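/- Let $\pi\colon B\to M$ be a smooth fibre bundle, where $M$, $B$ and the fibre are finite-dimensional smooth Hausdorff manifolds without boundary. **Spaces.** Let $\Gamma_{\mathrm g}(\pi)$ be the set of pairs $(x,[\sigma]^{\mathrm g}_x)$ of a point $x\in M$ and the germ at $x$ of a smooth local section $\sigma$ of $\pi$ defined near $x$. It carries the quotient of the diffeology on the set of pairs $(x,\sigma)$, $x\in\operatorname{dom}\sigma$, in which $u\mapsto(x_u,\sigma_u)$ is a plot iff $u\mapsto x_u$ is smooth and for all $u_0$ and $y_0\in\operatorname{dom}\sigma_{u_0}$ there are open neighbourhoods $V$ of $u_0$ and $O$ of $y_0$ such that $O\subseteq\operatorname{dom}\sigma_u$ for all $u\in V$ and $(u,y)\mapsto\sigma_u(y)$ is smooth on $V\times O$. For $0\le k<\infty$ let $\Gamma_k(\pi)$ be the manifold of $k$-jets $(x,[\sigma]^k_x)$, so that $\Gamma_0(\pi)=B$, and let $\Gamma_\infty(\pi)=\varprojlim_k\Gamma_k(\pi)$. Write $\pi^{k,\mathrm g}\colon\Gamma_{\mathrm g}(\pi)\to\Gamma_k(\pi)$ and $\pi^{l,k}\colon\Gamma_k(\pi)\to\Gamma_l(\pi)$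 ($l\le k\le\infty$) for the canonical projections. Tangent spaces and differentials are taken in the sense of internal tangent spaces of diffeological spaces (which for manifolds are the usual ones); the tangent bundle of $\Gamma_\infty(\pi)$ is $\varprojlim_kT\Gamma_k(\pi)$. **Prolongations.** A (possibly time-dependent) smooth vector field $X$ on $B$ is projectable if there is a smooth vector field $\pi_*X$ on $M$ with $d\pi\circ X=\pi_*X\circ\pi$. Let $\mathrm{Fl}^Z_{t,t_0}$ denote the flow of a vector field $Z$ from time $t_0$ to time $t$. For such $X$, and for $k=\mathrm g$ or $0\le k<\infty$, put $$\mathfrak p^{k}(X)\big(x,[\sigma]^{k}_x\big)=\frac{d}{dt}\Big|_{t=0}\Big(\mathrm{Fl}^{\pi_*X}_{t,0}(x),\ \big[\mathrm{Fl}^X_{t,0}\circ\sigma\circ\mathrm{Fl}^{\pi_*X}_{0,t}\big]^{k}_{\mathrm{Fl}^{\pi_*X}_{t,0}(x)}\Big),$$ and let $\mathfrak p^\infty(X)$ be the pointwise projective limit of the $\mathfrak p^k(X)$, $k<\infty$. Let $\mathfrak X_{\mathrm{proj}}(B)$ be the set of time-independent projectable vector fields and $\mathfrak X_{\mathrm{proj}}(\Gamma_k(\pi))$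 its image under $\mathfrak p^k$, for $k\in\{0,1,\dots,\infty,\mathrm g\}$. **Proposition.** The curves in the definition of $\mathfrak p^k(X)$ are defined and smooth for small $|t|$, $\mathfrak p^k(X)$ does not depend on the choice of $\sigma$, $\mathfrak p^\infty(X)$ is a section of $\varprojlim_kT\Gamma_k(\pi)$, and the maps $\pi^{k,\mathrm g}$ are smooth. For every $k\le\infty$ and every (possibly time-dependent) projectable vector field $X$ on $B$, $$d\pi^{k,\mathrm g}\circ\mathfrak p^{\mathrm g}(X)=\mathfrak p^k(X)\circ\pi^{k,\mathrm g};$$ for $k=0$, under $\Gamma_0(\pi)=B$, this reads $d\pi^{0,\mathrm g}\circ\mathfrak p^{\mathrm g}(X)=X_{t=0}\circ\pi^{0,\mathrm g}$. Consequently the tower of prolongations extends to germs: for all $l\le k\le\infty$ there are maps $$(\pi^{k,\mathrm g})_*\colon\mathfrak X_{\mathrm{proj}}(\Gamma_{\mathrm g}(\pi))\to\mathfrak X_{\mathrm{proj}}(\Gamma_k(\pi)),\qquad(\pi^{l,k})_*\colon\mathfrak X_{\mathrm{proj}}(\Gamma_k(\pi))\to\mathfrak X_{\mathrm{proj}}(\Gamma_l(\pi)),$$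 together with $\mathfrak X_{\mathrm{proj}}(\Gamma_0(\pi))\to\mathfrak X_{\mathrm{proj}}(B)$, each sending a field $V$ to the unique field of its target to which $V$ projects; they are compatible with composition of the projections, and $(\pi^{k,\mathrm g})_*\circ\mathfrak p^{\mathrm g}=\mathfrak p^k$, $(\pi^{l,k})_*\circ\mathfrak p^k=\mathfrak p^l$, while the map to $\mathfrak X_{\mathrm{proj}}(B)$ sends $\mathfrak p^0(X)$ to $X$. -/

import Mathlib

open scoped Manifold ContDiff Topology
open Diffeology

noncomputable section

namespace GermBundle

/-- The parameter spaces of plots. -/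
abbrev Euc (n : ℕ) : Type := EuclideanSpace ℝ (Fin n)

/-! ### Diffeological preliminaries -/

section Plots

variable {X Y : Type*}

/-- A plot of `X` with open domain `U ⊆ ℝⁿ` (the values of `p` outside `U` are irrelevant). Mathlib's
diffeologies only record the plots defined on all of `ℝⁿ`; those defined on `U` are the maps whose
composites with all smooth `ℝᵐ → U` are plots. -/
def IsPlotOn [DiffeologicalSpace X] {n : ℕ} (U : Set (Euc n)) (p : Euc n → X) : Prop :=
  ∀ ⦃m : ℕ⦄ (f : Euc m → Euc n), (∀ x, f x ∈ U) → ContDiff ℝ ∞ f → IsPlot (p ∘ f)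

theorem isPlotOn_univ [DiffeologicalSpace X] {n : ℕ} {p : Euc n → X} :
    IsPlotOn Set.univ p ↔ IsPlot p :=
  ⟨fun h => h id (fun _ => Set.mem_univ _) contDiff_id, fun h _ _ _ hf => isPlot_reparam h hf⟩

theorem IsPlotOn.congr [DiffeologicalSpace X] {n : ℕ} {U : Set (Euc n)} {p q : Euc n → X}
    (hp : IsPlotOn U p) (h : Set.EqOn p q U) : IsPlotOn U q := by
  intro m f hf hs
  have : q ∘ f = p ∘ f := funext fun x => (h (hf x)).symm
  rw [this]
  exact hp f hf hs

theorem IsPlotOn.comp [DiffeologicalSpace X] {n m : ℕ} {U : Set (Euc n)} {V : Set (Euc m)}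
    {p : Euc n → X} {f : Euc m → Euc n} (hp : IsPlotOn U p) (hf : ContDiffOn ℝ ∞ f V)
    (h : Set.MapsTo f V U) : IsPlotOn V (p ∘ f) := by
  intro l g hg hs
  refine hp (f ∘ g) (fun x => h (hg x)) ?_
  exact hf.comp_contDiff hs hg

theorem IsPlotOn.dSmooth_comp [DiffeologicalSpace X] [DiffeologicalSpace Y] {n : ℕ}
    {U : Set (Euc n)} {p : Euc n → X} {f : X → Y} (hp : IsPlotOn U p) (hf : DSmooth f) :
    IsPlotOn U (f ∘ p) :=
  fun _ g hg hs => hf _ _ (hp g hg hs)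

/-- For a diffeology that is given by its plots on open sets, `IsPlotOn` returns these plots. -/
theorem isPlotOn_ofCorePlotsOn (d : DiffeologicalSpace.CorePlotsOn X) {n : ℕ} {U : Set (Euc n)}
    (hU : IsOpen U) {p : Euc n → X} :
    @IsPlotOn X (DiffeologicalSpace.ofCorePlotsOn d) n U p ↔ d.isPlotOn hU p := by
  constructor
  · intro h
    refine d.locality hU fun x hx => ?_
    obtain ⟨ε, hε, hεU⟩ := Metric.isOpen_iff.mp hU x hx
    have h1 : d.isPlot (p ∘ OpenPartialHomeomorph.univBall x ε) := by
      refine h _ (fun y => hεU ?_) OpenPartialHomeomorph.contDiff_univBall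
      have := (OpenPartialHomeomorph.univBall x ε).map_source (x := y)
      rw [OpenPartialHomeomorph.univBall_target x hε] at this
      exact this (by simp)
    have h2 := d.isPlotOn_reparam Metric.isOpen_ball (Set.mapsTo_univ _ _)
      (d.isPlotOn_univ.mpr h1) (OpenPartialHomeomorph.contDiffOn_univBall_symm (c := x) (r := ε))
    refine ⟨_, Metric.isOpen_ball, Metric.mem_ball_self hε, (d.isPlotOn_congr _ ?_).mp h2⟩
    intro y hy
    have : OpenPartialHomeomorph.univBall x ε ((OpenPartialHomeomorph.univBall x ε).symm y) = y :=
      (OpenPartialHomeomorph.univBall x ε).right_inv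
        (by rwa [OpenPartialHomeomorph.univBall_target x hε])
    simp [this]
  · intro h m f hf hs
    exact d.isPlotOn_univ.mp (d.isPlotOn_reparam _ (fun x _ => hf x) h hs.contDiffOn)

/-- The pushforward diffeology along `f : X → Y`: its plots are locally constant or locally of the
form `f ∘ P` for a plot `P` of `X`. -/
@[reducible]
def pushforwardDiffeology [DiffeologicalSpace X] (f : X → Y) : DiffeologicalSpace Y :=
  .ofCorePlotsOn {
    isPlotOn := fun {n} {U} _ p => ∀ u ∈ U, ∃ V : Set (Euc n), IsOpen V ∧ u ∈ V ∧ V ⊆ U ∧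
      ((∃ y, ∀ v ∈ V, p v = y) ∨ ∃ P : Euc n → X, IsPlotOn V P ∧ ∀ v ∈ V, p v = f (P v))
    isPlotOn_congr := by
      have key : ∀ {n : ℕ} {U : Set (Euc n)} {p q : Euc n → Y}, Set.EqOn p q U →
          (∀ u ∈ U, ∃ V : Set (Euc n), IsOpen V ∧ u ∈ V ∧ V ⊆ U ∧
            ((∃ y, ∀ v ∈ V, p v = y) ∨ ∃ P : Euc n → X, IsPlotOn V P ∧ ∀ v ∈ V, p v = f (P v))) →
          (∀ u ∈ U, ∃ V : Set (Euc n), IsOpen V ∧ u ∈ V ∧ V ⊆ U ∧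
            ((∃ y, ∀ v ∈ V, q v = y) ∨
              ∃ P : Euc n → X, IsPlotOn V P ∧ ∀ v ∈ V, q v = f (P v))) := by
        intro n U p q h hp u hu
        obtain ⟨V, hV, huV, hVU, h'⟩ := hp u hu
        refine ⟨V, hV, huV, hVU, ?_⟩
        rcases h' with ⟨y, hy⟩ | ⟨P, hP, hPf⟩
        · exact Or.inl ⟨y, fun v hv => (h (hVU hv)).symm.trans (hy v hv)⟩
        · exact Or.inr ⟨P, hP, fun v hv => (h (hVU hv)).symm.trans (hPf v hv)⟩
      intro n U hU p q h
      exact ⟨key h, key h.symm⟩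
    isPlot_const := fun x u _ =>
      ⟨Set.univ, isOpen_univ, Set.mem_univ _, subset_rfl, Or.inl ⟨x, fun _ _ => rfl⟩⟩
    isPlotOn_reparam := by
      intro n m U V hU hV p g hg hp hs u hu
      obtain ⟨W, hW, huW, hWU, h'⟩ := hp (g u) (hg hu)
      refine ⟨V ∩ g ⁻¹' W, hs.continuousOn.isOpen_inter_preimage hV hW, ⟨hu, huW⟩,
        Set.inter_subset_left, ?_⟩
      rcases h' with ⟨y, hy⟩ | ⟨P, hP, hPf⟩
      · exact Or.inl ⟨y, fun v hv => hy _ hv.2⟩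
      · exact Or.inr ⟨P ∘ g, hP.comp (hs.mono Set.inter_subset_left) (fun v hv => hv.2),
          fun v hv => hPf _ hv.2⟩
    locality := by
      intro n U hU p hp u hu
      obtain ⟨V, hV, huV, h⟩ := hp u hu
      obtain ⟨W, hW, huW, hWV, h'⟩ := h u huV
      refine ⟨W ∩ U, hW.inter hU, ⟨huW, hu⟩, Set.inter_subset_right, ?_⟩
      rcases h' with ⟨y, hy⟩ | ⟨P, hP, hPf⟩
      · exact Or.inl ⟨y, fun v hv => hy _ hv.1⟩
      · exact Or.inr ⟨P, hP.comp (f := id) contDiffOn_id (fun v hv => hv.1),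
          fun v hv => hPf _ hv.1⟩ }

end Plots

/-! ### Internal tangent spaces and differentials -/

section Tangent

variable {X Y : Type*} [DiffeologicalSpace X] [DiffeologicalSpace Y]

/-- A plot of `X` defined on an open neighbourhood `dom` of `0` in some `ℝⁿ` with value `x` at `0`. -/
structure CenteredPlot (x : X) where
  dim : ℕ
  dom : Set (Euc dim)
  isOpen_dom : IsOpen dom
  zero_mem : (0 : Euc dim) ∈ dom
  toFun : Euc dim → X
  isPlotOn : IsPlotOn dom toFun
  map_zero : toFun 0 = x

open Classical in
/-- The direct sum, over all plots centered at `x`, of the tangent spaces at `0` of their domains. -/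
abbrev PlotVectors (x : X) : Type _ := DirectSum (CenteredPlot x) (fun φ => Euc φ.dim)

open Classical in
/-- The vector `v` in the summand of `φ`. -/
def plotVector {x : X} (φ : CenteredPlot x) : Euc φ.dim →ₗ[ℝ] PlotVectors x :=
  DirectSum.lof ℝ (CenteredPlot x) (fun φ => Euc φ.dim) φ

/-- The subspace generated by the vectors `(f_* v)_φ - v_{φ ∘ f}`. -/
def plotRelations (x : X) : Submodule ℝ (PlotVectors x) :=
  Submodule.span ℝ {w | ∃ (φ ψ : CenteredPlot x) (f : Euc ψ.dim → Euc φ.dim) (v : Euc ψ.dim),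
    ContDiffOn ℝ ∞ f ψ.dom ∧ Set.MapsTo f ψ.dom φ.dom ∧ f 0 = 0 ∧
    Set.EqOn ψ.toFun (φ.toFun ∘ f) ψ.dom ∧
    w = plotVector φ (fderiv ℝ f 0 v) - plotVector ψ v}

/-- The internal tangent space of a diffeological space at `x`. -/
abbrev InternalTangentSpace (x : X) : Type _ := PlotVectors x ⧸ plotRelations x

/-- The class `φ_* v` of a vector `v` at the centre of a plot. -/
def plotClass {x : X} (φ : CenteredPlot x) : Euc φ.dim →ₗ[ℝ] InternalTangentSpace x :=
  (plotRelations x).mkQ ∘ₗ plotVector φ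

variable (X) in
/-- The (underlying set of the) internal tangent bundle. -/
abbrev InternalTangentBundle : Type _ := Σ x : X, InternalTangentSpace x

/-- Composition of a centered plot with a smooth map. -/
def CenteredPlot.map {f : X → Y} (hf : DSmooth f) {x : X} (φ : CenteredPlot x) :
    CenteredPlot (f x) where
  dim := φ.dim
  dom := φ.dom
  isOpen_dom := φ.isOpen_dom
  zero_mem := φ.zero_mem
  toFun := f ∘ φ.toFun
  isPlotOn := φ.isPlotOn.dSmooth_comp hf
  map_zero := congrArg f φ.map_zero

open Classical in
/-- The linear extension of `v_φ ↦ (f ∘ φ)_* v`. -/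
def differentialAux {f : X → Y} (hf : DSmooth f) (x : X) :
    PlotVectors x →ₗ[ℝ] InternalTangentSpace (f x) :=
  DirectSum.toModule ℝ (CenteredPlot x) _ (fun φ => plotClass (φ.map hf))

theorem differentialAux_plotVector {f : X → Y} (hf : DSmooth f) {x : X} (φ : CenteredPlot x)
    (v : Euc φ.dim) : differentialAux hf x (plotVector φ v) = plotClass (φ.map hf) v := by
  classical
  simp only [differentialAux, plotVector]
  exact DirectSum.toModule_lof (R := ℝ) (M := fun φ : CenteredPlot _ => Euc φ.dim) φ v

theorem plotRelations_le_ker {f : X → Y} (hf : DSmooth f) (x : X) :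
    plotRelations x ≤ LinearMap.ker (differentialAux hf x) := by
  refine Submodule.span_le.mpr ?_
  rintro _ ⟨φ, ψ, g, v, hg, hm, h0, he, rfl⟩
  simp only [SetLike.mem_coe, LinearMap.mem_ker, map_sub, differentialAux_plotVector]
  have : plotVector (φ.map hf) (fderiv ℝ g 0 v) - plotVector (ψ.map hf) v ∈
      plotRelations (f x) :=
    Submodule.subset_span ⟨φ.map hf, ψ.map hf, g, v, hg, hm, h0,
      fun u hu => congrArg f (he hu), rfl⟩
  have h := (Submodule.Quotient.mk_eq_zero (plotRelations (f x))).mpr this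
  exact h

/-- The differential at `x` of a smooth map of diffeological spaces:
`φ_* v ↦ (f ∘ φ)_* v`, extended linearly. -/
def differential {f : X → Y} (hf : DSmooth f) (x : X) :
    InternalTangentSpace x →ₗ[ℝ] InternalTangentSpace (f x) :=
  (plotRelations x).liftQ (differentialAux hf x) (plotRelations_le_ker hf x)

/-- The differential as a map of internal tangent bundles. -/
def internalTangentMap {f : X → Y} (hf : DSmooth f) : InternalTangentBundle X → InternalTangentBundle Y :=
  fun v => ⟨f v.1, differential hf v.1 v.2⟩

/-- `c` is a smooth curve through `x` at time `0`: its restriction to some interval `(-ε, ε)` is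
a plot, with value `x` at `0`. -/
def IsSmoothCurveAt (c : ℝ → X) (x : X) : Prop :=
  c 0 = x ∧ ∃ ε : ℝ, 0 < ε ∧ IsPlotOn {u : Euc 1 | |u 0| < ε} (fun u => c (u 0))

open Classical in
/-- The tangent vector `d/dt|₀ c(t)` at `x` of a curve through `x` (zero if `c` is not a smooth curve
through `x`). -/
def velocityAt (x : X) (c : ℝ → X) : InternalTangentSpace x :=
  if h : IsSmoothCurveAt c x then
    plotClass (x := x)
      { dim := 1
        dom := {u : Euc 1 | |u 0| < h.2.choose}
        isOpen_dom := isOpen_lt (by fun_prop) continuous_const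
        zero_mem := by simpa using h.2.choose_spec.1
        toFun := fun u => c (u 0)
        isPlotOn := h.2.choose_spec.2
        map_zero := by simpa using h.1 }
      (EuclideanSpace.single 0 1)
  else 0

end Tangent

/-! ### Manifolds as diffeological spaces -/

section Manifold

/-- A manifold `N` (modelled on `E`), regarded as a diffeological space. -/
def AsDiffeological (_E N : Type*) : Type _ := N

instance (E N : Type*) [TopologicalSpace N] : TopologicalSpace (AsDiffeological E N) :=
  inferInstanceAs (TopologicalSpace N)

instance (E N : Type*) [TopologicalSpace E] [TopologicalSpace N] [ChartedSpace E N] :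
    ChartedSpace E (AsDiffeological E N) :=
  inferInstanceAs (ChartedSpace E N)

variable (E : Type*) [NormedAddCommGroup E] [NormedSpace ℝ E]
  (N : Type*) [TopologicalSpace N] [ChartedSpace E N]

/-- The plots of a manifold are the smooth parametrisations. -/
def manifoldCorePlots : DiffeologicalSpace.CorePlotsOn (AsDiffeological E N) where
  isPlotOn := fun {n} {U} _ p =>
    ContMDiffOn 𝓘(ℝ, Euc n) 𝓘(ℝ, E) ∞ p U
  isPlotOn_congr := fun _ _ _ h => ⟨fun hp => hp.congr fun u hu => (h hu).symm,
    fun hq => hq.congr fun _ hu => h hu⟩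
  isPlot_const := fun _ => contMDiffOn_const
  isPlotOn_reparam := fun _ _ _ h hp hf => ContMDiffOn.comp hp hf.contMDiffOn h
  locality := fun _ _ h u hu => by
    obtain ⟨V, hV, huV, hp⟩ := h u hu
    exact (hp.contMDiffAt (hV.mem_nhds huV)).contMDiffWithinAt

instance : DiffeologicalSpace (AsDiffeological E N) := .ofCorePlotsOn (manifoldCorePlots E N)

variable {E N}

/-- The plot `φ` centered at `b` induces the linear map `v ↦ dφ₀ v` into the usual tangent space. -/
def plotDerivative {b : AsDiffeological E N} (φ : CenteredPlot b) :
    Euc φ.dim →ₗ[ℝ] TangentSpace 𝓘(ℝ, E) b :=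
  (show Euc φ.dim →L[ℝ] E from
    mfderiv 𝓘(ℝ, Euc φ.dim) 𝓘(ℝ, E) φ.toFun 0).toLinearMap

open Classical in
/-- The linear extension of `v_φ ↦ dφ₀ v`. -/
def toTangentSpaceAux (b : AsDiffeological E N) :
    PlotVectors b →ₗ[ℝ] TangentSpace 𝓘(ℝ, E) b :=
  DirectSum.toModule ℝ (CenteredPlot b) _ (fun φ => plotDerivative φ)

theorem toTangentSpaceAux_plotVector {b : AsDiffeological E N} (φ : CenteredPlot b)
    (v : Euc φ.dim) : toTangentSpaceAux b (plotVector φ v) = plotDerivative φ v := by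
  classical
  simp only [toTangentSpaceAux, plotVector]
  exact DirectSum.toModule_lof (R := ℝ) (M := fun φ : CenteredPlot _ => Euc φ.dim) φ v

theorem plotDerivative_comp {b : AsDiffeological E N} (φ ψ : CenteredPlot b)
    (f : Euc ψ.dim → Euc φ.dim) (v : Euc ψ.dim) (hf : ContDiffOn ℝ ∞ f ψ.dom)
    (h0 : f 0 = 0) (he : Set.EqOn ψ.toFun (φ.toFun ∘ f) ψ.dom) :
    plotDerivative φ (fderiv ℝ f 0 v) = plotDerivative ψ v := by
  have hψ : ψ.dom ∈ 𝓝 (0 : Euc ψ.dim) := ψ.isOpen_dom.mem_nhds ψ.zero_mem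
  have hφ : MDifferentiableAt 𝓘(ℝ, Euc φ.dim) 𝓘(ℝ, E) φ.toFun (f 0) := by
    have h1 : ContMDiffOn 𝓘(ℝ, Euc φ.dim) 𝓘(ℝ, E) ∞ φ.toFun φ.dom :=
      (isPlotOn_ofCorePlotsOn (manifoldCorePlots E N) φ.isOpen_dom).mp φ.isPlotOn
    rw [h0]
    exact (h1.contMDiffAt (φ.isOpen_dom.mem_nhds φ.zero_mem)).mdifferentiableAt (by simp)
  have hfd : DifferentiableAt ℝ f 0 := (hf.contDiffAt hψ).differentiableAt (by simp)
  have e1 : mfderiv 𝓘(ℝ, Euc ψ.dim) 𝓘(ℝ, E) ψ.toFun 0 =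
      mfderiv 𝓘(ℝ, Euc ψ.dim) 𝓘(ℝ, E) (φ.toFun ∘ f) 0 :=
    Filter.EventuallyEq.mfderiv_eq (Filter.eventuallyEq_of_mem hψ he)
  have e2 := mfderiv_comp (0 : Euc ψ.dim) hφ hfd.mdifferentiableAt
  have e3 : ∀ z : Euc φ.dim, z = 0 → ∀ w : Euc φ.dim,
      (mfderiv 𝓘(ℝ, Euc φ.dim) 𝓘(ℝ, E) φ.toFun z w : E) =
        (mfderiv 𝓘(ℝ, Euc φ.dim) 𝓘(ℝ, E) φ.toFun 0 w : E) := by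
    rintro _ rfl _
    rfl
  have e4 := congrArg (fun L : Euc ψ.dim →L[ℝ] E => L v) (e1.trans e2)
  refine Eq.trans (e3 (f 0) h0 _).symm (Eq.trans ?_ e4.symm)
  rw [mfderiv_eq_fderiv]
  rfl

/-- The canonical linear map (an isomorphism) from the internal tangent space of a manifold, as a
diffeological space, to its usual tangent space: `φ_* v ↦ dφ₀ v`. -/
def toTangentSpace (b : AsDiffeological E N) :
    InternalTangentSpace b →ₗ[ℝ] TangentSpace 𝓘(ℝ, E) b :=
  (plotRelations b).liftQ (toTangentSpaceAux b) <| by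
    refine Submodule.span_le.mpr ?_
    rintro _ ⟨φ, ψ, f, v, hf, -, h0, he, rfl⟩
    simp only [SetLike.mem_coe, LinearMap.mem_ker, map_sub, toTangentSpaceAux_plotVector,
      plotDerivative_comp φ ψ f v hf h0 he, sub_self]

/-- `toTangentSpace` as a map of tangent bundles. -/
def toTangentBundle (v : InternalTangentBundle (AsDiffeological E N)) :
    TangentBundle 𝓘(ℝ, E) N :=
  ⟨v.1, toTangentSpace v.1 v.2⟩

end Manifold

/-! ### Fibre bundles, sections, germs -/

section Bundle

variable (E EB EF : Type*)
  [NormedAddCommGroup E] [NormedSpace ℝ E]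
  [NormedAddCommGroup EB] [NormedSpace ℝ EB]
  [NormedAddCommGroup EF] [NormedSpace ℝ EF]
  {M B : Type*} [TopologicalSpace M] [ChartedSpace E M] [TopologicalSpace B] [ChartedSpace EB B]

/-- `π : B → M` is a smooth fibre bundle with fibre `F`. Here `E`, `EB`, `EF` are the spaces on which
`M`, `B`, `F` are modelled. -/
structure IsFibreBundle (F : Type*) [TopologicalSpace F] [ChartedSpace EF F] (π : B → M) :
    Prop where
  smooth : ContMDiff 𝓘(ℝ, EB) 𝓘(ℝ, E) ∞ π
  surjective : Function.Surjective π
  locally_trivial : ∀ x : M, ∃ e : Bundle.Trivialization F π, x ∈ e.baseSet ∧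
    ContMDiffOn 𝓘(ℝ, EB) (𝓘(ℝ, E).prod 𝓘(ℝ, EF)) ∞ e e.source ∧
    ContMDiffOn (𝓘(ℝ, E).prod 𝓘(ℝ, EF)) 𝓘(ℝ, EB) ∞ e.toOpenPartialHomeomorph.symm e.target

/-- A smooth section of `π` defined on an open set `dom` (its values outside `dom` are
irrelevant). -/
structure LocalSection (π : B → M) where
  dom : Set M
  isOpen_dom : IsOpen dom
  toFun : M → B
  smooth : ContMDiffOn 𝓘(ℝ, E) 𝓘(ℝ, EB) ∞ toFun dom
  proj : ∀ y ∈ dom, π (toFun y) = y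

/-- The space `Γ_loc` of pairs `(x, σ)` of a local section `σ` and a point `x` of its domain. -/
structure PointedSection (π : B → M) where
  pt : M
  sec : LocalSection E EB π
  mem : pt ∈ sec.dom

variable {E EB} in
/-- The value `σ(x)`. -/
def PointedSection.value {π : B → M} (p : PointedSection E EB π) : B := p.sec.toFun p.pt

/-- The diffeology of `Γ_loc` as a subspace of the product of `M` and of the space of local sections
with its functional diffeology. -/
def pointedSectionCorePlots (π : B → M) :
    DiffeologicalSpace.CorePlotsOn (PointedSection E EB π) where
  isPlotOn := fun {n} {U} _ p =>
    ContMDiffOn 𝓘(ℝ, Euc n) 𝓘(ℝ, E) ∞ (fun u => (p u).pt) U ∧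
    ∀ u₀ ∈ U, ∀ x₀ ∈ (p u₀).sec.dom, ∃ (V : Set (Euc n)) (O : Set M),
      IsOpen V ∧ u₀ ∈ V ∧ V ⊆ U ∧ IsOpen O ∧ x₀ ∈ O ∧ (∀ u ∈ V, O ⊆ (p u).sec.dom) ∧
      ContMDiffOn (𝓘(ℝ, Euc n).prod 𝓘(ℝ, E)) 𝓘(ℝ, EB) ∞
        (fun w : Euc n × M => (p w.1).sec.toFun w.2) (V ×ˢ O)
  isPlotOn_congr := by
    have key : ∀ {n : ℕ} {U : Set (Euc n)} {p q : Euc n → PointedSection E EB π},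
        Set.EqOn p q U →
        (ContMDiffOn 𝓘(ℝ, Euc n) 𝓘(ℝ, E) ∞ (fun u => (p u).pt) U ∧
          ∀ u₀ ∈ U, ∀ x₀ ∈ (p u₀).sec.dom, ∃ (V : Set (Euc n)) (O : Set M),
            IsOpen V ∧ u₀ ∈ V ∧ V ⊆ U ∧ IsOpen O ∧ x₀ ∈ O ∧ (∀ u ∈ V, O ⊆ (p u).sec.dom) ∧
            ContMDiffOn (𝓘(ℝ, Euc n).prod 𝓘(ℝ, E)) 𝓘(ℝ, EB) ∞
              (fun w : Euc n × M => (p w.1).sec.toFun w.2) (V ×ˢ O)) →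
        (ContMDiffOn 𝓘(ℝ, Euc n) 𝓘(ℝ, E) ∞ (fun u => (q u).pt) U ∧
          ∀ u₀ ∈ U, ∀ x₀ ∈ (q u₀).sec.dom, ∃ (V : Set (Euc n)) (O : Set M),
            IsOpen V ∧ u₀ ∈ V ∧ V ⊆ U ∧ IsOpen O ∧ x₀ ∈ O ∧ (∀ u ∈ V, O ⊆ (q u).sec.dom) ∧
            ContMDiffOn (𝓘(ℝ, Euc n).prod 𝓘(ℝ, E)) 𝓘(ℝ, EB) ∞
              (fun w : Euc n × M => (q w.1).sec.toFun w.2) (V ×ˢ O)) := by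
      rintro n U p q h ⟨h1, h2⟩
      refine ⟨h1.congr fun u hu => by rw [h hu], fun u₀ hu₀ x₀ hx₀ => ?_⟩
      rw [← h hu₀] at hx₀
      obtain ⟨V, O, hV, hu, hVU, hO, hx, hd, hs⟩ := h2 u₀ hu₀ x₀ hx₀
      refine ⟨V, O, hV, hu, hVU, hO, hx, fun u hu => by rw [← h (hVU hu)]; exact hd u hu,
        hs.congr fun w hw => by rw [h (hVU hw.1)]⟩
    intro n U hU p q h
    exact ⟨key h, key h.symm⟩
  isPlot_const := fun p => ⟨contMDiffOn_const, fun u₀ _ x₀ hx₀ =>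
    ⟨Set.univ, p.sec.dom, isOpen_univ, Set.mem_univ _, subset_rfl, p.sec.isOpen_dom, hx₀,
      fun _ _ => subset_rfl, p.sec.smooth.comp contMDiffOn_snd fun w hw => hw.2⟩⟩
  isPlotOn_reparam := by
    rintro n m U V hU hV p f hf ⟨h1, h2⟩ hs
    refine ⟨h1.comp hs.contMDiffOn hf, fun u₀ hu₀ x₀ hx₀ => ?_⟩
    obtain ⟨W, O, hW, hu, hWU, hO, hx, hd, hsm⟩ := h2 (f u₀) (hf hu₀) x₀ hx₀
    refine ⟨V ∩ f ⁻¹' W, O, hs.continuousOn.isOpen_inter_preimage hV hW, ⟨hu₀, hu⟩,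
      Set.inter_subset_left, hO, hx, fun u hu => hd _ hu.2, ?_⟩
    have hfst : ContMDiffOn (𝓘(ℝ, Euc m).prod 𝓘(ℝ, E)) 𝓘(ℝ, Euc n) ∞
        (fun w : Euc m × M => f w.1) ((V ∩ f ⁻¹' W) ×ˢ O) :=
      hs.contMDiffOn.comp contMDiffOn_fst fun w hw => hw.1.1
    exact hsm.comp (hfst.prodMk contMDiffOn_snd) fun w hw => ⟨hw.1.2, hw.2⟩
  locality := by
    intro n U hU p hp
    refine ⟨fun u hu => ?_, fun u₀ hu₀ x₀ hx₀ => ?_⟩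
    · obtain ⟨V, hV, huV, h⟩ := hp u hu
      exact (h.1.contMDiffAt (hV.mem_nhds huV)).contMDiffWithinAt
    · obtain ⟨V, hV, huV, h⟩ := hp u₀ hu₀
      obtain ⟨W, O, hW, hu, hWV, hO, hx, hd, hs⟩ := h.2 u₀ huV x₀ hx₀
      exact ⟨W ∩ U, O, hW.inter hU, ⟨hu, hu₀⟩, Set.inter_subset_right, hO, hx,
        fun u hu => hd u hu.1, hs.mono (Set.prod_mono Set.inter_subset_left subset_rfl)⟩

instance (π : B → M) : DiffeologicalSpace (PointedSection E EB π) :=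
  .ofCorePlotsOn (pointedSectionCorePlots E EB π)

/-- `(x, σ) ∼ (y, η)` iff `x = y` and `σ`, `η` have the same germ at `x`. -/
def germSetoid (π : B → M) : Setoid (PointedSection E EB π) where
  r p q := p.pt = q.pt ∧ p.sec.toFun =ᶠ[𝓝 p.pt] q.sec.toFun
  iseqv :=
    { refl := fun _ => ⟨rfl, Filter.EventuallyEq.rfl⟩
      symm := fun h => ⟨h.1.symm, h.1 ▸ h.2.symm⟩
      trans := fun h h' => ⟨h.1.trans h'.1, h.2.trans (h.1 ▸ h'.2)⟩ }

/-- The bundle of germs `Γ_g(π)`. -/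
def Germ (π : B → M) : Type _ := Quotient (germSetoid E EB π)

variable {E EB} in
/-- The germ `(x, [σ]ᵍₓ)`. -/
def germ {π : B → M} (p : PointedSection E EB π) : Germ E EB π := Quotient.mk (germSetoid E EB π) p

/-- `Γ_g(π)` carries the quotient diffeology. -/
instance (π : B → M) : DiffeologicalSpace (Germ E EB π) := pushforwardDiffeology germ

/-! ### Jets -/

/-- Fibred local coordinates `b ↦ (x, f)` of `B` with values in `E × EF`, lying over local
coordinates `x` of `M`. -/
structure FibredChart (π : B → M) where
  base : OpenPartialHomeomorph M E
  total : OpenPartialHomeomorph B (E × EF)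
  base_smooth : ContMDiffOn 𝓘(ℝ, E) 𝓘(ℝ, E) ∞ base base.source
  base_symm_smooth : ContMDiffOn 𝓘(ℝ, E) 𝓘(ℝ, E) ∞ base.symm base.target
  total_smooth : ContMDiffOn 𝓘(ℝ, EB) 𝓘(ℝ, E × EF) ∞ total total.source
  total_symm_smooth : ContMDiffOn 𝓘(ℝ, E × EF) 𝓘(ℝ, EB) ∞ total.symm total.target
  proj : ∀ b ∈ total.source, π b ∈ base.source ∧ (total b).1 = base (π b)

variable {E EB EF} in
/-- The collection of all partial derivatives of order `j` at `x` of the coordinate expression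
`f ∘ σ ∘ x⁻¹` of a section `σ`. -/
def FibredChart.deriv {π : B → M} (c : FibredChart E EB EF π) (j : ℕ)
    (p : PointedSection E EB π) : E [×j]→L[ℝ] EF :=
  iteratedFDeriv ℝ j (fun z => (c.total (p.sec.toFun (c.base.symm z))).2) (c.base p.pt)

/-- `(x, σ) ∼ (y, η)` iff `x = y` and `σ`, `η` have the same `k`-jet at `x`. -/
def jetSetoid (π : B → M) (k : ℕ) : Setoid (PointedSection E EB π) where
  r p q := p.pt = q.pt ∧ p.value = q.value ∧
    ∀ c : FibredChart E EB EF π, p.value ∈ c.total.source → ∀ j ≤ k, c.deriv j p = c.deriv j q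
  iseqv :=
    { refl := fun _ => ⟨rfl, rfl, fun _ _ _ _ => rfl⟩
      symm := fun h => ⟨h.1.symm, h.2.1.symm, fun c hc j hj => (h.2.2 c (h.2.1 ▸ hc) j hj).symm⟩
      trans := fun h h' => ⟨h.1.trans h'.1, h.2.1.trans h'.2.1, fun c hc j hj =>
        (h.2.2 c hc j hj).trans (h'.2.2 c (h.2.1 ▸ hc) j hj)⟩ }

/-- The bundle `Γ_k(π)` of `k`-jets of local sections, for finite `k`. -/
def Jet (π : B → M) (k : ℕ) : Type _ := Quotient (jetSetoid E EB EF π k)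

variable {E EB}

/-- The `k`-jet `(x, [σ]ᵏₓ)`. -/
def jet {π : B → M} (k : ℕ) (p : PointedSection E EB π) : Jet E EB EF π k :=
  Quotient.mk (jetSetoid E EB EF π k) p

variable {EF}

/-- The projection `Γ_k(π) → M`. -/
def jetPt {π : B → M} {k : ℕ} (θ : Jet E EB EF π k) : M :=
  Quotient.lift (s := jetSetoid E EB EF π k) (fun p => p.pt) (fun _ _ h => h.1) θ

/-- The projection `Γ_k(π) → B`, `[σ]ᵏₓ ↦ σ(x)`. -/
def jetValue {π : B → M} {k : ℕ} (θ : Jet E EB EF π k) : AsDiffeological EB B :=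
  Quotient.lift (s := jetSetoid E EB EF π k) (fun p => p.value) (fun _ _ h => h.2.1) θ

open Classical in
/-- The jet coordinates of order `j ≤ k` over the domain of a fibred chart (zero over the complement
of this domain). -/
def jetCoord {π : B → M} {k : ℕ} (c : FibredChart E EB EF π) (j : ℕ) (hj : j ≤ k)
    (θ : Jet E EB EF π k) : E [×j]→L[ℝ] EF :=
  Quotient.lift (s := jetSetoid E EB EF π k)
    (fun p => if p.value ∈ c.total.source then c.deriv j p else 0)
    (fun p q h => by
      show (if p.value ∈ c.total.source then c.deriv j p else 0) =
        (if q.value ∈ c.total.source then c.deriv j q else 0)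
      by_cases hp : p.value ∈ c.total.source
      · rw [if_pos hp, if_pos (h.2.1 ▸ hp), h.2.2 c hp j hj]
      · rw [if_neg hp, if_neg (h.2.1 ▸ hp)]) θ

variable (E EB EF)

/-- The manifold diffeology of `Γ_k(π)`: a parametrisation is smooth iff for every fibred chart its
preimage is open and the jet coordinates `(x, f, ∂f, …, ∂ᵏf)` depend smoothly on the parameter
there. -/
def jetCorePlots (π : B → M) (k : ℕ) : DiffeologicalSpace.CorePlotsOn (Jet E EB EF π k) where
  isPlotOn := fun {_} {U} _ p => ∀ c : FibredChart E EB EF π,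
    IsOpen (U ∩ {u | jetValue (p u) ∈ c.total.source}) ∧
    ContDiffOn ℝ ∞ (fun u => c.base (jetPt (p u))) (U ∩ {u | jetValue (p u) ∈ c.total.source}) ∧
    ∀ (j : ℕ) (hj : j ≤ k), ContDiffOn ℝ ∞ (fun u => jetCoord c j hj (p u))
      (U ∩ {u | jetValue (p u) ∈ c.total.source})
  isPlotOn_congr := by
    have key : ∀ {n : ℕ} {U : Set (Euc n)} {p q : Euc n → Jet E EB EF π k}, Set.EqOn p q U →
        (∀ c : FibredChart E EB EF π,
          IsOpen (U ∩ {u | jetValue (p u) ∈ c.total.source}) ∧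
          ContDiffOn ℝ ∞ (fun u => c.base (jetPt (p u)))
            (U ∩ {u | jetValue (p u) ∈ c.total.source}) ∧
          ∀ (j : ℕ) (hj : j ≤ k), ContDiffOn ℝ ∞ (fun u => jetCoord c j hj (p u))
            (U ∩ {u | jetValue (p u) ∈ c.total.source})) →
        (∀ c : FibredChart E EB EF π,
          IsOpen (U ∩ {u | jetValue (q u) ∈ c.total.source}) ∧
          ContDiffOn ℝ ∞ (fun u => c.base (jetPt (q u)))
            (U ∩ {u | jetValue (q u) ∈ c.total.source}) ∧
          ∀ (j : ℕ) (hj : j ≤ k), ContDiffOn ℝ ∞ (fun u => jetCoord c j hj (q u))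
            (U ∩ {u | jetValue (q u) ∈ c.total.source})) := by
      intro n U p q h hp c
      have hset : U ∩ {u | jetValue (q u) ∈ c.total.source} =
          U ∩ {u | jetValue (p u) ∈ c.total.source} := by
        ext u
        refine and_congr_right fun hu => ?_
        rw [Set.mem_ofPred_eq, Set.mem_ofPred_eq, h hu]
      obtain ⟨h1, h2, h3⟩ := hp c
      rw [hset]
      exact ⟨h1, h2.congr fun u hu => by rw [h hu.1],
        fun j hj => (h3 j hj).congr fun u hu => by rw [h hu.1]⟩
    intro n U hU p q h
    exact ⟨key h, key h.symm⟩
  isPlot_const := fun θ c =>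
    ⟨isOpen_univ.inter isOpen_const, contDiffOn_const, fun _ _ => contDiffOn_const⟩
  isPlotOn_reparam := by
    intro n m U V hU hV p f hf hp hs c
    obtain ⟨h1, h2, h3⟩ := hp c
    have hset : V ∩ {u | jetValue ((p ∘ f) u) ∈ c.total.source} =
        V ∩ f ⁻¹' (U ∩ {u | jetValue (p u) ∈ c.total.source}) := by
      ext u
      exact ⟨fun hu => ⟨hu.1, hf hu.1, hu.2⟩, fun hu => ⟨hu.1, hu.2.2⟩⟩
    rw [hset]
    have hs' := hs.mono (Set.inter_subset_left (s := V)
      (t := f ⁻¹' (U ∩ {u | jetValue (p u) ∈ c.total.source})))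
    exact ⟨hs.continuousOn.isOpen_inter_preimage hV h1, h2.comp hs' fun u hu => hu.2,
      fun j hj => (h3 j hj).comp hs' fun u hu => hu.2⟩
  locality := by
    intro n U hU p hp c
    have hnhds : ∀ u ∈ U ∩ {u | jetValue (p u) ∈ c.total.source}, ∃ V : Set (Euc n), IsOpen V ∧
        u ∈ V ∧ V ⊆ {u | jetValue (p u) ∈ c.total.source} ∧
        ContDiffOn ℝ ∞ (fun u => c.base (jetPt (p u))) V ∧
        ∀ (j : ℕ) (hj : j ≤ k), ContDiffOn ℝ ∞ (fun u => jetCoord c j hj (p u)) V := by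
      intro u hu
      obtain ⟨V, hV, huV, h⟩ := hp u hu.1
      exact ⟨_, (h c).1, ⟨huV, hu.2⟩, Set.inter_subset_right, (h c).2⟩
    refine ⟨isOpen_iff_mem_nhds.mpr fun u hu => ?_, fun u hu => ?_, fun j hj u hu => ?_⟩
    · obtain ⟨V, hV, huV, hVs, -⟩ := hnhds u hu
      exact Filter.inter_mem (hU.mem_nhds hu.1) (Filter.mem_of_superset (hV.mem_nhds huV) hVs)
    · obtain ⟨V, hV, huV, -, h, -⟩ := hnhds u hu
      exact (h.contDiffAt (hV.mem_nhds huV)).contDiffWithinAt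
    · obtain ⟨V, hV, huV, -, -, h⟩ := hnhds u hu
      exact ((h j hj).contDiffAt (hV.mem_nhds huV)).contDiffWithinAt

instance (π : B → M) (k : ℕ) : DiffeologicalSpace (Jet E EB EF π k) :=
  .ofCorePlotsOn (jetCorePlots E EB EF π k)

/-- The projection `Γ_k(π) → Γ_l(π)` for `l ≤ k`. -/
def jetProj (π : B → M) {l k : ℕ} (h : l ≤ k) : Jet E EB EF π k → Jet E EB EF π l :=
  Quotient.map' (s₁ := jetSetoid E EB EF π k) (s₂ := jetSetoid E EB EF π l) id
    fun _ _ hpq => ⟨hpq.1, hpq.2.1, fun c hc j hj => hpq.2.2 c hc j (hj.trans h)⟩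

theorem dSmooth_jetProj (π : B → M) {l k : ℕ} (h : l ≤ k) : DSmooth (jetProj E EB EF π h) := by
  intro n p hp c
  have hv : ∀ θ : Jet E EB EF π k, jetValue (jetProj E EB EF π h θ) = jetValue θ := by
    rintro ⟨p⟩
    rfl
  have hx : ∀ θ : Jet E EB EF π k, jetPt (jetProj E EB EF π h θ) = jetPt θ := by
    rintro ⟨p⟩
    rfl
  have hc : ∀ (j : ℕ) (hj : j ≤ l) (θ : Jet E EB EF π k),
      jetCoord c j hj (jetProj E EB EF π h θ) = jetCoord c j (hj.trans h) θ := by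
    rintro j hj ⟨p⟩
    rfl
  obtain ⟨h1, h2, h3⟩ := hp c
  simp only [Function.comp_apply, hv, hx, hc]
  exact ⟨h1, h2, fun j hj => h3 j (hj.trans h)⟩

/-- The infinite jet bundle `Γ_∞(π)`: the projective limit of the `Γ_k(π)`. -/
def JetInf (π : B → M) : Type _ :=
  {θ : ∀ k, Jet E EB EF π k // ∀ (l k : ℕ) (h : l ≤ k), jetProj E EB EF π h (θ k) = θ l}

/-- The projection `Γ_∞(π) → Γ_k(π)`. -/
def jetInfProj (π : B → M) (k : ℕ) (θ : JetInf E EB EF π) : Jet E EB EF π k := θ.1 k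

/-- `Γ_∞(π)` carries the projective limit diffeology. -/
instance (π : B → M) : DiffeologicalSpace (JetInf E EB EF π) where
  plots _ := {p | ∀ k, IsPlot (jetInfProj E EB EF π k ∘ p)}
  constant_plots _ := fun _ => isPlot_const
  plot_reparam hp hf := fun k => isPlot_reparam (hp k) hf
  locality {n p} h := fun k => DiffeologicalSpace.locality fun x => by
    obtain ⟨u, hu, hxu, h'⟩ := h x
    exact ⟨u, hu, hxu, fun hfu hf => h' hfu hf k⟩

theorem dSmooth_jetInfProj (π : B → M) (k : ℕ) : DSmooth (jetInfProj E EB EF π k) :=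
  fun _ _ hp => hp k

/-- Sections with the same germ have the same `k`-jet. -/
theorem jet_eq_of_germ_eq {π : B → M} (k : ℕ) (p q : PointedSection E EB π)
    (h : germSetoid E EB π p q) : jet EF k p = jet EF k q := by
  obtain ⟨hpt, hpq⟩ := h
  have hval : p.value = q.value := by
    unfold PointedSection.value
    rw [← hpt]
    exact hpq.eq_of_nhds
  refine Quotient.sound (s := jetSetoid E EB EF π k) ⟨hpt, hval, fun c hc j _ => ?_⟩
  have hb : p.pt ∈ c.base.source := by
    have := (c.proj _ hc).1
    rwa [PointedSection.value, p.sec.proj _ p.mem] at this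
  have ht : Filter.Tendsto c.base.symm (𝓝 (c.base p.pt)) (𝓝 p.pt) := by
    have := (c.base.continuousAt_symm (c.base.map_source hb)).tendsto
    rwa [c.base.left_inv hb] at this
  unfold FibredChart.deriv
  rw [← hpt]
  refine Filter.EventuallyEq.eq_of_nhds (Filter.EventuallyEq.iteratedFDeriv ℝ ?_ j)
  filter_upwards [ht.eventually hpq] with z hz
  rw [hz]

/-- The projection `π^{k,g} : Γ_g(π) → Γ_k(π)` for finite `k`. -/
def germToJet (π : B → M) (k : ℕ) (γ : Germ E EB π) : Jet E EB EF π k :=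
  Quotient.lift (s := germSetoid E EB π) (jet EF k) (jet_eq_of_germ_eq E EB EF k) γ

/-- The projection `π^{∞,g} : Γ_g(π) → Γ_∞(π)`. -/
def germToJetInf (π : B → M) (γ : Germ E EB π) : JetInf E EB EF π :=
  ⟨fun k => germToJet E EB EF π k γ, fun l k h => by
    obtain ⟨p⟩ := γ
    rfl⟩

/-- The projective limit of the tangent bundles of the `Γ_k(π)`, as a set of families of tangent
vectors. -/
def jetInfTangent (π : B → M) : Set (∀ k, InternalTangentBundle (Jet E EB EF π k)) :=
  {v | ∀ (l k : ℕ) (h : l ≤ k), internalTangentMap (dSmooth_jetProj E EB EF π h) (v k) = v l}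

/-- The canonical map from the internal tangent bundle of `Γ_∞(π)` to the projective limit of the
tangent bundles of the `Γ_k(π)`. -/
def jetInfTangentComparison (π : B → M) (v : InternalTangentBundle (JetInf E EB EF π)) :
    ∀ k, InternalTangentBundle (Jet E EB EF π k) :=
  fun k => internalTangentMap (dSmooth_jetInfProj E EB EF π k) v

/-! ### Flows and prolongations -/

/-- `X` is a smooth time-dependent vector field on the manifold `N`. -/
def IsSmoothField (E : Type*) [NormedAddCommGroup E] [NormedSpace ℝ E] {N : Type*}
    [TopologicalSpace N] [ChartedSpace E N] [IsManifold 𝓘(ℝ, E) ∞ N]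
    (X : ℝ → ∀ y : N, TangentSpace 𝓘(ℝ, E) y) : Prop :=
  ContMDiff (𝓘(ℝ, ℝ).prod 𝓘(ℝ, E)) 𝓘(ℝ, E).tangent ∞
    (fun w : ℝ × N => (⟨w.2, X w.1 w.2⟩ : TangentBundle 𝓘(ℝ, E) N))

/-- `Fl^X_{t,t₀}(x)` is defined and equal to `y`: some integral curve of the time-dependent vector
field `X`, defined on an open interval containing `t₀` and `t`, takes the values `x` at `t₀` and `y`
at `t`. -/
def FlowsTo (E : Type*) [NormedAddCommGroup E] [NormedSpace ℝ E] {N : Type*}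
    [TopologicalSpace N] [ChartedSpace E N] (X : ℝ → ∀ y : N, TangentSpace 𝓘(ℝ, E) y)
    (t₀ : ℝ) (x : N) (t : ℝ) (y : N) : Prop :=
  ∃ (c : ℝ → N) (a b : ℝ), t₀ ∈ Set.Ioo a b ∧ t ∈ Set.Ioo a b ∧ c t₀ = x ∧ c t = y ∧
    ∀ s ∈ Set.Ioo a b, HasMFDerivAt 𝓘(ℝ, ℝ) 𝓘(ℝ, E) c s
      ((1 : ℝ →L[ℝ] ℝ).smulRight (X s (c s) : E))

variable [IsManifold 𝓘(ℝ, E) ∞ M] [IsManifold 𝓘(ℝ, EB) ∞ B]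

/-- A (possibly time-dependent) projectable vector field `total` on `B`, together with the vector
field `base` on `M` to which it projects (`base` is determined by `total`, as `π` is surjective). -/
structure ProjectableField (π : B → M) where
  total : ℝ → ∀ b : B, TangentSpace 𝓘(ℝ, EB) b
  base : ℝ → ∀ x : M, TangentSpace 𝓘(ℝ, E) x
  total_smooth : IsSmoothField EB total
  base_smooth : IsSmoothField E base
  related : ∀ (t : ℝ) (b : B), mfderiv 𝓘(ℝ, EB) 𝓘(ℝ, E) π b (total t b) = base t (π b)

/-- The set `𝔛_proj(B)` of time-independent projectable vector fields. -/
def AutonomousField (π : B → M) : Type _ :=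
  {X : ProjectableField E EB π // ∀ t, X.total t = X.total 0}

variable {E EB}

/-- `(y, τ)` represents the germ of `Fl^X_{t,0} ∘ σ ∘ Fl^{π_*X}_{0,t}` at `y = Fl^{π_*X}_{t,0}(x)`. -/
def IsTransport {π : B → M} (X : ProjectableField E EB π) (p : PointedSection E EB π) (t : ℝ)
    (q : PointedSection E EB π) : Prop :=
  FlowsTo E X.base 0 p.pt t q.pt ∧
  ∀ᶠ y in 𝓝 q.pt, ∃ z ∈ p.sec.dom, FlowsTo E X.base t y 0 z ∧
    FlowsTo EB X.total 0 (p.sec.toFun z) t (q.sec.toFun y)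

open Classical in
/-- A representative of the germ of `Fl^X_{t,0} ∘ σ ∘ Fl^{π_*X}_{0,t}` at `Fl^{π_*X}_{t,0}(x)`, where
it exists (and `(x, σ)` where it does not). -/
def transport {π : B → M} (X : ProjectableField E EB π) (p : PointedSection E EB π) (t : ℝ) :
    PointedSection E EB π :=
  if h : ∃ q, IsTransport X p t q then h.choose else p

/-- The germinal prolongation `𝔭ᵍ(X)`, a section of the internal tangent bundle of `Γ_g(π)`. -/
def germProlongation {π : B → M} (X : ProjectableField E EB π) (γ : Germ E EB π) :
    InternalTangentBundle (Germ E EB π) :=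
  ⟨γ, velocityAt γ (fun t => germ (transport X (Quotient.out γ) t))⟩

variable {EF}

/-- The `k`-jet prolongation `𝔭ᵏ(X)` for finite `k`, a section of the tangent bundle of `Γ_k(π)`. -/
def jetProlongation {π : B → M} (k : ℕ) (X : ProjectableField E EB π) (θ : Jet E EB EF π k) :
    InternalTangentBundle (Jet E EB EF π k) :=
  ⟨θ, velocityAt θ (fun t => jet EF k (transport X (Quotient.out θ) t))⟩

/-- The `∞`-jet prolongation `𝔭^∞(X)`: the pointwise projective limit of the `𝔭ᵏ(X)`. -/
def jetInfProlongation {π : B → M} (X : ProjectableField E EB π) (θ : JetInf E EB EF π) :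
    ∀ k, InternalTangentBundle (Jet E EB EF π k) :=
  fun k => jetProlongation k X (jetInfProj E EB EF π k θ)

variable (E EB EF)

/-- The set `𝔛_proj(Γ_g(π))`: the image of `𝔭ᵍ`. -/
abbrev GermFields (π : B → M) :=
  Set.range (fun X : AutonomousField E EB π => germProlongation X.1)

/-- The set `𝔛_proj(Γ_k(π))`: the image of `𝔭ᵏ`, for finite `k`. -/
abbrev JetFields (π : B → M) (k : ℕ) :=
  Set.range (fun X : AutonomousField E EB π => jetProlongation (EF := EF) k X.1)

/-- The set `𝔛_proj(Γ_∞(π))`: the image of `𝔭^∞`. -/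
abbrev JetInfFields (π : B → M) :=
  Set.range (fun X : AutonomousField E EB π => jetInfProlongation (EF := EF) X.1)

end Bundle

end GermBundle

end

open GermBundle

/-! The flow of a projectable field X carries a local section σ to the local sections σ_t =
Fl^X_{t,0} ∘ σ ∘ Fl^{π_*X}_{0,t}. Passing from the germ of σ_t to its k-jet loses information but
commutes with this construction. Hence π^{k,g} sends the curve of germs that defines 𝔭ᵍ(X) to the
curve of jets that defines 𝔭ᵏ(X), and the differential of a smooth map sends the velocity of a curve
to the velocity of its image (`differential_velocityAt`). This gives every projection identity of
the tower, for k = ∞ componentwise.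

The work lies in making this legitimate. Smooth curves: the sections σ_t must form a smooth family
on a common domain. This needs flows that are smooth jointly in the times and the initial value
(`exists_isLocalEvolution`), which come from the inverse function theorem in a space of continuous
curves, and a uniform choice of domains (`exists_isTransportFamily`). Independence of σ: uniqueness
of integral curves determines the germ of σ_t by the germ of σ (`germ_congr`). In fibred coordinates
σ_t is a fixed smooth expression in σ, so by the higher chain rule its k-jet depends only on the
k-jet of σ (`iteratedFDeriv_comp_eq_of_jet_eq`, `jet_congr`). Smooth projections: a plot of germs is
locally constant or lifts to a smooth family of sections, and the derivatives of such a family are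
smooth in the parameter (`isPlotOn_jet`).

For the pushforwards, a field in the image of a prolongation comes from some X, and the identity for
X provides a field to which it projects. That field is unique because the projections to finite jets
and to B are surjective, so the choice of X does not matter. -/

namespace GermBundle

/-! ### Smooth dependence of solutions of differential equations on initial values -/

section SmoothFlow

universe u

/-- Pointwise application of a continuous family of operators, as a continuous linear map. -/
noncomputable def pointwiseApply (K : Type*) [TopologicalSpace K] [CompactSpace K] (E F : Type*)
    [NormedAddCommGroup E] [NormedSpace ℝ E] [NormedAddCommGroup F] [NormedSpace ℝ F] :
    C(K, E →L[ℝ] F) →L[ℝ] C(K, E) →L[ℝ] C(K, F) :=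
  LinearMap.mkContinuous₂
    (LinearMap.mk₂ ℝ
      (fun (A : C(K, E →L[ℝ] F)) (h : C(K, E)) =>
        (⟨fun t => A t (h t), A.continuous.clm_apply h.continuous⟩ : C(K, F)))
      (fun _ _ _ => by ext; simp) (fun _ _ _ => by ext; simp)
      (fun _ _ _ => by ext; simp) (fun _ _ _ => by ext; simp)) 1
    (fun A h => by
      rw [one_mul, ContinuousMap.norm_le _ (by positivity)]
      intro t
      exact ((A t).le_opNorm _).trans
        (mul_le_mul (A.norm_coe_le_norm t) (h.norm_coe_le_norm t) (norm_nonneg _) (norm_nonneg A)))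

/-- The derivative of the composition operator `α ↦ f ∘ α`. -/
theorem hasFDerivAt_postcomp {K : Type*} [TopologicalSpace K] [CompactSpace K] {E F : Type*}
    [NormedAddCommGroup E] [NormedSpace ℝ E] [NormedAddCommGroup F] [NormedSpace ℝ F]
    (f : C(E, F)) (f' : C(E, E →L[ℝ] F)) (hf : ∀ x, HasFDerivAt f (f' x) x) (α : C(K, E)) :
    HasFDerivAt (fun β : C(K, E) => f.comp β) (pointwiseApply K E F (f'.comp α)) α := by
  rw [hasFDerivAt_iff_isLittleO_nhds_zero, Asymptotics.isLittleO_iff]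
  intro c hc
  -- In the sup norm `β ↦ f' ∘ β` is continuous, so a single `δ` controls the variation of `f'`
  -- along all segments `[α t, α t + h₀ t]` at once. The mean value inequality on each segment then
  -- gives an error bound uniform in `t`.
  have hcont : Continuous fun β : C(K, E) => f'.comp β := ContinuousMap.continuous_postcomp f'
  obtain ⟨δ, hδ, h⟩ := (Metric.continuousAt_iff (α := C(K, E)) (β := C(K, E →L[ℝ] F))).mp
    (hcont.continuousAt (x := α)) c hc
  filter_upwards [Metric.ball_mem_nhds (0 : C(K, E)) hδ] with h₀ hh₀
  rw [mem_ball_zero_iff] at hh₀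
  rw [ContinuousMap.norm_le _ (by positivity)]
  intro t
  have key : ∀ x ∈ segment ℝ (α t) (α t + h₀ t), ‖f' x - f' (α t)‖ ≤ c := by
    intro x hx
    rw [segment_eq_image'] at hx
    obtain ⟨s, hs, rfl⟩ := hx
    have h1 : dist (α + s • h₀) α < δ := by
      rw [dist_eq_norm, add_sub_cancel_left, norm_smul, Real.norm_of_nonneg hs.1]
      exact (mul_le_of_le_one_left (norm_nonneg _) hs.2).trans_lt hh₀
    have h2 := (ContinuousMap.dist_lt_iff hc).mp (h h1) t
    rw [dist_eq_norm] at h2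
    simpa using h2.le
  have := Convex.norm_image_sub_le_of_norm_hasFDerivWithin_le' (f := f) (f' := fun x => f' x)
    (φ := f' (α t)) (fun x _ => (hf x).hasFDerivWithinAt) key (convex_segment _ _)
    (left_mem_segment ℝ _ _) (right_mem_segment ℝ _ _)
  simp only [add_sub_cancel_left] at this
  exact this.trans (mul_le_mul_of_nonneg_left (h₀.norm_coe_le_norm t) hc.le)

/-- The composition operator `α ↦ f ∘ α` with a smooth map `f` is smooth. -/
theorem contDiff_postcomp {K : Type*} [TopologicalSpace K] [CompactSpace K] {E F : Type u}
    [NormedAddCommGroup E] [NormedSpace ℝ E] [NormedAddCommGroup F] [NormedSpace ℝ F]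
    (f : C(E, F)) (hf : ContDiff ℝ ∞ f) : ContDiff ℝ ∞ (fun β : C(K, E) => f.comp β) := by
  rw [contDiff_infty]
  intro n
  -- The derivative is post-composition with `f'` followed by a bounded operator. The target changes
  -- to `E →L[ℝ] F`, which must stay in the universe over which the induction ranges.
  induction n generalizing F with
  | zero =>
    exact contDiff_zero.mpr (ContinuousMap.continuous_postcomp f)
  | succ n ih =>
    let f' : C(E, E →L[ℝ] F) := ⟨fderiv ℝ f, hf.continuous_fderiv (by simp)⟩
    have hd := hasFDerivAt_postcomp (K := K) f f'
      fun x => ((hf.differentiable (by simp)) x).hasFDerivAt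
    push_cast
    rw [contDiff_succ_iff_fderiv]
    refine ⟨fun α => (hd α).differentiableAt, by simp, ?_⟩
    rw [funext fun α => (hd α).fderiv]
    exact (pointwiseApply K E F).contDiff.comp
      (ih f' (hf.fderiv_right (m := ∞) (by simp)))

/-- The time interval on which the rescaled differential equation is solved. -/
abbrev TimeInterval : Type := Set.Icc (-2 : ℝ) 2

/-- Integration from `0`, as an operator on continuous curves. -/
noncomputable def integralFromZero (E : Type*) [NormedAddCommGroup E] [NormedSpace ℝ E] :
    C(TimeInterval, E) →L[ℝ] C(TimeInterval, E) :=
  have hc : ∀ α : C(TimeInterval, E),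
      Continuous fun s => α (Set.projIcc (-2 : ℝ) 2 (by norm_num) s) :=
    fun α => α.continuous.comp continuous_projIcc
  LinearMap.mkContinuous
    { toFun := fun α => ⟨fun t => ∫ s in (0 : ℝ)..t, α (Set.projIcc (-2 : ℝ) 2 (by norm_num) s),
        (intervalIntegral.continuous_primitive (fun a b => (hc α).intervalIntegrable a b) 0).comp
          continuous_subtype_val⟩
      map_add' := fun α β => by
        ext t
        exact intervalIntegral.integral_add ((hc α).intervalIntegrable _ _)
          ((hc β).intervalIntegrable _ _)
      map_smul' := fun c α => by
        ext t
        exact intervalIntegral.integral_smul c _ } 2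
    (fun α => by
      rw [ContinuousMap.norm_le _ (by positivity)]
      intro t
      refine (intervalIntegral.norm_integral_le_of_norm_le_const
        (C := ‖α‖) fun s _ => α.norm_coe_le_norm _).trans ?_
      rw [mul_comm]
      refine mul_le_mul_of_nonneg_right ?_ (norm_nonneg _)
      rw [sub_zero]
      exact abs_le.mpr t.2)

/-- The map whose zeros in `α` are the solutions of `α' = s f(α)` with `α(0) = z`. -/
noncomputable def picardDefect {E : Type u} [NormedAddCommGroup E] [NormedSpace ℝ E]
    (f : C(E, E)) (p : (ℝ × E) × C(TimeInterval, E)) : C(TimeInterval, E) :=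
  p.2 - (ContinuousMap.const _ p.1.2 + p.1.1 • integralFromZero E (f.comp p.2))

/-- The constant curves. -/
noncomputable def constCurve (E : Type*) [NormedAddCommGroup E] [NormedSpace ℝ E] :
    E →L[ℝ] C(TimeInterval, E) :=
  LinearMap.mkContinuous
    { toFun := fun z => ContinuousMap.const _ z
      map_add' := fun _ _ => rfl
      map_smul' := fun _ _ => rfl } 1
    (fun z => by
      rw [one_mul, ContinuousMap.norm_le _ (norm_nonneg _)]
      exact fun _ => le_rfl)

/-- Smooth families of solutions of the rescaled equations `α' = s f(α)`, `α(0) = z`. -/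
theorem exists_smooth_picard_solution {E : Type u} [NormedAddCommGroup E] [NormedSpace ℝ E]
    [CompleteSpace E] (f : C(E, E)) (hf : ContDiff ℝ ∞ f) (z₀ : E) :
    ∃ (W : Set (ℝ × E)) (S : ℝ × E → C(TimeInterval, E)), IsOpen W ∧ (0, z₀) ∈ W ∧
      ContDiffOn ℝ ∞ S W ∧ ∀ p ∈ W, picardDefect f (p, S p) = 0 := by
  let C := C(TimeInterval, E)
  let G : (ℝ × E) × C → (ℝ × E) × C := fun p => (p.1, picardDefect f p)
  have hN : ContDiff ℝ ∞ fun β : C => f.comp β := contDiff_postcomp f hf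
  have hG : ContDiff ℝ ∞ G := by
    refine contDiff_fst.prodMk (contDiff_snd.sub (ContDiff.add ?_ ?_))
    · exact (constCurve E).contDiff.comp (contDiff_snd.comp contDiff_fst)
    · exact (contDiff_fst.comp contDiff_fst).smul
        ((integralFromZero E).contDiff.comp (hN.comp contDiff_snd))
  let α₀ : C := constCurve E z₀
  let p₀ : (ℝ × E) × C := ((0, z₀), α₀)
  -- At `s = 0` the derivative of `f ∘ β` drops out, so the defect linearises to `q.2 - L q.1`. The
  -- derivative of `G` is thus a shear, inverted by changing the sign of `L`.
  let L : (ℝ × E) →L[ℝ] C := (constCurve E).comp (ContinuousLinearMap.snd ℝ ℝ E) +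
    (ContinuousLinearMap.fst ℝ ℝ E).smulRight (integralFromZero E (f.comp α₀))
  let e : ((ℝ × E) × C) ≃L[ℝ] (ℝ × E) × C := ContinuousLinearEquiv.equivOfInverse
    ((ContinuousLinearMap.fst ℝ (ℝ × E) C).prod
      (ContinuousLinearMap.snd ℝ (ℝ × E) C - L.comp (ContinuousLinearMap.fst ℝ (ℝ × E) C)))
    ((ContinuousLinearMap.fst ℝ (ℝ × E) C).prod
      (ContinuousLinearMap.snd ℝ (ℝ × E) C + L.comp (ContinuousLinearMap.fst ℝ (ℝ × E) C)))
    (fun p => by ext1 <;> simp) (fun p => by ext1 <;> simp)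
  have hG' : HasFDerivAt G (e : ((ℝ × E) × C) →L[ℝ] (ℝ × E) × C) p₀ := by
    have h1 : HasFDerivAt (fun p : (ℝ × E) × C => integralFromZero E (f.comp p.2))
        ((integralFromZero E).comp ((fderiv ℝ (fun β : C => f.comp β) α₀).comp
          (ContinuousLinearMap.snd ℝ (ℝ × E) C))) p₀ :=
      (integralFromZero E).hasFDerivAt.comp p₀ (HasFDerivAt.comp (g := fun β : C => f.comp β)
        (f := Prod.snd) p₀ ((hN.differentiable (by simp)) α₀).hasFDerivAt hasFDerivAt_snd)
    have h2 : HasFDerivAt (fun p : (ℝ × E) × C => p.1.1)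
        ((ContinuousLinearMap.fst ℝ ℝ E).comp (ContinuousLinearMap.fst ℝ (ℝ × E) C)) p₀ :=
      hasFDerivAt_fst.fst
    have h3 : HasFDerivAt (fun p : (ℝ × E) × C => constCurve E p.1.2)
        ((constCurve E).comp ((ContinuousLinearMap.snd ℝ ℝ E).comp
          (ContinuousLinearMap.fst ℝ (ℝ × E) C))) p₀ :=
      (constCurve E).hasFDerivAt.comp p₀ hasFDerivAt_fst.snd
    have h4 := (hasFDerivAt_fst (𝕜 := ℝ) (p := p₀)).prodMk
      ((hasFDerivAt_snd (𝕜 := ℝ) (p := p₀)).sub (h3.add (h2.smul h1)))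
    refine h4.congr_fderiv ?_
    refine ContinuousLinearMap.ext fun q => Prod.ext rfl ?_
    change q.2 - (constCurve E q.1.2 + ((0 : ℝ) • _ + q.1.1 • integralFromZero E (f.comp α₀))) =
      q.2 - (constCurve E q.1.2 + q.1.1 • integralFromZero E (f.comp α₀))
    rw [zero_smul, zero_add]
  have hne : (∞ : WithTop ℕ∞) ≠ 0 := by simp
  let Φ := hG.contDiffAt.toOpenPartialHomeomorph G hG' hne
  have hΦ : ∀ p, Φ p = G p := fun _ => rfl
  have hp₀ : p₀ ∈ Φ.source := ContDiffAt.mem_toOpenPartialHomeomorph_source _ _ _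
  have hGp₀ : G p₀ = ((0, z₀), 0) := by
    refine Prod.ext rfl ?_
    simp only [G, picardDefect, p₀, zero_smul, add_zero]
    exact sub_self _
  -- The inverse function theorem gives a smooth inverse at one point. Invertibility of the
  -- derivative is an open condition, and the local inverse is smooth wherever it holds.
  let R : Set ((ℝ × E) × C) := (fderiv ℝ G) ⁻¹' Set.range
    ((↑) : (((ℝ × E) × C) ≃L[ℝ] (ℝ × E) × C) → ((ℝ × E) × C) →L[ℝ] (ℝ × E) × C)
  have hR : IsOpen R := ContinuousLinearEquiv.isOpen.preimage (hG.continuous_fderiv hne)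
  let ι : ℝ × E → (ℝ × E) × C := fun q => (q, 0)
  have hι : ContDiff ℝ ∞ ι := contDiff_id.prodMk contDiff_const
  let W₁ := Φ.target ∩ Φ.symm ⁻¹' R
  have hW₁ : IsOpen W₁ := Φ.isOpen_inter_preimage_symm hR
  refine ⟨ι ⁻¹' W₁, fun q => (Φ.symm (ι q)).2, hW₁.preimage hι.continuous, ⟨?_, ?_⟩, ?_, ?_⟩
  · show ((0, z₀), 0) ∈ Φ.target
    rw [← hGp₀, ← hΦ]
    exact Φ.map_source hp₀
  · show Φ.symm ((0, z₀), 0) ∈ R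
    rw [← hGp₀, ← hΦ, Φ.left_inv hp₀]
    exact ⟨e, hG'.fderiv.symm⟩
  · rintro q ⟨hq, e', he'⟩
    have hd : HasFDerivAt Φ (e' : ((ℝ × E) × C) →L[ℝ] (ℝ × E) × C) (Φ.symm (ι q)) := by
      rw [he']
      exact ((hG.differentiable hne) _).hasFDerivAt
    have hs := Φ.contDiffAt_symm hq hd (hG.contDiffAt (n := ∞))
    exact (hs.comp q hι.contDiffAt).snd.contDiffWithinAt
  · rintro q ⟨hq, -⟩
    have h1 := Φ.right_inv hq
    rw [hΦ] at h1
    have h2 : (Φ.symm (ι q)).1 = q := congrArg Prod.fst h1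
    have h3 : picardDefect f (Φ.symm (ι q)) = 0 := congrArg Prod.snd h1
    rw [← h3]
    congr 1
    exact Prod.ext h2.symm rfl

/-- The solutions of the integral equation solve the differential equation. -/
theorem hasDerivAt_of_picardDefect_eq_zero {E : Type u} [NormedAddCommGroup E] [NormedSpace ℝ E]
    [CompleteSpace E] {f : C(E, E)} {s : ℝ} {z : E} {α : C(TimeInterval, E)}
    (h : picardDefect f ((s, z), α) = 0) :
    Set.IccExtend (by norm_num) α 0 = z ∧ ∀ t ∈ Set.Ioo (-2 : ℝ) 2,
      HasDerivAt (Set.IccExtend (by norm_num) α) (s • f (Set.IccExtend (by norm_num) α t)) t := by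
  set γ : ℝ → E := Set.IccExtend (by norm_num) α with hγ
  have hγc : Continuous γ := α.continuous.Icc_extend'
  have hint : ∀ t ∈ Set.Icc (-2 : ℝ) 2, γ t = z + s • ∫ r in (0 : ℝ)..t, f (γ r) := by
    intro t ht
    have h1 := DFunLike.congr_fun (sub_eq_zero.mp h) ⟨t, ht⟩
    rw [hγ, Set.IccExtend_of_mem _ _ ht]
    exact h1
  refine ⟨by simpa using hint 0 (by norm_num), fun t ht => ?_⟩
  have h2 : HasDerivAt (fun t => z + s • ∫ r in (0 : ℝ)..t, f (γ r)) (s • f (γ t)) t := by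
    have hc : Continuous fun r => f (γ r) := f.continuous.comp hγc
    exact ((intervalIntegral.integral_hasDerivAt_right (hc.intervalIntegrable _ _)
      (hc.stronglyMeasurableAtFilter _ _) hc.continuousAt).const_smul s).const_add z
  refine h2.congr_of_eventuallyEq ?_
  filter_upwards [Icc_mem_nhds ht.1 ht.2] with r hr
  exact hint r hr

/-- Local flows of Lipschitz smooth vector fields are smooth. -/
theorem exists_smooth_local_flow {E : Type u} [NormedAddCommGroup E] [NormedSpace ℝ E]
    [CompleteSpace E] {f : E → E} (hf : ContDiff ℝ ∞ f) {K : NNReal} (hK : LipschitzWith K f)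
    (z₀ : E) :
    ∃ (ε : ℝ) (U : Set E) (Θ : ℝ × E → E), 0 < ε ∧ IsOpen U ∧ z₀ ∈ U ∧
      ContDiffOn ℝ ∞ Θ (Set.Ioo (-ε) ε ×ˢ U) ∧ ∀ z ∈ U, Θ (0, z) = z ∧
        ∀ t ∈ Set.Ioo (-ε) ε, HasDerivAt (fun t => Θ (t, z)) (f (Θ (t, z))) t := by
  let F : C(E, E) := ⟨f, hf.continuous⟩
  obtain ⟨W, S, hW, h0, hS, hsol⟩ := exists_smooth_picard_solution F hf z₀
  obtain ⟨A, U, hA, hU, hA0, hzU, hAU⟩ := isOpen_prod_iff.mp hW 0 z₀ h0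
  obtain ⟨r, hr, hrA⟩ := Metric.isOpen_iff.mp hA 0 hA0
  let ε := r / 2
  have hε : 0 < ε := by positivity
  have hIA : ∀ s, |s| ≤ ε → s ∈ A := fun s hs => hrA (by
    rw [mem_ball_zero_iff, Real.norm_eq_abs]
    exact hs.trans_lt (half_lt_self hr))
  let γ : ℝ × E → ℝ → E := fun p => Set.IccExtend (by norm_num) (S p)
  have hγ : ∀ s, |s| ≤ ε → ∀ z ∈ U, γ (s, z) 0 = z ∧ ∀ t ∈ Set.Ioo (-2 : ℝ) 2,
      HasDerivAt (γ (s, z)) (s • f (γ (s, z) t)) t := fun s hs z hz =>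
    hasDerivAt_of_picardDefect_eq_zero (hsol (s, z) (hAU ⟨hIA s hs, hz⟩))
  -- Slowing the solution of speed `ε` by the factor `s / ε` gives a solution of speed `s`, and the
  -- Lipschitz bound makes solutions unique. The interval `[-2, 2]` is chosen so that time `1` is
  -- interior.
  have hscale : ∀ s, |s| ≤ ε → ∀ z ∈ U, γ (s, z) 1 = γ (ε, z) (s / ε) := by
    intro s hs z hz
    obtain ⟨h1, h2⟩ := hγ s hs z hz
    obtain ⟨h3, h4⟩ := hγ ε (by rw [abs_of_pos hε]) z hz
    have hsε : |s / ε| ≤ 1 := by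
      rw [abs_div, abs_of_pos hε]
      exact (div_le_one hε).mpr hs
    have h5 : Set.EqOn (γ (s, z)) (fun t => γ (ε, z) (t * (s / ε))) (Set.Ioo (-2) 2) := by
      refine ODE_solution_unique_of_mem_Ioo (v := fun _ x => s • f x) (s := fun _ => Set.univ)
        (K := ‖s‖₊ * K) (t₀ := 0) (fun t _ => ?_) (by norm_num)
        (fun t ht => ⟨h2 t ht, Set.mem_univ _⟩) (fun t ht => ⟨?_, Set.mem_univ _⟩) ?_
      · exact ((lipschitzWith_smul s).comp hK).lipschitzOnWith
      · have ht' : t * (s / ε) ∈ Set.Ioo (-2 : ℝ) 2 := by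
          rw [Set.mem_Ioo, ← abs_lt] at ht ⊢
          rw [abs_mul]
          exact (mul_le_of_le_one_right (abs_nonneg _) hsε).trans_lt ht
        have := (h4 _ ht').scomp t ((hasDerivAt_id t).mul_const (s / ε))
        simp only [one_mul, smul_smul, div_mul_cancel₀ s hε.ne'] at this
        exact this
      · simp [h1, h3]
    simpa using h5 (show (1 : ℝ) ∈ Set.Ioo (-2 : ℝ) 2 by norm_num)
  have habs : ∀ t ∈ Set.Ioo (-ε) ε, |t| ≤ ε := fun t ht => (abs_lt.mpr ht).le
  -- Time has become the parameter `s` and the curve is evaluated at the fixed time `1`. Joint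
  -- smoothness in time and initial value is therefore smoothness of `S`, while the differential
  -- equation in `t` comes from `hscale`.
  refine ⟨ε, U, fun p => γ p 1, hε, hU, hzU, ?_, fun z hz => ⟨?_, fun t ht => ?_⟩⟩
  · have h1 : ContDiffOn ℝ ∞ S (Set.Ioo (-ε) ε ×ˢ U) :=
      hS.mono fun p hp => hAU ⟨hIA _ (habs _ hp.1), hp.2⟩
    exact (ContinuousMap.evalCLM ℝ (Set.projIcc (-2 : ℝ) 2 (by norm_num) 1)).contDiff.comp_contDiffOn
      h1
  · show γ (0, z) 1 = z
    rw [hscale 0 (by simpa using hε.le) z hz, zero_div]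
    exact (hγ ε (by rw [abs_of_pos hε]) z hz).1
  · show HasDerivAt (fun t => γ (t, z) 1) (f (γ (t, z) 1)) t
    rw [hscale t (habs t ht) z hz]
    have ht' : t / ε ∈ Set.Ioo (-2 : ℝ) 2 := by
      rw [Set.mem_Ioo, ← abs_lt, abs_div, abs_of_pos hε]
      exact ((div_le_one hε).mpr (habs t ht)).trans_lt one_lt_two
    have h1 := ((hγ ε (by rw [abs_of_pos hε]) z hz).2 _ ht').scomp t
      ((hasDerivAt_id t).div_const ε)
    rw [smul_smul, one_div, inv_mul_cancel₀ hε.ne', one_smul] at h1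
    refine h1.congr_of_eventuallyEq ?_
    filter_upwards [Ioo_mem_nhds ht.1 ht.2] with s hs
    exact hscale s (habs s hs) z hz

/-- A vector field that is smooth near a point of a finite-dimensional space has a smooth local
flow there. -/
theorem exists_smooth_local_flow_of_contDiffOn {E : Type u} [NormedAddCommGroup E]
    [NormedSpace ℝ E] [FiniteDimensional ℝ E] {f : E → E} {Ω : Set E} (hΩ : IsOpen Ω)
    (hf : ContDiffOn ℝ ∞ f Ω) {z₀ : E} (hz₀ : z₀ ∈ Ω) :
    ∃ (ε : ℝ) (U : Set E) (Θ : ℝ × E → E), 0 < ε ∧ IsOpen U ∧ z₀ ∈ U ∧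
      ContDiffOn ℝ ∞ Θ (Set.Ioo (-ε) ε ×ˢ U) ∧ ∀ z ∈ U, Θ (0, z) = z ∧
        ∀ t ∈ Set.Ioo (-ε) ε, Θ (t, z) ∈ Ω ∧
          HasDerivAt (fun t => Θ (t, z)) (f (Θ (t, z))) t := by
  obtain ⟨r, hr, hrΩ⟩ := Metric.isOpen_iff.mp hΩ z₀ hz₀
  -- Cutting off makes the field globally smooth with compact support, hence Lipschitz. The cut-off
  -- is `1` on the ball of radius `r / 4`, and times and initial values are shrunk below until the
  -- flow stays there.
  let χ : ContDiffBump z₀ := ⟨r / 4, r / 2, by positivity, by linarith⟩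
  let g : E → E := fun x => χ x • f x
  have hsub : Metric.closedBall z₀ (r / 2) ⊆ Ω :=
    (Metric.closedBall_subset_ball (half_lt_self hr)).trans hrΩ
  have hg : ContDiff ℝ ∞ g := by
    rw [contDiff_iff_contDiffAt]
    intro x
    by_cases hx : x ∈ Metric.closedBall z₀ (r / 2)
    · exact χ.contDiffAt.smul (hf.contDiffAt (hΩ.mem_nhds (hsub hx)))
    · refine contDiffAt_const (c := (0 : E)) |>.congr_of_eventuallyEq ?_
      filter_upwards [Metric.isClosed_closedBall.isOpen_compl.mem_nhds hx] with y hy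
      have : χ y = 0 := χ.zero_of_le_dist (by
        rw [Set.mem_compl_iff, Metric.mem_closedBall, not_le] at hy
        exact hy.le)
      simp [g, this]
  have hsupp : HasCompactSupport g := χ.hasCompactSupport.smul_right
  obtain ⟨K, hK⟩ := hg.lipschitzWith_of_hasCompactSupport hsupp (by simp)
  obtain ⟨ε, U, Θ, hε, hU, hzU, hΘ, hflow⟩ := exists_smooth_local_flow hg hK z₀
  have hopen : IsOpen (Set.Ioo (-ε) ε ×ˢ U) := isOpen_Ioo.prod hU
  have hpre : IsOpen ((Set.Ioo (-ε) ε ×ˢ U) ∩ Θ ⁻¹' Metric.ball z₀ (r / 4)) :=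
    hΘ.continuousOn.isOpen_inter_preimage hopen Metric.isOpen_ball
  obtain ⟨A, V, hA, hV, hA0, hzV, hAV⟩ := isOpen_prod_iff.mp hpre 0 z₀
    ⟨⟨⟨by linarith, hε⟩, hzU⟩, by
      rw [Set.mem_preimage, (hflow z₀ hzU).1]
      exact Metric.mem_ball_self (by positivity)⟩
  obtain ⟨δ, hδ, hδA⟩ := Metric.isOpen_iff.mp hA 0 hA0
  have hIA : Set.Ioo (-δ) δ ⊆ A := fun t ht => hδA (by
    rw [mem_ball_zero_iff, Real.norm_eq_abs]
    exact abs_lt.mpr ht)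
  refine ⟨δ, V, Θ, hδ, hV, hzV, hΘ.mono fun p hp => (hAV ⟨hIA hp.1, hp.2⟩).1, fun z hz => ?_⟩
  have hz0 := hAV (Set.mk_mem_prod hA0 hz)
  refine ⟨(hflow z hz0.1.2).1, fun t ht => ?_⟩
  have hzt := hAV (Set.mk_mem_prod (hIA ht) hz)
  have hball : Θ (t, z) ∈ Metric.ball z₀ (r / 4) := hzt.2
  refine ⟨hsub (Metric.ball_subset_closedBall (Metric.ball_subset_ball (by linarith) hball)), ?_⟩
  have h1 := (hflow z hzt.1.2).2 t hzt.1.1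
  have h2 : g (Θ (t, z)) = f (Θ (t, z)) := by
    simp [g, χ.one_of_mem_closedBall (Metric.ball_subset_closedBall hball)]
  rwa [h2] at h1

end SmoothFlow

end GermBundle

namespace GermBundle

/-! ### Time-dependent vector fields on manifolds -/

section ManifoldFlow

variable {E : Type*} [NormedAddCommGroup E] [NormedSpace ℝ E] {N : Type*}
  [TopologicalSpace N] [ChartedSpace E N]

variable (E) in
/-- `c` is an integral curve of the time-dependent field `X` on `(a, b)`. -/
def IsTimeCurveOn (X : ℝ → ∀ y : N, TangentSpace 𝓘(ℝ, E) y) (c : ℝ → N) (a b : ℝ) : Prop :=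
  ∀ s ∈ Set.Ioo a b, HasMFDerivAt 𝓘(ℝ, ℝ) 𝓘(ℝ, E) c s
    ((1 : ℝ →L[ℝ] ℝ).smulRight (X s (c s) : E))

theorem IsTimeCurveOn.mono {X : ℝ → ∀ y : N, TangentSpace 𝓘(ℝ, E) y} {c : ℝ → N} {a b a' b' : ℝ}
    (hc : IsTimeCurveOn E X c a b) (ha : a ≤ a') (hb : b' ≤ b) : IsTimeCurveOn E X c a' b' :=
  fun s hs => hc s ⟨ha.trans_lt hs.1, hs.2.trans_le hb⟩

theorem IsTimeCurveOn.flowsTo {X : ℝ → ∀ y : N, TangentSpace 𝓘(ℝ, E) y} {c : ℝ → N} {a b t₀ t : ℝ}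
    (hc : IsTimeCurveOn E X c a b) (ht₀ : t₀ ∈ Set.Ioo a b) (ht : t ∈ Set.Ioo a b) :
    FlowsTo E X t₀ (c t₀) t (c t) :=
  ⟨c, a, b, ht₀, ht, rfl, rfl, hc⟩

theorem FlowsTo.symm {X : ℝ → ∀ y : N, TangentSpace 𝓘(ℝ, E) y} {t₀ t : ℝ} {x y : N}
    (h : FlowsTo E X t₀ x t y) : FlowsTo E X t y t₀ x := by
  obtain ⟨c, a, b, h0, h1, h2, h3, hc⟩ := h
  exact ⟨c, a, b, h1, h0, h3, h2, hc⟩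

variable (E) in
/-- `Ψ t₀ t x` is the smooth evolution of `X` from time `t₀` to time `t`, for times in `(-ε, ε)` and
initial values in `O`. -/
structure IsLocalEvolution (X : ℝ → ∀ y : N, TangentSpace 𝓘(ℝ, E) y) (ε : ℝ) (O : Set N)
    (Ψ : ℝ → ℝ → N → N) : Prop where
  pos : 0 < ε
  isOpen : IsOpen O
  smooth : ContMDiffOn ((𝓘(ℝ, ℝ).prod 𝓘(ℝ, ℝ)).prod 𝓘(ℝ, E)) 𝓘(ℝ, E) ∞
    (fun w : (ℝ × ℝ) × N => Ψ w.1.1 w.1.2 w.2) ((Set.Ioo (-ε) ε ×ˢ Set.Ioo (-ε) ε) ×ˢ O)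
  init : ∀ t₀ ∈ Set.Ioo (-ε) ε, ∀ x ∈ O, Ψ t₀ t₀ x = x
  curve : ∀ t₀ ∈ Set.Ioo (-ε) ε, ∀ x ∈ O, IsTimeCurveOn E X (fun t => Ψ t₀ t x) (-ε) ε

namespace IsLocalEvolution

variable {X : ℝ → ∀ y : N, TangentSpace 𝓘(ℝ, E) y} {ε : ℝ} {O : Set N} {Ψ : ℝ → ℝ → N → N}

theorem zero_mem (h : IsLocalEvolution E X ε O Ψ) : (0 : ℝ) ∈ Set.Ioo (-ε) ε :=
  ⟨neg_neg_of_pos h.pos, h.pos⟩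

theorem flowsTo (h : IsLocalEvolution E X ε O Ψ) {t₀ t : ℝ} (ht₀ : t₀ ∈ Set.Ioo (-ε) ε)
    (ht : t ∈ Set.Ioo (-ε) ε) {x : N} (hx : x ∈ O) : FlowsTo E X t₀ x t (Ψ t₀ t x) := by
  have := (h.curve t₀ ht₀ x hx).flowsTo ht₀ ht
  rwa [h.init t₀ ht₀ x hx] at this

theorem contMDiffAt (h : IsLocalEvolution E X ε O Ψ) {t₀ t : ℝ} (ht₀ : t₀ ∈ Set.Ioo (-ε) ε)
    (ht : t ∈ Set.Ioo (-ε) ε) {x : N} (hx : x ∈ O) :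
    ContMDiffAt ((𝓘(ℝ, ℝ).prod 𝓘(ℝ, ℝ)).prod 𝓘(ℝ, E)) 𝓘(ℝ, E) ∞
      (fun w : (ℝ × ℝ) × N => Ψ w.1.1 w.1.2 w.2) ((t₀, t), x) :=
  h.smooth.contMDiffAt (((isOpen_Ioo.prod isOpen_Ioo).prod h.isOpen).mem_nhds ⟨⟨ht₀, ht⟩, hx⟩)

theorem contMDiffAt_apply (h : IsLocalEvolution E X ε O Ψ) {t₀ t : ℝ} (ht₀ : t₀ ∈ Set.Ioo (-ε) ε)
    (ht : t ∈ Set.Ioo (-ε) ε) {x : N} (hx : x ∈ O) :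
    ContMDiffAt 𝓘(ℝ, E) 𝓘(ℝ, E) ∞ (Ψ t₀ t) x :=
  ContMDiffAt.comp (g := fun w : (ℝ × ℝ) × N => Ψ w.1.1 w.1.2 w.2) (f := fun x => ((t₀, t), x)) x
    (h.contMDiffAt ht₀ ht hx) (contMDiffAt_const.prodMk contMDiffAt_id)

end IsLocalEvolution

variable [IsManifold 𝓘(ℝ, E) ∞ N]

/-- The autonomous field `(1, X)` on `ℝ × N`. -/
def suspendedField (X : ℝ → ∀ y : N, TangentSpace 𝓘(ℝ, E) y) (w : ℝ × N) :
    TangentSpace (𝓘(ℝ, ℝ).prod 𝓘(ℝ, E)) w := ((1 : ℝ), (X w.1 w.2 : E))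

theorem contMDiff_suspendedField {X : ℝ → ∀ y : N, TangentSpace 𝓘(ℝ, E) y}
    (hX : IsSmoothField E X) :
    ContMDiff (𝓘(ℝ, ℝ).prod 𝓘(ℝ, E)) (𝓘(ℝ, ℝ).prod 𝓘(ℝ, E)).tangent ∞
      (fun w : ℝ × N => (⟨w, suspendedField X w⟩ :
        TangentBundle (𝓘(ℝ, ℝ).prod 𝓘(ℝ, E)) (ℝ × N))) := by
  have h1 : ContMDiff 𝓘(ℝ, ℝ) 𝓘(ℝ, ℝ).tangent ∞
      (fun t : ℝ => (⟨t, (1 : ℝ)⟩ : TangentBundle 𝓘(ℝ, ℝ) ℝ)) := by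
    intro t
    exact contMDiffAt_vectorSpace_iff_contDiffAt.mpr contDiffAt_const
  exact (contMDiff_equivTangentBundleProd_symm (I := 𝓘(ℝ, ℝ)) (I' := 𝓘(ℝ, E)) (M := ℝ) (M' := N)
    (n := ∞)).comp ((h1.comp contMDiff_fst).prodMk hX)

/-- The curves `s ↦ (s, c s)` are integral curves of the autonomous suspended field on `ℝ × N`,
where uniqueness of integral curves on a Hausdorff manifold applies. -/
theorem IsTimeCurveOn.eqOn [CompleteSpace E] [T2Space N]
    {X : ℝ → ∀ y : N, TangentSpace 𝓘(ℝ, E) y} (hX : IsSmoothField E X) {c c' : ℝ → N} {a b t₀ : ℝ}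
    (hc : IsTimeCurveOn E X c a b) (hc' : IsTimeCurveOn E X c' a b) (ht₀ : t₀ ∈ Set.Ioo a b)
    (h : c t₀ = c' t₀) : Set.EqOn c c' (Set.Ioo a b) := by
  have key : ∀ {c : ℝ → N}, IsTimeCurveOn E X c a b →
      IsMIntegralCurveOn (I := 𝓘(ℝ, ℝ).prod 𝓘(ℝ, E)) (fun s => (s, c s)) (suspendedField X)
        (Set.Ioo a b) := by
    intro c hc s hs
    refine (((hasMFDerivAt_id (I := 𝓘(ℝ, ℝ)) s).prodMk (hc s hs)).congr_mfderiv
      ?_).hasMFDerivWithinAt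
    refine ContinuousLinearMap.ext fun r : ℝ => ?_
    change (r, r • (X s (c s) : E)) = ((r * 1 : ℝ), r • (X s (c s) : E))
    rw [mul_one]
  have h1 := isMIntegralCurveOn_Ioo_eqOn_of_contMDiff_boundaryless (I := 𝓘(ℝ, ℝ).prod 𝓘(ℝ, E))
    ht₀ ((contMDiff_suspendedField hX).of_le (by simp)) (key hc) (key hc') (by simp [h])
  exact fun s hs => congrArg Prod.snd (h1 hs)

/-- The two witnessing curves may live on different intervals, but the intersection of these is an
interval that contains both `t₀` and `t`. -/
theorem FlowsTo.unique [CompleteSpace E] [T2Space N] {X : ℝ → ∀ y : N, TangentSpace 𝓘(ℝ, E) y}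
    (hX : IsSmoothField E X) {t₀ t : ℝ} {x y y' : N} (h : FlowsTo E X t₀ x t y)
    (h' : FlowsTo E X t₀ x t y') : y = y' := by
  obtain ⟨c, a, b, h0, h1, rfl, rfl, hc⟩ := h
  obtain ⟨c', a', b', h0', h1', h2, rfl, hc'⟩ := h'
  have hc : IsTimeCurveOn E X c a b := hc
  have hc' : IsTimeCurveOn E X c' a' b' := hc'
  exact (hc.mono (le_max_left a a') (min_le_left b b')).eqOn hX
    (hc'.mono (le_max_right a a') (min_le_right b b'))
    ⟨max_lt h0.1 h0'.1, lt_min h0.2 h0'.2⟩ h2.symm ⟨max_lt h1.1 h1'.1, lt_min h1.2 h1'.2⟩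

/-- The coordinate expression of a time-dependent field. -/
noncomputable def chartField (X : ℝ → ∀ y : N, TangentSpace 𝓘(ℝ, E) y) (x₀ : N) (w : ℝ × E) : E :=
  (trivializationAt E (TangentSpace 𝓘(ℝ, E)) x₀
    (⟨(extChartAt 𝓘(ℝ, E) x₀).symm w.2, X w.1 ((extChartAt 𝓘(ℝ, E) x₀).symm w.2)⟩ :
      TangentBundle 𝓘(ℝ, E) N)).2

theorem contDiffOn_chartField {X : ℝ → ∀ y : N, TangentSpace 𝓘(ℝ, E) y}
    (hX : IsSmoothField E X) (x₀ : N) :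
    ContDiffOn ℝ ∞ (chartField X x₀) (Set.univ ×ˢ (extChartAt 𝓘(ℝ, E) x₀).target) := by
  rw [← contMDiffOn_iff_contDiffOn]
  have h1 : ContMDiffOn 𝓘(ℝ, ℝ × E) (𝓘(ℝ, ℝ).prod 𝓘(ℝ, E)) ∞
      (fun w : ℝ × E => (w.1, (extChartAt 𝓘(ℝ, E) x₀).symm w.2))
      (Set.univ ×ˢ (extChartAt 𝓘(ℝ, E) x₀).target) :=
    contDiff_fst.contMDiff.contMDiffOn.prodMk
      ((contMDiffOn_extChartAt_symm x₀).comp contDiff_snd.contMDiff.contMDiffOn fun w hw => hw.2)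
  have h2 := (Bundle.Trivialization.contMDiffOn (n := ∞) (IB := 𝓘(ℝ, E))
    (trivializationAt E (TangentSpace 𝓘(ℝ, E)) x₀)).comp (hX.comp_contMDiffOn h1) (by
      intro w hw
      simpa using (extChartAt 𝓘(ℝ, E) x₀).map_target hw.2)
  exact contMDiff_snd.comp_contMDiffOn h2

/-- The trivialization of the tangent bundle at `x₀` is the derivative of the chart, which the
derivative of the inverse chart undoes. Solutions in coordinates therefore become integral curves on
`N`. -/
theorem hasMFDerivAt_of_chartField {X : ℝ → ∀ y : N, TangentSpace 𝓘(ℝ, E) y} {x₀ : N} {γ : ℝ → E}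
    {s : ℝ} (hs : γ s ∈ (extChartAt 𝓘(ℝ, E) x₀).target)
    (h : HasDerivAt γ (chartField X x₀ (s, γ s)) s) :
    HasMFDerivAt 𝓘(ℝ, ℝ) 𝓘(ℝ, E) (fun t => (extChartAt 𝓘(ℝ, E) x₀).symm (γ t)) s
      ((1 : ℝ →L[ℝ] ℝ).smulRight (X s ((extChartAt 𝓘(ℝ, E) x₀).symm (γ s)) : E)) := by
  have hsource : (extChartAt 𝓘(ℝ, E) x₀).symm (γ s) ∈ (chartAt E x₀).source := by
    simpa only [extChartAt_source] using (extChartAt 𝓘(ℝ, E) x₀).map_target hs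
  have h1 : (chartField X x₀ (s, γ s) : E) =
      (mfderiv 𝓘(ℝ, E) 𝓘(ℝ, E) (extChartAt 𝓘(ℝ, E) x₀) ((extChartAt 𝓘(ℝ, E) x₀).symm (γ s))
        (X s ((extChartAt 𝓘(ℝ, E) x₀).symm (γ s))) : E) := by
    have h := DFunLike.congr_fun
      (TangentBundle.continuousLinearMapAt_trivializationAt (I := 𝓘(ℝ, E)) hsource)
      (X s ((extChartAt 𝓘(ℝ, E) x₀).symm (γ s)))
    refine Eq.trans ?_ h
    rw [Bundle.Trivialization.continuousLinearMapAt_apply,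
      Bundle.Trivialization.coe_linearMapAt_of_mem _ (by simpa using hsource)]
    rfl
  have h2 : MDifferentiableAt 𝓘(ℝ, E) 𝓘(ℝ, E) (extChartAt 𝓘(ℝ, E) x₀).symm (γ s) :=
    ((contMDiffOn_extChartAt_symm x₀).contMDiffAt
      ((isOpen_extChartAt_target x₀).mem_nhds hs)).mdifferentiableAt (n := ∞) (by simp)
  have h3 := h2.hasMFDerivAt.comp s h.hasFDerivAt.hasMFDerivAt
  refine h3.congr_mfderiv ?_
  have h4 := mfderivWithin_extChartAt_symm_comp_mfderiv_extChartAt (I := 𝓘(ℝ, E)) hs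
  rw [modelWithCornersSelf_coe, Set.range_id, mfderivWithin_univ] at h4
  refine ContinuousLinearMap.ext fun r : ℝ => ?_
  have h5 := DFunLike.congr_fun h4 (X s ((extChartAt 𝓘(ℝ, E) x₀).symm (γ s)))
  let L : E →L[ℝ] E := mfderiv 𝓘(ℝ, E) 𝓘(ℝ, E) (extChartAt 𝓘(ℝ, E) x₀).symm (γ s)
  change L ((r : ℝ) • (chartField X x₀ (s, γ s) : E)) =
    r • (X s ((extChartAt 𝓘(ℝ, E) x₀).symm (γ s)) : E)
  rw [map_smul]
  congr 1
  rw [h1]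
  exact h5

/-- Time-dependent vector fields have smooth local evolution operators. -/
theorem exists_isLocalEvolution [FiniteDimensional ℝ E]
    {X : ℝ → ∀ y : N, TangentSpace 𝓘(ℝ, E) y} (hX : IsSmoothField E X) (x₀ : N) :
    ∃ (ε : ℝ) (O : Set N) (Ψ : ℝ → ℝ → N → N), x₀ ∈ O ∧ IsLocalEvolution E X ε O Ψ := by
  set φ := extChartAt 𝓘(ℝ, E) x₀ with hφ
  -- Adding time as a coordinate with unit speed makes the coordinate equation autonomous.
  let f : ℝ × E → ℝ × E := fun w => (1, chartField X x₀ w)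
  obtain ⟨δ, U, Θ, hδ, hU, hzU, hΘ, hflow⟩ :=
    exists_smooth_local_flow_of_contDiffOn (f := f) (Ω := Set.univ ×ˢ φ.target)
      (isOpen_univ.prod (isOpen_extChartAt_target x₀))
      (contDiffOn_const.prodMk (contDiffOn_chartField hX x₀)) (z₀ := (0, φ x₀))
      ⟨Set.mem_univ _, mem_extChartAt_target x₀⟩
  have htime : ∀ z ∈ U, ∀ t ∈ Set.Ioo (-δ) δ, (Θ (t, z)).1 = z.1 + t := by
    intro z hz t ht
    have h0 : (0 : ℝ) ∈ Set.Ioo (-δ) δ := ⟨by linarith, hδ⟩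
    have hd : ∀ s ∈ Set.Ioo (-δ) δ, HasDerivAt (fun s => (Θ (s, z)).1 - s) 0 s := by
      intro s hs
      have := (hasFDerivAt_fst.comp_hasDerivAt s ((hflow z hz).2 s hs).2).sub (hasDerivAt_id s)
      simpa [f, Function.comp_def] using! this
    have := isOpen_Ioo.is_const_of_deriv_eq_zero isPreconnected_Ioo
      (fun s hs => (hd s hs).differentiableAt.differentiableWithinAt)
      (fun s hs => (hd s hs).deriv) ht h0
    rw [(hflow z hz).1] at this
    linarith
  obtain ⟨A, V, hA, hV, hA0, hzV, hAV⟩ := isOpen_prod_iff.mp hU 0 (φ x₀) hzU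
  obtain ⟨r, hr, hrA⟩ := Metric.isOpen_iff.mp hA 0 hA0
  -- Halving `δ` keeps the difference of two times in `(-ε, ε)` within the range `(-δ, δ)` of the
  -- flow.
  let ε := min r (δ / 2)
  have hε : 0 < ε := by positivity
  have hIA : Set.Ioo (-ε) ε ⊆ A := fun t ht => hrA (by
    rw [mem_ball_zero_iff, Real.norm_eq_abs]
    exact (abs_lt.mpr ht).trans_le (min_le_left _ _))
  have hdiff : ∀ t₀ ∈ Set.Ioo (-ε) ε, ∀ t ∈ Set.Ioo (-ε) ε, t - t₀ ∈ Set.Ioo (-δ) δ := by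
    intro t₀ ht₀ t ht
    have : ε ≤ δ / 2 := min_le_right _ _
    exact ⟨by linarith [ht.1, ht₀.2], by linarith [ht.2, ht₀.1]⟩
  have hO : IsOpen (φ.source ∩ φ ⁻¹' V) :=
    (continuousOn_extChartAt x₀).isOpen_inter_preimage (isOpen_extChartAt_source x₀) hV
  refine ⟨ε, φ.source ∩ φ ⁻¹' V, fun t₀ t x => φ.symm (Θ (t - t₀, (t₀, φ x))).2,
    ⟨mem_extChartAt_source x₀, hzV⟩, hε, hO, ?_, ?_, ?_⟩
  · have h1 : ContMDiffOn ((𝓘(ℝ, ℝ).prod 𝓘(ℝ, ℝ)).prod 𝓘(ℝ, E)) 𝓘(ℝ, ℝ × (ℝ × E)) ∞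
        (fun w : (ℝ × ℝ) × N => (w.1.2 - w.1.1, (w.1.1, φ w.2)))
        ((Set.Ioo (-ε) ε ×ˢ Set.Ioo (-ε) ε) ×ˢ (φ.source ∩ φ ⁻¹' V)) := by
      have ht₀ : ContMDiff ((𝓘(ℝ, ℝ).prod 𝓘(ℝ, ℝ)).prod 𝓘(ℝ, E)) 𝓘(ℝ, ℝ) ∞
          (fun w : (ℝ × ℝ) × N => w.1.1) := contMDiff_fst.comp contMDiff_fst
      have ht : ContMDiff ((𝓘(ℝ, ℝ).prod 𝓘(ℝ, ℝ)).prod 𝓘(ℝ, E)) 𝓘(ℝ, ℝ) ∞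
          (fun w : (ℝ × ℝ) × N => w.1.2) := contMDiff_snd.comp contMDiff_fst
      refine (ht.sub ht₀).contMDiffOn.prodMk_space (ht₀.contMDiffOn.prodMk_space ?_)
      exact ((contMDiffOn_extChartAt (x := x₀)).mono (by simp)).comp
        contMDiff_snd.contMDiffOn fun w hw => hw.2.1
    have h2 := hΘ.contMDiffOn.comp h1 fun w hw =>
      ⟨hdiff _ hw.1.1 _ hw.1.2, hAV (show (w.1.1, φ w.2) ∈ A ×ˢ V from ⟨hIA hw.1.1, hw.2.2⟩)⟩
    refine (contMDiffOn_extChartAt_symm x₀).comp (contDiff_snd.contMDiff.comp_contMDiffOn h2) ?_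
    intro w hw
    exact ((hflow _ (hAV (show (w.1.1, φ w.2) ∈ A ×ˢ V from ⟨hIA hw.1.1, hw.2.2⟩))).2 _ (hdiff _ hw.1.1 _ hw.1.2)).1.2
  · intro t₀ ht₀ x hx
    have hz : (t₀, φ x) ∈ U := hAV ⟨hIA ht₀, hx.2⟩
    simp only [sub_self, (hflow _ hz).1]
    exact φ.left_inv hx.1
  · intro t₀ ht₀ x hx t ht
    have hz : (t₀, φ x) ∈ U := hAV ⟨hIA ht₀, hx.2⟩
    have h1 := (hflow _ hz).2 _ (hdiff _ ht₀ _ ht)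
    refine hasMFDerivAt_of_chartField (γ := fun t => (Θ (t - t₀, (t₀, φ x))).2) h1.1.2 ?_
    have h2 := HasDerivAt.comp_sub_const t t₀ (hasFDerivAt_snd.comp_hasDerivAt _ h1.2)
    have h3 : Θ (t - t₀, (t₀, φ x)) = (t, (Θ (t - t₀, (t₀, φ x))).2) :=
      Prod.ext (by rw [htime _ hz _ (hdiff _ ht₀ _ ht)]; simp) rfl
    rw [h3] at h2
    exact h2

namespace IsLocalEvolution

variable {X : ℝ → ∀ y : N, TangentSpace 𝓘(ℝ, E) y} {ε : ℝ} {O : Set N} {Ψ : ℝ → ℝ → N → N}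

theorem apply_apply [CompleteSpace E] [T2Space N] (hX : IsSmoothField E X)
    (h : IsLocalEvolution E X ε O Ψ) {t₀ t : ℝ} (ht₀ : t₀ ∈ Set.Ioo (-ε) ε)
    (ht : t ∈ Set.Ioo (-ε) ε) {x : N} (hx : x ∈ O) (hx' : Ψ t₀ t x ∈ O) :
    Ψ t t₀ (Ψ t₀ t x) = x :=
  (h.flowsTo ht ht₀ hx').unique hX (h.flowsTo ht₀ ht hx).symm

end IsLocalEvolution

theorem FlowsTo.refl_zero [FiniteDimensional ℝ E] {X : ℝ → ∀ y : N, TangentSpace 𝓘(ℝ, E) y}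
    (hX : IsSmoothField E X) (x : N) : FlowsTo E X 0 x 0 x := by
  obtain ⟨ε, O, Ψ, hx, h⟩ := exists_isLocalEvolution hX x
  have := h.flowsTo h.zero_mem h.zero_mem hx
  rwa [h.init 0 h.zero_mem x hx] at this

end ManifoldFlow

end GermBundle

namespace GermBundle

/-! ### Velocities of smooth curves -/

section Velocity

variable {X Y : Type*} [DiffeologicalSpace X] [DiffeologicalSpace Y]

theorem plotClass_comp {x : X} (φ ψ : CenteredPlot x) (f : Euc ψ.dim → Euc φ.dim) (v : Euc ψ.dim)
    (hf : ContDiffOn ℝ ∞ f ψ.dom) (hm : Set.MapsTo f ψ.dom φ.dom) (h0 : f 0 = 0)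
    (he : Set.EqOn ψ.toFun (φ.toFun ∘ f) ψ.dom) :
    plotClass φ (fderiv ℝ f 0 v) = plotClass ψ v :=
  (Submodule.Quotient.eq (plotRelations x)).mpr
    (Submodule.subset_span ⟨φ, ψ, f, v, hf, hm, h0, he, rfl⟩)

/-- The plot centered at `x` that is given by a curve on `(-ε, ε)`. -/
def curvePlot {x : X} {c : ℝ → X} {ε : ℝ} (hε : 0 < ε) (hc : c 0 = x)
    (hp : IsPlotOn {u : Euc 1 | |u 0| < ε} (fun u => c (u 0))) : CenteredPlot x where
  dim := 1
  dom := {u : Euc 1 | |u 0| < ε}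
  isOpen_dom := isOpen_lt (by fun_prop) continuous_const
  zero_mem := by simpa using hε
  toFun := fun u => c (u 0)
  isPlotOn := hp
  map_zero := by simpa using hc

/-- On a small common interval the two curves coincide, and this restricted plot maps into both
given plots by the identity. -/
theorem plotClass_curvePlot_eq {x : X} {c c' : ℝ → X} {ε ε' : ℝ} (hε : 0 < ε) (hε' : 0 < ε')
    (hc : c 0 = x) (hc' : c' 0 = x) (hp : IsPlotOn {u : Euc 1 | |u 0| < ε} (fun u => c (u 0)))
    (hp' : IsPlotOn {u : Euc 1 | |u 0| < ε'} (fun u => c' (u 0))) (h : c =ᶠ[𝓝 0] c')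
    (v : Euc 1) : plotClass (curvePlot hε hc hp) v = plotClass (curvePlot hε' hc' hp') v := by
  obtain ⟨δ, hδ, hδc⟩ := Metric.eventually_nhds_iff_ball.mp h
  have hη : 0 < min δ (min ε ε') := lt_min hδ (lt_min hε hε')
  have hres : IsPlotOn {u : Euc 1 | |u 0| < min δ (min ε ε')} (fun u => c (u 0)) :=
    hp.comp (f := id) contDiffOn_id fun u hu =>
      (show |u 0| < _ from hu).trans_le ((min_le_right _ _).trans (min_le_left _ _))
  have h1 := plotClass_comp (curvePlot hε hc hp) (curvePlot hη hc hres) id v contDiffOn_id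
    (fun (u : Euc 1) hu => (show |u 0| < _ from hu).trans_le ((min_le_right _ _).trans (min_le_left _ _)))
    rfl (fun _ _ => rfl)
  have h2 := plotClass_comp (curvePlot hε' hc' hp') (curvePlot hη hc hres) id v contDiffOn_id
    (fun (u : Euc 1) hu => (show |u 0| < _ from hu).trans_le ((min_le_right _ _).trans (min_le_right _ _)))
    rfl (fun (u : Euc 1) hu => hδc (u 0) (by
      rw [mem_ball_zero_iff, Real.norm_eq_abs]
      exact (show |u 0| < _ from hu).trans_le (min_le_left _ _)))
  have hid : fderiv ℝ (id : Euc 1 → Euc 1) 0 v = v := by rw [fderiv_id, ContinuousLinearMap.id_apply]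
  exact (congrArg (plotClass (curvePlot hε hc hp)) hid).symm.trans
    (h1.trans (h2.symm.trans (congrArg (plotClass (curvePlot hε' hc' hp')) hid)))

/-- `velocityAt` uses an interval obtained by choice; the tangent class does not depend on it. -/
theorem velocityAt_eq_plotClass {x : X} {c : ℝ → X} {ε : ℝ} (hε : 0 < ε) (hc : c 0 = x)
    (hp : IsPlotOn {u : Euc 1 | |u 0| < ε} (fun u => c (u 0))) :
    velocityAt x c = plotClass (curvePlot hε hc hp) (EuclideanSpace.single (0 : Fin 1) (1 : ℝ)) := by
  have h : IsSmoothCurveAt c x := ⟨hc, ε, hε, hp⟩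
  rw [velocityAt, dif_pos h]
  exact plotClass_curvePlot_eq h.2.choose_spec.1 hε h.1 hc h.2.choose_spec.2 hp
    Filter.EventuallyEq.rfl _

theorem IsSmoothCurveAt.congr {x : X} {c c' : ℝ → X} (hc : IsSmoothCurveAt c x)
    (h : c =ᶠ[𝓝 0] c') : IsSmoothCurveAt c' x := by
  obtain ⟨h0, ε, hε, hp⟩ := hc
  obtain ⟨δ, hδ, hδc⟩ := Metric.eventually_nhds_iff_ball.mp h
  refine ⟨h.eq_of_nhds.symm.trans h0, min δ ε, lt_min hδ hε, ?_⟩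
  refine (hp.comp (f := id) (V := {u : Euc 1 | |u 0| < min δ ε}) contDiffOn_id fun u hu =>
    (show |u 0| < _ from hu).trans_le (min_le_right _ _)).congr fun u hu => hδc (u 0) ?_
  rw [mem_ball_zero_iff, Real.norm_eq_abs]
  exact (show |u 0| < _ from hu).trans_le (min_le_left _ _)

theorem velocityAt_congr {x : X} {c c' : ℝ → X} (hc : IsSmoothCurveAt c x) (h : c =ᶠ[𝓝 0] c') :
    velocityAt x c = velocityAt x c' := by
  obtain ⟨h0', ε', hε', hp'⟩ := hc.congr h
  obtain ⟨h0, ε, hε, hp⟩ := hc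
  rw [velocityAt_eq_plotClass hε h0 hp, velocityAt_eq_plotClass hε' h0' hp']
  exact plotClass_curvePlot_eq _ _ _ _ _ _ h _

theorem IsSmoothCurveAt.map {x : X} {c : ℝ → X} (hc : IsSmoothCurveAt c x) {f : X → Y}
    (hf : DSmooth f) : IsSmoothCurveAt (f ∘ c) (f x) := by
  obtain ⟨h0, ε, hε, hp⟩ := hc
  exact ⟨congrArg f h0, ε, hε, hp.dSmooth_comp hf⟩

theorem differential_plotClass {f : X → Y} (hf : DSmooth f) {x : X} (φ : CenteredPlot x)
    (v : Euc φ.dim) : differential hf x (plotClass φ v) = plotClass (φ.map hf) v :=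
  differentialAux_plotVector hf φ v

theorem differential_velocityAt {x : X} {c : ℝ → X} (hc : IsSmoothCurveAt c x) {f : X → Y}
    (hf : DSmooth f) : differential hf x (velocityAt x c) = velocityAt (f x) (f ∘ c) := by
  obtain ⟨h0, ε, hε, hp⟩ := hc
  rw [velocityAt_eq_plotClass hε h0 hp,
    velocityAt_eq_plotClass (c := f ∘ c) hε (congrArg f h0) (hp.dSmooth_comp hf)]
  exact differential_plotClass hf _ _

/-- The point `y` and the curve `c'` are free up to equality and germ equality, so that the result
can be read at the jet of a section rather than at the projection of its germ. -/
theorem internalTangentMap_velocityAt {x : X} {y : Y} {c : ℝ → X} {c' : ℝ → Y}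
    (hc : IsSmoothCurveAt c x) {f : X → Y} (hf : DSmooth f) (hxy : f x = y)
    (h : f ∘ c =ᶠ[𝓝 0] c') :
    internalTangentMap hf ⟨x, velocityAt x c⟩ = ⟨y, velocityAt y c'⟩ := by
  subst hxy
  rw [← velocityAt_congr (hc.map hf) h, ← differential_velocityAt hc hf]
  rfl

/-- The plot of a curve is `c` composed with the coordinate `Euc 1 → ℝ`, so the chain rule evaluates
its derivative on the unit vector. -/
theorem toTangentSpace_velocityAt {E N : Type*} [NormedAddCommGroup E] [NormedSpace ℝ E]
    [TopologicalSpace N] [ChartedSpace E N] {b : AsDiffeological E N} {c : ℝ → AsDiffeological E N}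
    (hc : IsSmoothCurveAt c b) {v : E}
    (h : HasMFDerivAt 𝓘(ℝ, ℝ) 𝓘(ℝ, E) c 0 ((1 : ℝ →L[ℝ] ℝ).smulRight v)) :
    (toTangentSpace b (velocityAt b c) : E) = v := by
  obtain ⟨h0, ε, hε, hp⟩ := hc
  rw [velocityAt_eq_plotClass hε h0 hp]
  refine (toTangentSpaceAux_plotVector (curvePlot hε h0 hp) _).trans ?_
  let ev : Euc 1 →L[ℝ] ℝ := EuclideanSpace.proj (0 : Fin 1)
  have h1 : HasMFDerivAt 𝓘(ℝ, Euc 1) 𝓘(ℝ, E) (c ∘ ev) 0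
      (((1 : ℝ →L[ℝ] ℝ).smulRight v).comp ev) :=
    HasMFDerivAt.comp (I' := 𝓘(ℝ, ℝ)) (0 : Euc 1) (f := ev) (g := c) (by rwa [map_zero])
      ev.hasFDerivAt.hasMFDerivAt
  have h2 : (mfderiv 𝓘(ℝ, Euc 1) 𝓘(ℝ, E) (fun u : Euc 1 => c (u 0)) 0 : Euc 1 →L[ℝ] E) =
      ((1 : ℝ →L[ℝ] ℝ).smulRight v).comp ev := h1.mfderiv
  change (mfderiv 𝓘(ℝ, Euc 1) 𝓘(ℝ, E) (fun u : Euc 1 => c (u 0)) 0 : Euc 1 →L[ℝ] E)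
    (EuclideanSpace.single (0 : Fin 1) (1 : ℝ)) = v
  rw [h2]
  change (EuclideanSpace.single (0 : Fin 1) (1 : ℝ) : Euc 1) 0 • v = v
  simp

end Velocity

/-! ### Jets of smooth families -/

section JetFamilies

/-- The derivatives in the second variable of a smooth function of two variables are smooth. -/
theorem contDiffAt_iteratedFDeriv_snd {A E G : Type*} [NormedAddCommGroup A] [NormedSpace ℝ A]
    [NormedAddCommGroup E] [NormedSpace ℝ E] [NormedAddCommGroup G] [NormedSpace ℝ G]
    {g : A → E → G} {w : A × E} (hg : ContDiffAt ℝ ∞ (Function.uncurry g) w) (j : ℕ) :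
    ContDiffAt ℝ ∞ (fun w : A × E => iteratedFDeriv ℝ j (g w.1) w.2) w := by
  induction j with
  | zero =>
    exact (continuousMultilinearCurryFin0 ℝ E G).symm.contDiff.contDiffAt.comp w hg
  | succ j ih =>
    -- The induction hypothesis is viewed as a family in `z` whose parameter is the whole pair `w`.
    -- Its derivative in `z` can then be taken at the moving point `z = w.2`.
    have h1 : ContDiffAt ℝ ∞
        (Function.uncurry fun (w : A × E) (z : E) => iteratedFDeriv ℝ j (g w.1) z) (w, w.2) :=
      ContDiffAt.comp (w, w.2) (g := fun w : A × E => iteratedFDeriv ℝ j (g w.1) w.2)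
        (f := fun q : (A × E) × E => (q.1.1, q.2)) ih
        (contDiffAt_fst.fst.prodMk contDiffAt_snd)
    have h2 := ContDiffAt.fderiv (m := ∞) h1 contDiffAt_snd (by simp)
    exact (continuousMultilinearCurryLeftEquiv ℝ (fun _ : Fin (j + 1) => E) G).symm.contDiff
      |>.contDiffAt.comp w h2

/-- Composition preserves equality of jets. -/
theorem iteratedFDeriv_comp_eq_of_jet_eq {E G H E' : Type*}
    [NormedAddCommGroup E] [NormedSpace ℝ E] [NormedAddCommGroup G] [NormedSpace ℝ G]
    [NormedAddCommGroup H] [NormedSpace ℝ H] [NormedAddCommGroup E'] [NormedSpace ℝ E']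
    {s s' : E → G} {a : E' → E} {h : E × G → H} {w : E'} {k : ℕ}
    (hs : ContDiffAt ℝ ∞ s (a w)) (hs' : ContDiffAt ℝ ∞ s' (a w)) (ha : ContDiffAt ℝ ∞ a w)
    (hh : ContDiffAt ℝ ∞ h (a w, s (a w)))
    (hjet : ∀ j ≤ k, iteratedFDeriv ℝ j s (a w) = iteratedFDeriv ℝ j s' (a w)) :
    ∀ j ≤ k, iteratedFDeriv ℝ j (fun z => h (a z, s (a z))) w =
      iteratedFDeriv ℝ j (fun z => h (a z, s' (a z))) w := by
  have hval : s (a w) = s' (a w) := by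
    have := congrArg (fun L => L 0) (hjet 0 (Nat.zero_le k))
    simpa using this
  intro j hj
  have hle : ∀ i : ℕ, (i : WithTop ℕ∞) ≤ ∞ := fun i => by exact_mod_cast le_top
  -- In the Faà di Bruno formula for `s ∘ a`, only derivatives of `s` of order `c.length ≤ i` occur.
  have comp_jet : ∀ (i : ℕ), i ≤ k → iteratedFDeriv ℝ i (s ∘ a) w = iteratedFDeriv ℝ i (s' ∘ a) w := by
    intro i hi
    rw [iteratedFDeriv_comp hs ha (hle i), iteratedFDeriv_comp hs' ha (hle i)]
    simp only [FormalMultilinearSeries.taylorComp]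
    refine Finset.sum_congr rfl fun c _ => ?_
    simp only [FormalMultilinearSeries.compAlongOrderedFinpartition, ftaylorSeries]
    rw [hjet c.length (c.length_le.trans hi)]
  have pair_jet : ∀ (i : ℕ), i ≤ k → iteratedFDeriv ℝ i (fun z => (a z, s (a z))) w =
      iteratedFDeriv ℝ i (fun z => (a z, s' (a z))) w := by
    intro i hi
    refine (iteratedFDeriv_prodMk ha (hs.comp w ha) (hle i)).trans
      (Eq.trans ?_ (iteratedFDeriv_prodMk ha (hs'.comp w ha) (hle i)).symm)
    rw [comp_jet i hi]
  have e1 := iteratedFDeriv_comp (g := h) (f := fun z => (a z, s (a z))) hh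
    (ha.prodMk (hs.comp w ha)) (hle j)
  have e2 := iteratedFDeriv_comp (g := h) (f := fun z => (a z, s' (a z))) (by rwa [← hval])
    (ha.prodMk (hs'.comp w ha)) (hle j)
  refine e1.trans (Eq.trans ?_ e2.symm)
  simp only [FormalMultilinearSeries.taylorComp]
  -- Now the two jets enter as inner factors, of orders `c.partSize m ≤ j`; the derivatives of `h`
  -- are taken at the same point by `hval`.
  refine Finset.sum_congr rfl fun c _ => ?_
  simp only [FormalMultilinearSeries.compAlongOrderedFinpartition, ftaylorSeries, hval]
  congr 1
  funext m
  exact pair_jet _ ((c.partSize_le m).trans hj)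

end JetFamilies

end GermBundle

namespace GermBundle

/-! ### Smoothness of the projections from germs to jets -/

section Projections

variable {E EB EF M B : Type*}
  [NormedAddCommGroup E] [NormedSpace ℝ E] [NormedAddCommGroup EB] [NormedSpace ℝ EB]
  [NormedAddCommGroup EF] [NormedSpace ℝ EF]
  [TopologicalSpace M] [ChartedSpace E M] [TopologicalSpace B] [ChartedSpace EB B] {π : B → M}

theorem PointedSection.proj_value (p : PointedSection E EB π) : π p.value = p.pt :=
  p.sec.proj _ p.mem

theorem FibredChart.pt_mem_base_source (c : FibredChart E EB EF π) (p : PointedSection E EB π)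
    (h : p.value ∈ c.total.source) : p.pt ∈ c.base.source := by
  have := (c.proj _ h).1
  rwa [p.proj_value] at this

theorem FibredChart.contMDiffAt_base (c : FibredChart E EB EF π) {x : M} (hx : x ∈ c.base.source) :
    ContMDiffAt 𝓘(ℝ, E) 𝓘(ℝ, E) ∞ c.base x :=
  c.base_smooth.contMDiffAt (c.base.open_source.mem_nhds hx)

theorem FibredChart.contMDiffAt_total (c : FibredChart E EB EF π) {b : B}
    (hb : b ∈ c.total.source) : ContMDiffAt 𝓘(ℝ, EB) 𝓘(ℝ, E × EF) ∞ c.total b :=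
  c.total_smooth.contMDiffAt (c.total.open_source.mem_nhds hb)

theorem FibredChart.contMDiffAt_base_symm (c : FibredChart E EB EF π) {x : M}
    (hx : x ∈ c.base.source) : ContMDiffAt 𝓘(ℝ, E) 𝓘(ℝ, E) ∞ c.base.symm (c.base x) :=
  c.base_symm_smooth.contMDiffAt (c.base.open_target.mem_nhds (c.base.map_source hx))

theorem FibredChart.contMDiffAt_total_symm (c : FibredChart E EB EF π) {z : E × EF}
    (hz : z ∈ c.total.target) : ContMDiffAt 𝓘(ℝ, E × EF) 𝓘(ℝ, EB) ∞ c.total.symm z :=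
  c.total_symm_smooth.contMDiffAt (c.total.open_target.mem_nhds hz)

theorem FibredChart.contDiffAt_family (c : FibredChart E EB EF π) {A : Type*}
    [NormedAddCommGroup A] [NormedSpace ℝ A] {S : A × M → B} {u : A} {x : M}
    (hS : ContMDiffAt (𝓘(ℝ, A).prod 𝓘(ℝ, E)) 𝓘(ℝ, EB) ∞ S (u, x)) (hx : x ∈ c.base.source)
    (hc : S (u, x) ∈ c.total.source) :
    ContDiffAt ℝ ∞ (fun w : A × E => (c.total (S (w.1, c.base.symm w.2))).2) (u, c.base x) := by
  rw [← contMDiffAt_iff_contDiffAt]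
  have h1 : ContMDiffAt 𝓘(ℝ, A × E) (𝓘(ℝ, A).prod 𝓘(ℝ, E)) ∞
      (fun w : A × E => (w.1, c.base.symm w.2)) (u, c.base x) :=
    contDiffAt_fst.contMDiffAt.prodMk
      ((c.contMDiffAt_base_symm hx).comp (u, c.base x) contDiffAt_snd.contMDiffAt)
  have h2 : ContMDiffAt 𝓘(ℝ, A × E) 𝓘(ℝ, EB) ∞
      (fun w : A × E => S (w.1, c.base.symm w.2)) (u, c.base x) :=
    hS.comp_of_eq h1 (by simp only [c.base.left_inv hx])
  have h3 : ContMDiffAt 𝓘(ℝ, A × E) 𝓘(ℝ, E × EF) ∞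
      (fun w : A × E => c.total (S (w.1, c.base.symm w.2))) (u, c.base x) :=
    (c.contMDiffAt_total hc).comp_of_eq h2 (by simp only [c.base.left_inv hx])
  exact contDiffAt_snd.contMDiffAt.comp _ h3

theorem FibredChart.contDiffAt_section (c : FibredChart E EB EF π) {σ : M → B} {x : M}
    (hσ : ContMDiffAt 𝓘(ℝ, E) 𝓘(ℝ, EB) ∞ σ x) (hx : x ∈ c.base.source)
    (hc : σ x ∈ c.total.source) :
    ContDiffAt ℝ ∞ (fun z : E => (c.total (σ (c.base.symm z))).2) (c.base x) := by
  have h := c.contDiffAt_family (A := ℝ) (u := 0) (S := fun w : ℝ × M => σ w.2)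
    (hσ.comp (0, x) contMDiffAt_snd) hx hc
  exact h.comp (c.base x) (contDiffAt_const.prodMk contDiffAt_id)

/-- Smooth families of pointed sections have smooth families of jets. -/
theorem isPlotOn_jet (k : ℕ) {n : ℕ} {V : Set (Euc n)} (hV : IsOpen V)
    {P : Euc n → PointedSection E EB π} (hP : IsPlotOn V P) :
    IsPlotOn V (fun u => jet EF k (P u)) := by
  obtain ⟨hpt, hsec⟩ := (isPlotOn_ofCorePlotsOn (pointedSectionCorePlots E EB π) hV).mp hP
  refine (isPlotOn_ofCorePlotsOn (jetCorePlots E EB EF π k) hV).mpr fun c => ?_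
  have hptAt : ∀ u ∈ V, ContMDiffAt 𝓘(ℝ, Euc n) 𝓘(ℝ, E) ∞ (fun u => (P u).pt) u :=
    fun u hu => hpt.contMDiffAt (hV.mem_nhds hu)
  have hsecAt : ∀ u ∈ V, ContMDiffAt (𝓘(ℝ, Euc n).prod 𝓘(ℝ, E)) 𝓘(ℝ, EB) ∞
      (fun w : Euc n × M => (P w.1).sec.toFun w.2) (u, (P u).pt) := by
    intro u hu
    obtain ⟨W, O, hW, huW, -, hO, hxO, -, hs⟩ := hsec u hu _ (P u).mem
    exact hs.contMDiffAt ((hW.prod hO).mem_nhds ⟨huW, hxO⟩)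
  have hval : ∀ u ∈ V, ContMDiffAt 𝓘(ℝ, Euc n) 𝓘(ℝ, EB) ∞ (fun u => (P u).value) u :=
    fun u hu => ContMDiffAt.comp (g := fun w : Euc n × M => (P w.1).sec.toFun w.2)
      (f := fun u => (u, (P u).pt)) u (hsecAt u hu) (contMDiffAt_id.prodMk (hptAt u hu))
  have hbase : ∀ u ∈ V, (P u).value ∈ c.total.source →
      ContDiffAt ℝ ∞ (fun u => c.base (P u).pt) u := fun u hu hc =>
    contMDiffAt_iff_contDiffAt.mp
      ((c.contMDiffAt_base (c.pt_mem_base_source _ hc)).comp u (hptAt u hu))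
  refine ⟨?_, fun u hu => (hbase u hu.1 hu.2).contDiffWithinAt, fun j hj u hu => ?_⟩
  · rw [isOpen_iff_mem_nhds]
    intro u hu
    exact Filter.inter_mem (hV.mem_nhds hu.1)
      ((hval u hu.1).continuousAt.preimage_mem_nhds (c.total.open_source.mem_nhds hu.2))
  · have h1 := contDiffAt_iteratedFDeriv_snd
      (g := fun (u : Euc n) (z : E) => (c.total ((P u).sec.toFun (c.base.symm z))).2)
      (c.contDiffAt_family (hsecAt u hu.1) (c.pt_mem_base_source _ hu.2) hu.2) j
    have h2 := ContDiffAt.comp (f := fun u => (u, c.base (P u).pt)) u h1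
      (contDiffAt_id.prodMk (hbase u hu.1 hu.2))
    exact h2.contDiffWithinAt.congr (fun v hv => if_pos hv.2) (if_pos hu.2)

/-- Smoothness is local, and a plot of the quotient is locally constant or lifts to a plot of
pointed sections, where `isPlotOn_jet` applies. -/
theorem dSmooth_germToJet (k : ℕ) : DSmooth (germToJet E EB EF π k) := by
  intro n p hp
  rw [← isPlotOn_univ] at hp ⊢
  have hp' := (isPlotOn_ofCorePlotsOn _ isOpen_univ).mp hp
  refine (isPlotOn_ofCorePlotsOn (jetCorePlots E EB EF π k) isOpen_univ).mpr
    ((jetCorePlots E EB EF π k).locality isOpen_univ fun u hu => ?_)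
  obtain ⟨V, hV, huV, -, h⟩ := hp' u hu
  refine ⟨V, hV, huV, (isPlotOn_ofCorePlotsOn (jetCorePlots E EB EF π k) hV).mp ?_⟩
  rcases h with ⟨y, hy⟩ | ⟨P, hP, hPf⟩
  · have : IsPlotOn V (fun _ : Euc n => germToJet E EB EF π k y) := fun _ _ _ _ => isPlot_const
    exact this.congr fun v hv => congrArg _ (hy v hv).symm
  · exact (isPlotOn_jet k hV hP).congr fun v hv => congrArg (germToJet E EB EF π k) (hPf v hv).symm

theorem dSmooth_germToJetInf : DSmooth (germToJetInf E EB EF π) :=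
  fun n p hp k => dSmooth_germToJet k n p hp

/-- The base coordinates and the order-zero jet coordinate together recover the value of the jet.
Composing with the inverse chart then makes `jetValue` smooth. -/
theorem jetCoord_zero_apply (c : FibredChart E EB EF π) {k : ℕ} (θ : Jet E EB EF π k)
    (h : (jetValue θ : B) ∈ c.total.source) :
    c.total (jetValue θ : B) = (c.base (jetPt θ), jetCoord c 0 (Nat.zero_le k) θ 0) := by
  obtain ⟨p⟩ := θ
  have hp : p.value ∈ c.total.source := h
  have h1 : jetCoord c 0 (Nat.zero_le k) (jet EF k p) = c.deriv 0 p := if_pos hp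
  refine Prod.ext ?_ ?_
  · refine ((c.proj _ hp).2).trans ?_
    rw [p.proj_value]
    rfl
  · refine Eq.trans ?_ (congrArg (fun L => L 0) h1).symm
    simp only [FibredChart.deriv, iteratedFDeriv_zero_apply]
    rw [c.base.left_inv (c.pt_mem_base_source p hp)]
    rfl

/-- Every point of a fibre bundle lies in the domain of a fibred chart. -/
theorem IsFibreBundle.exists_fibredChart [IsManifold 𝓘(ℝ, E) ∞ M] {F : Type*} [TopologicalSpace F]
    [ChartedSpace EF F] [IsManifold 𝓘(ℝ, EF) ∞ F] (hπ : IsFibreBundle E EB EF F π) (b : B) :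
    ∃ c : FibredChart E EB EF π, b ∈ c.total.source := by
  obtain ⟨e, hx, he, he'⟩ := hπ.locally_trivial (π b)
  have hb : b ∈ e.source := e.mem_source.mpr hx
  let φ := chartAt E (π b)
  let ψ := chartAt EF (e b).2
  refine ⟨
    { base := φ
      total := e.toOpenPartialHomeomorph.trans (φ.prod ψ)
      base_smooth := contMDiffOn_chart
      base_symm_smooth := contMDiffOn_chart_symm
      total_smooth := ?_
      total_symm_smooth := ?_
      proj := ?_ }, ?_⟩
  · have h1 : ContMDiffOn 𝓘(ℝ, EB) (𝓘(ℝ, E).prod 𝓘(ℝ, EF)) ∞ e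
        (e.toOpenPartialHomeomorph.trans (φ.prod ψ)).source := he.mono fun z hz => hz.1
    refine ContMDiffOn.prodMk_space (f := fun z => φ (e z).1) (g := fun z => ψ (e z).2) ?_ ?_
    · exact (contMDiffOn_chart (x := π b)).comp (contMDiff_fst.comp_contMDiffOn h1)
        fun z hz => hz.2.1
    · exact (contMDiffOn_chart (x := (e b).2)).comp (contMDiff_snd.comp_contMDiffOn h1)
        fun z hz => hz.2.2
  · have h1 : ContMDiffOn 𝓘(ℝ, E × EF) (𝓘(ℝ, E).prod 𝓘(ℝ, EF)) ∞
        (fun w : E × EF => (φ.symm w.1, ψ.symm w.2)) (φ.target ×ˢ ψ.target) :=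
      ((contMDiffOn_chart_symm (x := π b)).comp contDiff_fst.contMDiff.contMDiffOn
        fun w hw => hw.1).prodMk
      ((contMDiffOn_chart_symm (x := (e b).2)).comp contDiff_snd.contMDiff.contMDiffOn
        fun w hw => hw.2)
    exact he'.comp (h1.mono fun w hw => hw.1) fun w hw => hw.2
  · intro z hz
    have h1 : (e z).1 = π z := e.coe_fst hz.1
    refine ⟨?_, ?_⟩
    · have h2 : (e z).1 ∈ φ.source := hz.2.1
      rwa [h1] at h2
    · exact congrArg φ h1
  · refine ⟨hb, ?_, mem_chart_source EF (e b).2⟩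
    show (e b).1 ∈ φ.source
    rw [e.coe_fst hb]
    exact mem_chart_source E (π b)

/-- The projection of a jet to its value is smooth. -/
theorem IsFibreBundle.dSmooth_jetValue [IsManifold 𝓘(ℝ, E) ∞ M] {F : Type*} [TopologicalSpace F]
    [ChartedSpace EF F] [IsManifold 𝓘(ℝ, EF) ∞ F] (hπ : IsFibreBundle E EB EF F π) (k : ℕ) :
    DSmooth (jetValue : Jet E EB EF π k → AsDiffeological EB B) := by
  intro n p hp
  rw [← isPlotOn_univ] at hp ⊢
  have hp' := (isPlotOn_ofCorePlotsOn (jetCorePlots E EB EF π k) isOpen_univ).mp hp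
  refine (isPlotOn_ofCorePlotsOn (manifoldCorePlots EB B) isOpen_univ).mpr fun u _ => ?_
  obtain ⟨c, hc⟩ := hπ.exists_fibredChart (jetValue (p u) : B)
  obtain ⟨ho, hb, hf⟩ := hp' c
  have hu : u ∈ Set.univ ∩ {u | jetValue (p u) ∈ c.total.source} := ⟨Set.mem_univ u, hc⟩
  have hnhds := ho.mem_nhds hu
  have h1 : ContDiffAt ℝ ∞ (fun u => (c.base (jetPt (p u)),
      jetCoord c 0 (Nat.zero_le k) (p u) 0)) u :=
    (hb.contDiffAt hnhds).prodMk
      ((ContinuousMultilinearMap.apply ℝ (fun _ : Fin 0 => E) EF 0).contDiff.contDiffAt.comp u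
        ((hf 0 (Nat.zero_le k)).contDiffAt hnhds))
  have h2 : ContMDiffAt 𝓘(ℝ, Euc n) 𝓘(ℝ, EB) ∞ (fun u => c.total.symm (c.base (jetPt (p u)),
      jetCoord c 0 (Nat.zero_le k) (p u) 0)) u := by
    refine ContMDiffAt.comp u (c.contMDiffAt_total_symm ?_) h1.contMDiffAt
    rw [← jetCoord_zero_apply c (p u) hc]
    exact c.total.map_source hc
  refine (h2.congr_of_eventuallyEq ?_).contMDiffWithinAt
  filter_upwards [hnhds] with v hv
  rw [← jetCoord_zero_apply c (p v) hv.2]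
  exact (c.total.left_inv hv.2).symm

/-- Every point of a fibre bundle is the value of a local section. -/
theorem IsFibreBundle.exists_value_eq [IsManifold 𝓘(ℝ, E) ∞ M] {F : Type*} [TopologicalSpace F]
    [ChartedSpace EF F] [IsManifold 𝓘(ℝ, EF) ∞ F] (hπ : IsFibreBundle E EB EF F π) (b : B) :
    ∃ p : PointedSection E EB π, p.value = b := by
  obtain ⟨c, hc⟩ := hπ.exists_fibredChart b
  have hpt : c.total b = (c.base (π b), (c.total b).2) := Prod.ext (c.proj b hc).2 rfl
  -- The section has constant fibre coordinate; `D` is where its coordinates remain in the image of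
  -- the chart.
  let D : Set M := c.base.source ∩ (fun y => (c.base y, (c.total b).2)) ⁻¹' c.total.target
  have hD : IsOpen D := ContinuousOn.isOpen_inter_preimage
    (c.base.continuousOn.prodMk continuousOn_const) c.base.open_source c.total.open_target
  have hmem : π b ∈ D := ⟨(c.proj b hc).1, by
    show (c.base (π b), (c.total b).2) ∈ c.total.target
    rw [← hpt]
    exact c.total.map_source hc⟩
  refine ⟨⟨π b, ⟨D, hD, fun y => c.total.symm (c.base y, (c.total b).2), ?_, ?_⟩, hmem⟩, ?_⟩
  · exact c.total_symm_smooth.comp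
      ((c.base_smooth.mono Set.inter_subset_left).prodMk_space contMDiffOn_const) fun y hy => hy.2
  · intro y hy
    have hs := c.total.map_target hy.2
    obtain ⟨h1, h2⟩ := c.proj _ hs
    rw [c.total.right_inv hy.2] at h2
    -- The value lies over a point with the same base coordinates as `y`, and the base chart is
    -- injective.
    exact (c.base.injOn hy.1 h1 h2).symm
  · show c.total.symm (c.base (π b), (c.total b).2) = b
    rw [← hpt]
    exact c.total.left_inv hc

end Projections

end GermBundle

namespace GermBundle

/-! ### Transport of sections along projectable fields -/

section Transport

variable {E EB EF M B : Type*}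
  [NormedAddCommGroup E] [NormedSpace ℝ E] [NormedAddCommGroup EB] [NormedSpace ℝ EB]
  [NormedAddCommGroup EF] [NormedSpace ℝ EF]
  [TopologicalSpace M] [ChartedSpace E M] [TopologicalSpace B] [ChartedSpace EB B] {π : B → M}

theorem germ_eq_iff {p q : PointedSection E EB π} :
    germ p = germ q ↔ p.pt = q.pt ∧ p.sec.toFun =ᶠ[𝓝 p.pt] q.sec.toFun :=
  ⟨fun h => Quotient.exact h, fun h => Quotient.sound h⟩

theorem jet_eq_iff {k : ℕ} {p q : PointedSection E EB π} :
    jet EF k p = jet EF k q ↔ p.pt = q.pt ∧ p.value = q.value ∧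
      ∀ c : FibredChart E EB EF π, p.value ∈ c.total.source → ∀ j ≤ k, c.deriv j p = c.deriv j q :=
  ⟨fun h => Quotient.exact h, fun h => Quotient.sound (s := jetSetoid E EB EF π k) h⟩

theorem isPlotOn_germ {n : ℕ} {V : Set (Euc n)} {P : Euc n → PointedSection E EB π}
    (hP : IsPlotOn V P) : IsPlotOn V (fun u => germ (P u)) :=
  fun _ f hf hs _ _ => ⟨Set.univ, isOpen_univ, Set.mem_univ _, subset_rfl,
    Or.inr ⟨P ∘ f, isPlotOn_univ.mpr (hP f hf hs), fun _ _ => rfl⟩⟩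

variable [IsManifold 𝓘(ℝ, E) ∞ M] [IsManifold 𝓘(ℝ, EB) ∞ B]

/-- The projection of an integral curve of a projectable field is an integral curve of its base
field. -/
theorem ProjectableField.isTimeCurveOn_base (hπ : ContMDiff 𝓘(ℝ, EB) 𝓘(ℝ, E) ∞ π)
    (X : ProjectableField E EB π) {c : ℝ → B} {a b : ℝ} (hc : IsTimeCurveOn EB X.total c a b) :
    IsTimeCurveOn E X.base (fun t => π (c t)) a b := by
  intro s hs
  have h1 := (((hπ (c s)).mdifferentiableAt (by simp)).hasMFDerivAt).comp s (hc s hs)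
  refine h1.congr_mfderiv ?_
  refine ContinuousLinearMap.ext fun r : ℝ => ?_
  let L : EB →L[ℝ] E := mfderiv 𝓘(ℝ, EB) 𝓘(ℝ, E) π (c s)
  exact (L.map_smul r (X.total s (c s))).trans
    (congrArg (fun v : E => r • v) (X.related s (c s)))

theorem ProjectableField.flowsTo_base (hπ : ContMDiff 𝓘(ℝ, EB) 𝓘(ℝ, E) ∞ π)
    (X : ProjectableField E EB π) {t₀ t : ℝ} {b b' : B} (h : FlowsTo EB X.total t₀ b t b') :
    FlowsTo E X.base t₀ (π b) t (π b') := by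
  obtain ⟨c, a, a', h0, h1, rfl, rfl, hc⟩ := h
  exact (X.isTimeCurveOn_base hπ hc).flowsTo h0 h1

/-- At every nearby point `y`, uniqueness for the base field determines the source point `z`, and
uniqueness for the total field then determines the value. The choice made in `transport` is thus
invisible on germs. -/
theorem IsTransport.germ_eq [CompleteSpace E] [CompleteSpace EB] [T2Space M] [T2Space B]
    {X : ProjectableField E EB π} {p q q' : PointedSection E EB π} {t : ℝ}
    (h : IsTransport X p t q) (h' : IsTransport X p t q') : germ q = germ q' := by
  have hpt := h.1.unique X.base_smooth h'.1
  refine germ_eq_iff.mpr ⟨hpt, ?_⟩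
  have h2 := h'.2
  rw [← hpt] at h2
  filter_upwards [h.2, h2] with y ⟨z, hz, h3, h4⟩ ⟨z', hz', h3', h4'⟩
  obtain rfl := h3.unique X.base_smooth h3'
  exact h4.unique X.total_smooth h4'

theorem isTransport_zero [FiniteDimensional ℝ E] [FiniteDimensional ℝ EB]
    (X : ProjectableField E EB π) (p : PointedSection E EB π) : IsTransport X p 0 p := by
  refine ⟨FlowsTo.refl_zero X.base_smooth _, ?_⟩
  filter_upwards [p.sec.isOpen_dom.mem_nhds p.mem] with y hy
  exact ⟨y, hy, FlowsTo.refl_zero X.base_smooth _, FlowsTo.refl_zero X.total_smooth _⟩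

/-- `Q t` is the section `Fl^X_{t,0} ∘ σ ∘ Fl^{π_*X}_{0,t}`, given by local evolutions of the two
fields, for `|t| < δ`. -/
structure IsTransportFamily (X : ProjectableField E EB π) (ΨM : ℝ → ℝ → M → M)
    (ΨB : ℝ → ℝ → B → B) (O : Set M) (δ : ℝ) (p : PointedSection E EB π)
    (Q : ℝ → PointedSection E EB π) : Prop where
  pos : 0 < δ
  isTransport : ∀ t, |t| < δ → IsTransport X p t (Q t)
  pt : ∀ t, |t| < δ → (Q t).pt = ΨM 0 t p.pt
  pt_mem : ∀ t, |t| < δ → (Q t).pt ∈ O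
  toFun : ∀ t, |t| < δ → ∀ y, (Q t).sec.toFun y = ΨB 0 t (p.sec.toFun (ΨM t 0 y))
  isPlotOn : IsPlotOn {u : Euc 1 | |u 0| < δ} (fun u => Q (u 0))

/-- At time `0` the evolutions are the identity, so by openness the formula for the transported
section makes sense on one neighbourhood `O` for all small `t`. Such a common domain is what the
diffeology on sections asks for. -/
theorem exists_isTransportFamily [CompleteSpace E] [T2Space M]
    (hπ : ContMDiff 𝓘(ℝ, EB) 𝓘(ℝ, E) ∞ π) (X : ProjectableField E EB π)
    {εM εB : ℝ} {OM : Set M} {OB : Set B} {ΨM : ℝ → ℝ → M → M} {ΨB : ℝ → ℝ → B → B}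
    (hM : IsLocalEvolution E X.base εM OM ΨM) (hB : IsLocalEvolution EB X.total εB OB ΨB)
    (p : PointedSection E EB π) (hpM : p.pt ∈ OM) (hpB : p.value ∈ OB) :
    ∃ (δ : ℝ) (Q : ℝ → PointedSection E EB π), δ ≤ εM ∧ δ ≤ εB ∧
      IsTransportFamily X ΨM ΨB OM δ p Q := by
  let D : Set M := p.sec.dom ∩ p.sec.toFun ⁻¹' OB
  have hD : IsOpen D := p.sec.smooth.continuousOn.isOpen_inter_preimage p.sec.isOpen_dom hB.isOpen
  let back : ℝ × M → M := fun w => ΨM w.1 0 w.2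
  have hback : ContMDiffOn (𝓘(ℝ, ℝ).prod 𝓘(ℝ, E)) 𝓘(ℝ, E) ∞ back (Set.Ioo (-εM) εM ×ˢ OM) :=
    hM.smooth.comp (f := fun w : ℝ × M => ((w.1, (0 : ℝ)), w.2))
      ((contMDiff_fst.prodMk contMDiff_const).prodMk contMDiff_snd).contMDiffOn
      fun w hw => ⟨⟨hw.1, hM.zero_mem⟩, hw.2⟩
  have hG : IsOpen ((Set.Ioo (-εM) εM ×ˢ OM) ∩ back ⁻¹' D) :=
    hback.continuousOn.isOpen_inter_preimage (isOpen_Ioo.prod hM.isOpen) hD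
  obtain ⟨A, O, hA, hO, hA0, hpO, hAO⟩ := isOpen_prod_iff.mp hG 0 p.pt
    ⟨⟨hM.zero_mem, hpM⟩, by
      show ΨM 0 0 p.pt ∈ D
      rw [hM.init 0 hM.zero_mem _ hpM]
      exact ⟨p.mem, hpB⟩⟩
  have hφ : ContMDiffOn 𝓘(ℝ, ℝ) 𝓘(ℝ, E) ∞ (fun t => ΨM 0 t p.pt) (Set.Ioo (-εM) εM) :=
    hM.smooth.comp (f := fun t : ℝ => (((0 : ℝ), t), p.pt))
      ((contMDiff_const.prodMk contMDiff_id).prodMk contMDiff_const).contMDiffOn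
      fun t ht => ⟨⟨hM.zero_mem, ht⟩, hpM⟩
  -- The moved base point must also remain in the common domain `O`.
  have hA' : IsOpen (A ∩ (Set.Ioo (-εM) εM ∩ (fun t => ΨM 0 t p.pt) ⁻¹' O)) :=
    hA.inter (hφ.continuousOn.isOpen_inter_preimage isOpen_Ioo hO)
  obtain ⟨r, hr, hrA⟩ := Metric.isOpen_iff.mp hA' 0 ⟨hA0, hM.zero_mem, by
    show ΨM 0 0 p.pt ∈ O
    rwa [hM.init 0 hM.zero_mem _ hpM]⟩
  let δ := min r (min εM εB)
  have hδM : δ ≤ εM := (min_le_right _ _).trans (min_le_left _ _)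
  have hδB : δ ≤ εB := (min_le_right _ _).trans (min_le_right _ _)
  have hδ : 0 < δ := lt_min hr (lt_min hM.pos hB.pos)
  have hmem : ∀ t, |t| < δ → t ∈ A ∧ t ∈ Set.Ioo (-εM) εM ∧ ΨM 0 t p.pt ∈ O := fun t ht =>
    hrA (by
      rw [mem_ball_zero_iff, Real.norm_eq_abs]
      exact ht.trans_le (min_le_left _ _))
  have hmemB : ∀ t, |t| < δ → t ∈ Set.Ioo (-εB) εB := fun t ht => abs_lt.mp (ht.trans_le hδB)
  have hOM : O ⊆ OM := fun y hy => (hAO (Set.mk_mem_prod hA0 hy)).1.2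
  have hz : ∀ t, |t| < δ → ∀ y ∈ O, ΨM t 0 y ∈ D := fun t ht y hy =>
    (hAO (Set.mk_mem_prod (hmem t ht).1 hy)).2
  have hsec : ContMDiffOn (𝓘(ℝ, ℝ).prod 𝓘(ℝ, E)) 𝓘(ℝ, EB) ∞
      (fun w : ℝ × M => ΨB 0 w.1 (p.sec.toFun (ΨM w.1 0 w.2))) ({t | |t| < δ} ×ˢ O) := by
    have h1 : ContMDiffOn (𝓘(ℝ, ℝ).prod 𝓘(ℝ, E)) 𝓘(ℝ, E) ∞ back ({t | |t| < δ} ×ˢ O) :=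
      hback.mono fun w hw => ⟨(hmem _ hw.1).2.1, hOM hw.2⟩
    have h2 := p.sec.smooth.comp h1 fun w hw => (hz _ hw.1 _ hw.2).1
    exact hB.smooth.comp (f := fun w : ℝ × M => (((0 : ℝ), w.1), p.sec.toFun (back w)))
      ((contMDiff_const.prodMk contMDiff_fst).contMDiffOn.prodMk h2)
      fun w hw => ⟨⟨hB.zero_mem, hmemB _ hw.1⟩, (hz _ hw.1 _ hw.2).2⟩
  have hflowM : ∀ t, |t| < δ → ∀ y ∈ O, FlowsTo E X.base t y 0 (ΨM t 0 y) := fun t ht y hy =>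
    hM.flowsTo (hmem t ht).2.1 hM.zero_mem (hOM hy)
  have hflowB : ∀ t, |t| < δ → ∀ y ∈ O, FlowsTo EB X.total 0 (p.sec.toFun (ΨM t 0 y)) t
      (ΨB 0 t (p.sec.toFun (ΨM t 0 y))) := fun t ht y hy =>
    hB.flowsTo hB.zero_mem (hmemB t ht) (hz t ht y hy).2
  let q : ∀ t, |t| < δ → PointedSection E EB π := fun t ht =>
    { pt := ΨM 0 t p.pt
      sec :=
        { dom := O
          isOpen_dom := hO
          toFun := fun y => ΨB 0 t (p.sec.toFun (ΨM t 0 y))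
          smooth := hsec.comp (f := fun y => (t, y))
            (contMDiff_const.prodMk contMDiff_id).contMDiffOn fun y hy => ⟨ht, hy⟩
          proj := fun y hy => by
            -- The projected total flow and the base evolution both start at `ΨM t 0 y` at time `0`.
            -- The latter reaches `y` at time `t`, hence so does the former.
            have h1 := X.flowsTo_base hπ (hflowB t ht y hy)
            rw [p.sec.proj _ (hz t ht y hy).1] at h1
            exact h1.unique X.base_smooth (hflowM t ht y hy).symm }
      mem := (hmem t ht).2.2 }
  classical
  -- The value `p` outside `|t| < δ` is a filler and never enters.
  let Q : ℝ → PointedSection E EB π := fun t => if ht : |t| < δ then q t ht else p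
  have hQ : ∀ t (ht : |t| < δ), Q t = q t ht := fun t ht => dif_pos ht
  have hopen : IsOpen {u : Euc 1 | |u 0| < δ} := isOpen_lt (by fun_prop) continuous_const
  have hcoord : ContMDiff 𝓘(ℝ, Euc 1) 𝓘(ℝ, ℝ) ∞ (fun u : Euc 1 => u 0) :=
    ((EuclideanSpace.proj (0 : Fin 1) : Euc 1 →L[ℝ] ℝ).contDiff).contMDiff
  refine ⟨δ, Q, hδM, hδB, hδ, fun t ht => ?_, fun t ht => ?_, fun t ht => ?_, fun t ht y => ?_, ?_⟩
  · rw [hQ t ht]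
    refine ⟨hM.flowsTo hM.zero_mem (hmem t ht).2.1 hpM, ?_⟩
    filter_upwards [hO.mem_nhds (hmem t ht).2.2] with y hy
    exact ⟨_, (hz t ht y hy).1, hflowM t ht y hy, hflowB t ht y hy⟩
  · rw [hQ t ht]
  · rw [hQ t ht]
    exact hOM (hmem t ht).2.2
  · rw [hQ t ht]
  · refine (isPlotOn_ofCorePlotsOn (pointedSectionCorePlots E EB π) hopen).mpr
      ⟨?_, fun u hu x hx => ⟨{u : Euc 1 | |u 0| < δ}, O, hopen, hu, subset_rfl, hO, ?_, ?_, ?_⟩⟩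
    · exact (hφ.comp hcoord.contMDiffOn fun u hu => (hmem (u 0) hu).2.1).congr
        fun u hu => congrArg PointedSection.pt (hQ (u 0) hu)
    · have hx' : x ∈ (Q (u 0)).sec.dom := hx
      rwa [hQ (u 0) hu] at hx'
    · intro v hv
      show O ⊆ (Q (v 0)).sec.dom
      rw [hQ (v 0) hv]
    · exact (hsec.comp (f := fun w : Euc 1 × M => (w.1 0, w.2))
        ((hcoord.comp contMDiff_fst).prodMk contMDiff_snd).contMDiffOn
        fun w hw => ⟨hw.1, hw.2⟩).congr
        fun w hw => congrArg (fun q => q.sec.toFun w.2) (hQ (w.1 0) hw.1)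

end Transport

end GermBundle

namespace GermBundle

/-! ### Prolongations do not depend on the representing section -/

section Prolongation

variable {E EB EF M B : Type*}
  [NormedAddCommGroup E] [NormedSpace ℝ E] [NormedAddCommGroup EB] [NormedSpace ℝ EB]
  [NormedAddCommGroup EF] [NormedSpace ℝ EF]
  [TopologicalSpace M] [ChartedSpace E M] [TopologicalSpace B] [ChartedSpace EB B] {π : B → M}
  [IsManifold 𝓘(ℝ, E) ∞ M] [IsManifold 𝓘(ℝ, EB) ∞ B] [T2Space M]

omit [IsManifold 𝓘(ℝ, E) ∞ M] [IsManifold 𝓘(ℝ, EB) ∞ B] [T2Space M] in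
theorem value_eq_of_germ_eq {p q : PointedSection E EB π} (h : germ p = germ q) :
    p.value = q.value := by
  obtain ⟨hpt, hs⟩ := germ_eq_iff.mp h
  unfold PointedSection.value
  rw [hs.eq_of_nhds, hpt]

namespace IsTransportFamily

variable {X : ProjectableField E EB π} {εM εB : ℝ} {OM : Set M} {OB : Set B}
  {ΨM : ℝ → ℝ → M → M} {ΨB : ℝ → ℝ → B → B} {δ δ' : ℝ} {p p' : PointedSection E EB π}
  {Q Q' : ℝ → PointedSection E EB π}

omit [T2Space M] in
theorem eventually_abs_lt (hQ : IsTransportFamily X ΨM ΨB OM δ p Q) :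
    ∀ᶠ t in 𝓝 (0 : ℝ), |t| < δ :=
  (isOpen_lt continuous_abs continuous_const).mem_nhds (by simpa using hQ.pos)

/-- The backward evolution at the moved point needs that point to lie in `OM`, which is why the
family records `pt_mem`. -/
theorem back_pt [CompleteSpace E] (hM : IsLocalEvolution E X.base εM OM ΨM) (hδ : δ ≤ εM)
    (hp : p.pt ∈ OM) (hQ : IsTransportFamily X ΨM ΨB OM δ p Q) {t : ℝ} (ht : |t| < δ) :
    ΨM t 0 (Q t).pt = p.pt := by
  have h := hQ.pt_mem t ht
  rw [hQ.pt t ht] at h ⊢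
  exact hM.apply_apply X.base_smooth hM.zero_mem (abs_lt.mp (ht.trans_le hδ)) hp h

theorem value [CompleteSpace E] (hM : IsLocalEvolution E X.base εM OM ΨM) (hδ : δ ≤ εM)
    (hp : p.pt ∈ OM) (hQ : IsTransportFamily X ΨM ΨB OM δ p Q) {t : ℝ} (ht : |t| < δ) :
    (Q t).value = ΨB 0 t p.value := by
  unfold PointedSection.value
  rw [hQ.toFun t ht, hQ.back_pt hM hδ hp ht]

theorem tendsto_back [CompleteSpace E] (hM : IsLocalEvolution E X.base εM OM ΨM) (hδ : δ ≤ εM)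
    (hp : p.pt ∈ OM) (hQ : IsTransportFamily X ΨM ΨB OM δ p Q) {t : ℝ} (ht : |t| < δ) :
    Filter.Tendsto (ΨM t 0) (𝓝 (Q t).pt) (𝓝 p.pt) := by
  have h := (hM.contMDiffAt_apply (abs_lt.mp (ht.trans_le hδ)) hM.zero_mem
    (hQ.pt_mem t ht)).continuousAt.tendsto
  rwa [hQ.back_pt hM hδ hp ht] at h

theorem germ_congr [CompleteSpace E] (hM : IsLocalEvolution E X.base εM OM ΨM) (hδ : δ ≤ εM)
    (hp : p.pt ∈ OM) (hQ : IsTransportFamily X ΨM ΨB OM δ p Q)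
    (hQ' : IsTransportFamily X ΨM ΨB OM δ' p' Q') (h : germ p = germ p') {t : ℝ} (ht : |t| < δ)
    (ht' : |t| < δ') : germ (Q t) = germ (Q' t) := by
  obtain ⟨hpt, hs⟩ := germ_eq_iff.mp h
  refine germ_eq_iff.mpr ⟨by rw [hQ.pt t ht, hQ'.pt t ht', hpt], ?_⟩
  filter_upwards [(hQ.tendsto_back hM hδ hp ht).eventually hs] with y hy
  rw [hQ.toFun t ht, hQ'.toFun t ht', hy]

/-- Near the transported point, the coordinate expression of the transported section is a smooth
expression in the coordinate expression of the original section. -/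
theorem deriv_eq [CompleteSpace E] (hM : IsLocalEvolution E X.base εM OM ΨM) (hδ : δ ≤ εM)
    (hp : p.pt ∈ OM) (hQ : IsTransportFamily X ΨM ΨB OM δ p Q) {t : ℝ} (ht : |t| < δ)
    (c c₀ : FibredChart E EB EF π) (hc₀ : p.value ∈ c₀.total.source)
    (hc : (Q t).value ∈ c.total.source) (j : ℕ) :
    c.deriv j (Q t) = iteratedFDeriv ℝ j
      (fun w => (fun v : E × EF => (c.total (ΨB 0 t (c₀.total.symm v))).2)
        (c₀.base (ΨM t 0 (c.base.symm w)),
          (c₀.total (p.sec.toFun (c₀.base.symm (c₀.base (ΨM t 0 (c.base.symm w)))))).2))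
      (c.base (Q t).pt) := by
  have hpt := c.pt_mem_base_source _ hc
  have hpt₀ := c₀.pt_mem_base_source _ hc₀
  have htend : Filter.Tendsto (fun w => ΨM t 0 (c.base.symm w)) (𝓝 (c.base (Q t).pt))
      (𝓝 p.pt) := by
    refine (hQ.tendsto_back hM hδ hp ht).comp ?_
    have := (c.base.continuousAt_symm (c.base.map_source hpt)).tendsto
    rwa [c.base.left_inv hpt] at this
  have hcont : ContinuousAt p.sec.toFun p.pt :=
    (p.sec.smooth.contMDiffAt (p.sec.isOpen_dom.mem_nhds p.mem)).continuousAt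
  refine Filter.EventuallyEq.eq_of_nhds (Filter.EventuallyEq.iteratedFDeriv ℝ ?_ j)
  filter_upwards [htend.eventually (p.sec.isOpen_dom.mem_nhds p.mem),
    htend.eventually (c₀.base.open_source.mem_nhds hpt₀),
    htend.eventually (hcont.preimage_mem_nhds (c₀.total.open_source.mem_nhds hc₀))]
    with w h1 h2 h3
  rw [hQ.toFun t ht]
  simp only [c₀.base.left_inv h2]
  have h4 := (c₀.proj _ h3).2
  rw [p.sec.proj _ h1] at h4
  -- A fibred chart lies over its base chart and `σ` is a section, so base point and fibre
  -- coordinate together are the total coordinates of the value. This puts the expression in the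
  -- form `h (a w, s (a w))`.
  have h5 : (c₀.base (ΨM t 0 (c.base.symm w)),
      (c₀.total (p.sec.toFun (ΨM t 0 (c.base.symm w)))).2) =
      c₀.total (p.sec.toFun (ΨM t 0 (c.base.symm w))) := Prod.ext h4.symm rfl
  rw [h5, c₀.total.left_inv h3]

/-- Both transported sections have the form `w ↦ h (a w, s (a w))` by `deriv_eq`. Here `a` comes
from the backward base evolution and `h` from the forward total evolution. Only `s`, the coordinate
expression of the original section, differs, and its derivatives agree up to order `k`. -/
theorem jet_congr [CompleteSpace E] (hM : IsLocalEvolution E X.base εM OM ΨM)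
    (hB : IsLocalEvolution EB X.total εB OB ΨB) (hδ : δ ≤ εM) (hδB : δ ≤ εB) (hδ' : δ' ≤ εM)
    (hp : p.pt ∈ OM) (hpB : p.value ∈ OB) (c₀ : FibredChart E EB EF π)
    (hc₀ : p.value ∈ c₀.total.source) (hQ : IsTransportFamily X ΨM ΨB OM δ p Q)
    (hQ' : IsTransportFamily X ΨM ΨB OM δ' p' Q') {k : ℕ} (h : jet EF k p = jet EF k p') {t : ℝ}
    (ht : |t| < δ) (ht' : |t| < δ') : jet EF k (Q t) = jet EF k (Q' t) := by
  obtain ⟨hpt, hval, hder⟩ := jet_eq_iff.mp h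
  have hp' : p'.pt ∈ OM := hpt ▸ hp
  have hQpt : (Q t).pt = (Q' t).pt := by rw [hQ.pt t ht, hQ'.pt t ht', hpt]
  have hQval : (Q t).value = (Q' t).value := by
    rw [hQ.value hM hδ hp ht, hQ'.value hM hδ' hp' ht', hval]
  refine jet_eq_iff.mpr ⟨hQpt, hQval, fun c hc j hj => ?_⟩
  rw [hQ.deriv_eq hM hδ hp ht c c₀ hc₀ hc, hQ'.deriv_eq hM hδ' hp' ht' c c₀ (hval ▸ hc₀)
    (hQval ▸ hc), ← hQpt]
  have hbase := c.pt_mem_base_source _ hc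
  have hbase₀ := c₀.pt_mem_base_source _ hc₀
  have hsymm := c.base.left_inv hbase
  have hback := hQ.back_pt hM hδ hp ht
  have htM := abs_lt.mp (ht.trans_le hδ)
  have ha : c₀.base (ΨM t 0 (c.base.symm (c.base (Q t).pt))) = c₀.base p.pt := by
    rw [hsymm, hback]
  have hsmooth : ∀ q : PointedSection E EB π, q.pt = p.pt → q.value = p.value →
      ContDiffAt ℝ ∞ (fun z : E => (c₀.total (q.sec.toFun (c₀.base.symm z))).2)
        (c₀.base (ΨM t 0 (c.base.symm (c.base (Q t).pt)))) := by
    intro q hq hqv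
    rw [ha, ← hq]
    refine c₀.contDiffAt_section
      (q.sec.smooth.contMDiffAt (q.sec.isOpen_dom.mem_nhds q.mem)) (hq ▸ hbase₀) ?_
    show q.value ∈ c₀.total.source
    rwa [hqv]
  have hcoord : (c₀.base p.pt, (c₀.total (p.sec.toFun (c₀.base.symm (c₀.base p.pt)))).2) =
      c₀.total p.value := by
    rw [c₀.base.left_inv hbase₀]
    refine Prod.ext ?_ rfl
    rw [(c₀.proj _ hc₀).2, p.proj_value]
  refine iteratedFDeriv_comp_eq_of_jet_eq
    (a := fun w => c₀.base (ΨM t 0 (c.base.symm w)))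
    (h := fun v : E × EF => (c.total (ΨB 0 t (c₀.total.symm v))).2)
    (hsmooth p rfl rfl) (hsmooth p' hpt.symm hval.symm) ?_ ?_ ?_ j hj
  · rw [← contMDiffAt_iff_contDiffAt]
    have h1 : ContMDiffAt 𝓘(ℝ, E) 𝓘(ℝ, E) ∞ (fun w => ΨM t 0 (c.base.symm w))
        (c.base (Q t).pt) :=
      (hM.contMDiffAt_apply htM hM.zero_mem (hQ.pt_mem t ht)).comp_of_eq
        (c.contMDiffAt_base_symm hbase) hsymm
    exact (c₀.contMDiffAt_base hbase₀).comp_of_eq h1 (by rw [hsymm, hback])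
  · rw [ha, hcoord, ← contMDiffAt_iff_contDiffAt]
    have hinv := c₀.total.left_inv hc₀
    have h1 : ContMDiffAt 𝓘(ℝ, E × EF) 𝓘(ℝ, EB) ∞ (fun v => ΨB 0 t (c₀.total.symm v))
        (c₀.total p.value) :=
      (hB.contMDiffAt_apply hB.zero_mem (abs_lt.mp (ht.trans_le hδB)) hpB).comp_of_eq
        (c₀.contMDiffAt_total_symm (c₀.total.map_source hc₀)) hinv
    have h2 : ContMDiffAt 𝓘(ℝ, E × EF) 𝓘(ℝ, E × EF) ∞
        (fun v => c.total (ΨB 0 t (c₀.total.symm v))) (c₀.total p.value) := by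
      refine ContMDiffAt.comp _ (c.contMDiffAt_total ?_) h1
      rw [hinv, ← hQ.value hM hδ hp ht]
      exact hc
    exact contDiffAt_snd.contMDiffAt.comp _ h2
  · intro i hi
    rw [ha]
    have := hder c₀ hc₀ i hi
    simp only [FibredChart.deriv] at this
    rw [← hpt] at this
    exact this

end IsTransportFamily

omit [T2Space M] in
theorem IsTransport.transport {X : ProjectableField E EB π} {p q : PointedSection E EB π} {t : ℝ}
    (h : IsTransport X p t q) : IsTransport X p t (transport X p t) := by
  have h' : ∃ q, IsTransport X p t q := ⟨q, h⟩
  rw [GermBundle.transport, dif_pos h']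
  exact h'.choose_spec

variable [FiniteDimensional ℝ E] [FiniteDimensional ℝ EB] [T2Space B]

theorem IsTransport.germ_transport {X : ProjectableField E EB π} {p q : PointedSection E EB π}
    {t : ℝ} (h : IsTransport X p t q) : germ (GermBundle.transport X p t) = germ q :=
  have := FiniteDimensional.complete ℝ E
  have := FiniteDimensional.complete ℝ EB
  h.transport.germ_eq h

omit [T2Space B] in
/-- Simultaneous transport of two sections with the same value. -/
theorem ProjectableField.exists_transportFamilies (hπ : ContMDiff 𝓘(ℝ, EB) 𝓘(ℝ, E) ∞ π)
    (X : ProjectableField E EB π) (b : B) :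
    ∃ (εM εB : ℝ) (OM : Set M) (OB : Set B) (ΨM : ℝ → ℝ → M → M) (ΨB : ℝ → ℝ → B → B),
      IsLocalEvolution E X.base εM OM ΨM ∧ IsLocalEvolution EB X.total εB OB ΨB ∧ π b ∈ OM ∧
      b ∈ OB ∧ ∀ p : PointedSection E EB π, p.value = b →
        ∃ (δ : ℝ) (Q : ℝ → PointedSection E EB π), δ ≤ εM ∧ δ ≤ εB ∧
          IsTransportFamily X ΨM ΨB OM δ p Q := by
  have := FiniteDimensional.complete ℝ E
  obtain ⟨εM, OM, ΨM, hbM, hM⟩ := exists_isLocalEvolution X.base_smooth (π b)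
  obtain ⟨εB, OB, ΨB, hbB, hB⟩ := exists_isLocalEvolution X.total_smooth b
  -- The evolutions depend only on `b`, so the same pair serves all sections with this value; the
  -- comparison of two representatives relies on that.
  refine ⟨εM, εB, OM, OB, ΨM, ΨB, hM, hB, hbM, hbB, fun p hp => ?_⟩
  subst hp
  exact exists_isTransportFamily hπ X hM hB p (p.proj_value ▸ hbM) hbB

omit [T2Space B] in
theorem eventually_isTransport_transport (hπ : ContMDiff 𝓘(ℝ, EB) 𝓘(ℝ, E) ∞ π)
    (X : ProjectableField E EB π) (p : PointedSection E EB π) :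
    ∀ᶠ t in 𝓝 (0 : ℝ), IsTransport X p t (transport X p t) := by
  obtain ⟨_, _, _, _, _, _, -, -, -, -, hfam⟩ := X.exists_transportFamilies hπ p.value
  obtain ⟨δ, Q, -, -, hQ⟩ := hfam p rfl
  filter_upwards [hQ.eventually_abs_lt] with t ht
  exact (hQ.isTransport t ht).transport

/-- The germs of `transport` agree with those of an explicit smooth family, although the chosen
sections themselves need not vary smoothly with `t`. -/
theorem isSmoothCurveAt_germ_transport (hπ : ContMDiff 𝓘(ℝ, EB) 𝓘(ℝ, E) ∞ π)
    (X : ProjectableField E EB π) (p : PointedSection E EB π) :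
    IsSmoothCurveAt (fun t => germ (transport X p t)) (germ p) := by
  obtain ⟨_, _, _, _, _, _, -, -, -, -, hfam⟩ := X.exists_transportFamilies hπ p.value
  obtain ⟨δ, Q, -, -, hQ⟩ := hfam p rfl
  exact ⟨(isTransport_zero X p).germ_transport, δ, hQ.pos,
    (isPlotOn_germ hQ.isPlotOn).congr fun u hu =>
      ((hQ.isTransport (u 0) hu).germ_transport).symm⟩

theorem germ_transport_congr (hπ : ContMDiff 𝓘(ℝ, EB) 𝓘(ℝ, E) ∞ π)
    (X : ProjectableField E EB π) {p p' : PointedSection E EB π} (h : germ p = germ p') :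
    (fun t => germ (transport X p t)) =ᶠ[𝓝 0] fun t => germ (transport X p' t) := by
  have := FiniteDimensional.complete ℝ E
  obtain ⟨_, _, _, _, _, _, hM, -, hbM, -, hfam⟩ := X.exists_transportFamilies hπ p.value
  obtain ⟨δ, Q, hδ, -, hQ⟩ := hfam p rfl
  obtain ⟨δ', Q', -, -, hQ'⟩ := hfam p' (value_eq_of_germ_eq h).symm
  filter_upwards [hQ.eventually_abs_lt, hQ'.eventually_abs_lt] with t ht ht'
  rw [(hQ.isTransport t ht).germ_transport, (hQ'.isTransport t ht').germ_transport]
  exact hQ.germ_congr hM hδ (p.proj_value ▸ hbM) hQ' h ht ht'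

theorem jet_transport_congr {F : Type*} [TopologicalSpace F] [ChartedSpace EF F]
    [IsManifold 𝓘(ℝ, EF) ∞ F] (hπ : IsFibreBundle E EB EF F π) (X : ProjectableField E EB π)
    {k : ℕ} {p p' : PointedSection E EB π} (h : jet EF k p = jet EF k p') :
    (fun t => jet EF k (transport X p t)) =ᶠ[𝓝 0] fun t => jet EF k (transport X p' t) := by
  have := FiniteDimensional.complete ℝ E
  obtain ⟨_, _, _, _, _, _, hM, hB, hbM, hbB, hfam⟩ :=
    X.exists_transportFamilies hπ.smooth p.value
  obtain ⟨δ, Q, hδ, hδB, hQ⟩ := hfam p rfl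
  obtain ⟨δ', Q', hδ', -, hQ'⟩ := hfam p' (jet_eq_iff.mp h).2.1.symm
  obtain ⟨c₀, hc₀⟩ := hπ.exists_fibredChart p.value
  have hjet : ∀ {q q' : PointedSection E EB π}, germ q = germ q' → jet EF k q = jet EF k q' :=
    fun h => congrArg (germToJet E EB EF π k) h
  filter_upwards [hQ.eventually_abs_lt, hQ'.eventually_abs_lt] with t ht ht'
  rw [hjet (hQ.isTransport t ht).germ_transport, hjet (hQ'.isTransport t ht').germ_transport]
  exact hQ.jet_congr hM hB hδ hδB hδ' (p.proj_value ▸ hbM) hbB c₀ hc₀ hQ' h ht ht'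

/-- The values of the transported sections follow the flow of the total field. -/
theorem hasMFDerivAt_value_transport (hπ : ContMDiff 𝓘(ℝ, EB) 𝓘(ℝ, E) ∞ π)
    (X : ProjectableField E EB π) (p : PointedSection E EB π) :
    HasMFDerivAt 𝓘(ℝ, ℝ) 𝓘(ℝ, EB) (fun t => (transport X p t).value) 0
      ((1 : ℝ →L[ℝ] ℝ).smulRight (X.total 0 p.value : EB)) := by
  have := FiniteDimensional.complete ℝ E
  obtain ⟨_, _, _, _, _, ΨB, hM, hB, hbM, hbB, hfam⟩ := X.exists_transportFamilies hπ p.value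
  obtain ⟨δ, Q, hδ, -, hQ⟩ := hfam p rfl
  have h1 := hB.curve 0 hB.zero_mem p.value hbB 0 hB.zero_mem
  -- The type of `X.total 0 b` depends on `b`, so the equality of points is transferred to vectors
  -- inside the model space `EB`.
  have h2 : ∀ b, b = p.value → (X.total 0 b : EB) = X.total 0 p.value := by
    rintro _ rfl
    rfl
  rw [h2 _ (hB.init 0 hB.zero_mem p.value hbB)] at h1
  refine h1.congr_of_eventuallyEq ?_
  filter_upwards [hQ.eventually_abs_lt] with t ht
  rw [value_eq_of_germ_eq (hQ.isTransport t ht).germ_transport]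
  exact hQ.value hM hδ (p.proj_value ▸ hbM) ht

/-- The definition uses the representative `Quotient.out`. Any other one gives a curve that agrees
with it near `t = 0`, hence the same velocity. -/
theorem germProlongation_germ (hπ : ContMDiff 𝓘(ℝ, EB) 𝓘(ℝ, E) ∞ π)
    (X : ProjectableField E EB π) (p : PointedSection E EB π) :
    germProlongation X (germ p) =
      ⟨germ p, velocityAt (germ p) (fun t => germ (transport X p t))⟩ := by
  have h : germ p = germ (Quotient.out (germ p)) := (Quotient.out_eq (germ p)).symm
  exact congrArg (Sigma.mk (germ p)) (velocityAt_congr (isSmoothCurveAt_germ_transport hπ X p)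
    (germ_transport_congr hπ X h)).symm

theorem isSmoothCurveAt_jet_transport (hπ : ContMDiff 𝓘(ℝ, EB) 𝓘(ℝ, E) ∞ π)
    (X : ProjectableField E EB π) (k : ℕ) (p : PointedSection E EB π) :
    IsSmoothCurveAt (fun t => jet EF k (transport X p t)) (jet EF k p) :=
  (isSmoothCurveAt_germ_transport hπ X p).map (dSmooth_germToJet k)

variable {F : Type*} [TopologicalSpace F] [ChartedSpace EF F] [IsManifold 𝓘(ℝ, EF) ∞ F]

theorem jetProlongation_jet (hπ : IsFibreBundle E EB EF F π) (X : ProjectableField E EB π)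
    (k : ℕ) (p : PointedSection E EB π) :
    jetProlongation k X (jet EF k p) =
      ⟨jet EF k p, velocityAt (jet EF k p) (fun t => jet EF k (transport X p t))⟩ := by
  have h : jet EF k p = jet EF k (Quotient.out (jet EF k p)) := (Quotient.out_eq (jet EF k p)).symm
  exact congrArg (Sigma.mk (jet EF k p)) (velocityAt_congr
    (isSmoothCurveAt_jet_transport hπ.smooth X k p) (jet_transport_congr hπ X h)).symm

/-- On representatives the projection turns the curve of germs into the curve of jets by definition,
and differentials respect velocities. -/
theorem internalTangentMap_germToJet (hπ : IsFibreBundle E EB EF F π)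
    (X : ProjectableField E EB π) (k : ℕ) (γ : Germ E EB π) :
    internalTangentMap (dSmooth_germToJet k) (germProlongation X γ) =
      jetProlongation k X (germToJet E EB EF π k γ) := by
  obtain ⟨p, rfl⟩ : ∃ p, germ p = γ := ⟨_, Quotient.out_eq γ⟩
  rw [germProlongation_germ hπ.smooth, internalTangentMap_velocityAt
    (isSmoothCurveAt_germ_transport hπ.smooth X p) (dSmooth_germToJet k)
    (y := jet EF k p) (c' := fun t => jet EF k (transport X p t)) rfl (by rfl)]
  exact (jetProlongation_jet hπ X k p).symm

theorem internalTangentMap_jetProj (hπ : IsFibreBundle E EB EF F π)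
    (X : ProjectableField E EB π) {l k : ℕ} (h : l ≤ k) (θ : Jet E EB EF π k) :
    internalTangentMap (dSmooth_jetProj E EB EF π h) (jetProlongation k X θ) =
      jetProlongation l X (jetProj E EB EF π h θ) := by
  obtain ⟨p, rfl⟩ : ∃ p, jet EF k p = θ := ⟨_, Quotient.out_eq θ⟩
  rw [jetProlongation_jet hπ, internalTangentMap_velocityAt
    (isSmoothCurveAt_jet_transport hπ.smooth X k p) (dSmooth_jetProj E EB EF π h)
    (y := jet EF l p) (c' := fun t => jet EF l (transport X p t)) rfl (by rfl)]
  exact (jetProlongation_jet hπ X l p).symm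

theorem toTangentBundle_jetProlongation (hπ : IsFibreBundle E EB EF F π)
    (X : ProjectableField E EB π) (k : ℕ) (θ : Jet E EB EF π k) :
    toTangentBundle (internalTangentMap (hπ.dSmooth_jetValue k) (jetProlongation k X θ)) =
      (⟨jetValue θ, X.total 0 (jetValue θ)⟩ : TangentBundle 𝓘(ℝ, EB) B) := by
  obtain ⟨p, rfl⟩ : ∃ p, jet EF k p = θ := ⟨_, Quotient.out_eq θ⟩
  have hc := isSmoothCurveAt_jet_transport (EF := EF) hπ.smooth X k p
  rw [jetProlongation_jet hπ, internalTangentMap_velocityAt hc (hπ.dSmooth_jetValue k)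
    (Y := AsDiffeological EB B) (y := p.value) (c' := fun t => (transport X p t).value) rfl
    (by rfl)]
  refine congrArg (Bundle.TotalSpace.mk p.value) ?_
  exact toTangentSpace_velocityAt (hc.map (hπ.dSmooth_jetValue k))
    (hasMFDerivAt_value_transport hπ.smooth X p)

omit [IsManifold 𝓘(ℝ, E) ∞ M] [IsManifold 𝓘(ℝ, EB) ∞ B] [T2Space M] [FiniteDimensional ℝ E]
    [FiniteDimensional ℝ EB] [T2Space B] in
theorem germToJet_surjective (k : ℕ) : Function.Surjective (germToJet E EB EF π k) := by
  intro θ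
  obtain ⟨p, rfl⟩ : ∃ p, jet EF k p = θ := ⟨_, Quotient.out_eq θ⟩
  exact ⟨germ p, rfl⟩

omit [IsManifold 𝓘(ℝ, EB) ∞ B] [T2Space M] [FiniteDimensional ℝ E] [FiniteDimensional ℝ EB]
    [T2Space B] in
theorem IsFibreBundle.jetValue_surjective (hπ : IsFibreBundle E EB EF F π) (k : ℕ) :
    Function.Surjective (jetValue : Jet E EB EF π k → AsDiffeological EB B) := by
  intro b
  obtain ⟨p, hp⟩ := hπ.exists_value_eq b
  exact ⟨jet EF k p, hp⟩

-- Autonomy reduces the total field to time `0`, and surjectivity of `π` makes the base field a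
-- function of the total one.
omit [T2Space M] [FiniteDimensional ℝ E] [FiniteDimensional ℝ EB] [T2Space B] in
theorem AutonomousField.ext_total_zero (hπ : Function.Surjective π)
    {X Y : AutonomousField E EB π} (h : X.1.total 0 = Y.1.total 0) : X = Y := by
  obtain ⟨⟨XT, XB, hXT, hXB, hX⟩, hX0⟩ := X
  obtain ⟨⟨YT, YB, hYT, hYB, hY⟩, hY0⟩ := Y
  have hT : XT = YT := funext fun t => (hX0 t).trans (h.trans (hY0 t).symm)
  subst hT
  have hB : XB = YB := by
    funext t x
    obtain ⟨b, rfl⟩ := hπ x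
    exact (hX t b).symm.trans (hY t b)
  subst hB
  rfl

end Prolongation

end GermBundle

namespace GermBundle

/-! ### Chain rule for internal tangent maps. -/

section Functoriality

variable {X Y Z : Type*} [DiffeologicalSpace X] [DiffeologicalSpace Y] [DiffeologicalSpace Z]

theorem differential_comp {f : X → Y} {g : Y → Z} (hg : DSmooth g) (hf : DSmooth f) (x : X) :
    differential (hg.comp hf) x = differential hg (f x) ∘ₗ differential hf x := by
  classical
  refine Submodule.linearMap_qext _ (DirectSum.linearMap_ext ℝ fun φ => LinearMap.ext fun v => ?_)
  refine (differentialAux_plotVector (hg.comp hf) φ v).trans ?_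
  refine Eq.trans ?_ (congrArg (differential hg (f x)) (differentialAux_plotVector hf φ v)).symm
  exact (differentialAux_plotVector hg (φ.map hf) v).symm

theorem internalTangentMap_comp {f : X → Y} {g : Y → Z} (hg : DSmooth g) (hf : DSmooth f)
    (v : InternalTangentBundle X) :
    internalTangentMap (hg.comp hf) v = internalTangentMap hg (internalTangentMap hf v) :=
  congrArg (Sigma.mk (g (f v.1))) (LinearMap.congr_fun (differential_comp hg hf v.1) v.2)

end Functoriality

/-! ### Pushforward maps between the spaces of prolonged fields. -/

section Tower

variable {E EB EF M B F : Type*}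
  [NormedAddCommGroup E] [NormedSpace ℝ E] [FiniteDimensional ℝ E]
  [NormedAddCommGroup EB] [NormedSpace ℝ EB] [FiniteDimensional ℝ EB]
  [NormedAddCommGroup EF] [NormedSpace ℝ EF]
  [TopologicalSpace M] [ChartedSpace E M] [IsManifold 𝓘(ℝ, E) ∞ M] [T2Space M]
  [TopologicalSpace B] [ChartedSpace EB B] [IsManifold 𝓘(ℝ, EB) ∞ B] [T2Space B]
  [TopologicalSpace F] [ChartedSpace EF F] [IsManifold 𝓘(ℝ, EF) ∞ F] {π : B → M}

/-- By the chain rule the component of order `k` is the differential of the composite projection,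
which is `germToJet` at level `k`. -/
theorem jetInfTangentComparison_germToJetInf (hπ : IsFibreBundle E EB EF F π)
    (X : ProjectableField E EB π) :
    jetInfTangentComparison E EB EF π ∘ internalTangentMap dSmooth_germToJetInf ∘
      germProlongation X = jetInfProlongation X ∘ germToJetInf E EB EF π := by
  funext γ k
  refine (internalTangentMap_comp (dSmooth_jetInfProj E EB EF π k) dSmooth_germToJetInf _).symm.trans
    (internalTangentMap_germToJet hπ X k γ)

theorem jetInfProlongation_mem (hπ : IsFibreBundle E EB EF F π) (X : ProjectableField E EB π)
    (θ : JetInf E EB EF π) : jetInfProlongation X θ ∈ jetInfTangent E EB EF π := fun l k h =>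
  (internalTangentMap_jetProj hπ X h (θ.1 k)).trans (congrArg (jetProlongation l X) (θ.2 l k h))

omit [FiniteDimensional ℝ E] [FiniteDimensional ℝ EB] [IsManifold 𝓘(ℝ, E) ∞ M] [T2Space M]
    [IsManifold 𝓘(ℝ, EB) ∞ B] [T2Space B] in
theorem jetProj_surjective {l k : ℕ} (h : l ≤ k) :
    Function.Surjective (jetProj E EB EF π h) := fun θ =>
  have ⟨γ, hγ⟩ := germToJet_surjective l θ
  ⟨germToJet E EB EF π k γ, ((germToJetInf E EB EF π γ).2 l k h).trans hγ⟩

omit [FiniteDimensional ℝ E] [FiniteDimensional ℝ EB] [IsManifold 𝓘(ℝ, E) ∞ M] [T2Space M]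
    [IsManifold 𝓘(ℝ, EB) ∞ B] [T2Space B] in
theorem jetInfProj_surjective (k : ℕ) : Function.Surjective (jetInfProj E EB EF π k) := fun θ =>
  have ⟨γ, hγ⟩ := germToJet_surjective k θ
  ⟨germToJetInf E EB EF π γ, hγ⟩

omit [FiniteDimensional ℝ E] [FiniteDimensional ℝ EB] [T2Space M] [T2Space B] in
/-- A field in the image of `𝔭^∞` is determined by its restriction to the jets of sections. -/
theorem jetInfFields_ext {V W : JetInfFields E EB EF π}
    (h : V.1 ∘ germToJetInf E EB EF π = W.1 ∘ germToJetInf E EB EF π) : V = W := by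
  obtain ⟨_, X, rfl⟩ := V
  obtain ⟨_, Y, rfl⟩ := W
  refine Subtype.ext (funext fun θ => funext fun k => ?_)
  -- Surjectivity of `germToJetInf` (Borel's theorem) is not needed: the component of order `k` at
  -- `θ` depends only on the `k`-jet of `θ`, which is the jet of a germ.
  obtain ⟨γ, hγ⟩ := germToJet_surjective k (jetInfProj E EB EF π k θ)
  have := congrFun (congrFun h γ) k
  change jetProlongation k X.1 (germToJet E EB EF π k γ) =
    jetProlongation k Y.1 (germToJet E EB EF π k γ) at this
  rw [hγ] at this
  exact this

/-- `V ↦ (π^{∞,g})_* V`. -/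
noncomputable def germPushJetInf (V : GermFields E EB π) : JetInfFields E EB EF π :=
  ⟨jetInfProlongation V.2.choose.1, V.2.choose, rfl⟩

/-- `V ↦ (π^{k,g})_* V`. -/
noncomputable def germPushJet (k : ℕ) (V : GermFields E EB π) : JetFields E EB EF π k :=
  ⟨jetProlongation k V.2.choose.1, V.2.choose, rfl⟩

/-- `V ↦ (π^{k,∞})_* V`. -/
noncomputable def jetInfPushJet (k : ℕ) (V : JetInfFields E EB EF π) : JetFields E EB EF π k :=
  ⟨jetProlongation k V.2.choose.1, V.2.choose, rfl⟩

/-- `V ↦ (π^{l,k})_* V`. -/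
noncomputable def jetPushJet (l k : ℕ) (_ : l ≤ k) (V : JetFields E EB EF π k) :
    JetFields E EB EF π l :=
  ⟨jetProlongation l V.2.choose.1, V.2.choose, rfl⟩

/-- The field on `B` to which a field on `Γ_0(π)` projects. -/
noncomputable def jetPushTotal (V : JetFields E EB EF π 0) : AutonomousField E EB π :=
  V.2.choose

/-- The pushforward is defined through a chosen X with prolongation `V`. The projection identity for
X gives one direction and `jetInfFields_ext` gives uniqueness, so the choice is immaterial. The
other pushforwards are characterised in the same way, with a surjective projection giving
uniqueness. -/
theorem eq_germPushJetInf_iff (hπ : IsFibreBundle E EB EF F π) (V : GermFields E EB π)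
    (W : JetInfFields E EB EF π) : W = germPushJetInf V ↔
      jetInfTangentComparison E EB EF π ∘ internalTangentMap dSmooth_germToJetInf ∘ V.1 =
        W.1 ∘ germToJetInf E EB EF π := by
  have hV : jetInfTangentComparison E EB EF π ∘ internalTangentMap dSmooth_germToJetInf ∘ V.1 =
      (germPushJetInf V).1 ∘ germToJetInf E EB EF π := by
    rw [← V.2.choose_spec]
    exact jetInfTangentComparison_germToJetInf hπ V.2.choose.1
  exact ⟨fun h => h ▸ hV, fun h => jetInfFields_ext (h.symm.trans hV)⟩

theorem eq_germPushJet_iff (hπ : IsFibreBundle E EB EF F π) (k : ℕ) (V : GermFields E EB π)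
    (W : JetFields E EB EF π k) : W = germPushJet k V ↔
      internalTangentMap (dSmooth_germToJet k) ∘ V.1 = W.1 ∘ germToJet E EB EF π k := by
  have hV : internalTangentMap (dSmooth_germToJet k) ∘ V.1 =
      (germPushJet k V).1 ∘ germToJet E EB EF π k := by
    rw [← V.2.choose_spec]
    exact funext (internalTangentMap_germToJet hπ V.2.choose.1 k)
  exact ⟨fun h => h ▸ hV, fun h =>
    Subtype.ext ((germToJet_surjective k).injective_comp_right (h.symm.trans hV))⟩

omit [FiniteDimensional ℝ E] [FiniteDimensional ℝ EB] [T2Space M] [T2Space B] in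
theorem eq_jetInfPushJet_iff (k : ℕ) (V : JetInfFields E EB EF π) (W : JetFields E EB EF π k) :
    W = jetInfPushJet k V ↔ ∀ θ, V.1 θ k = W.1 (jetInfProj E EB EF π k θ) := by
  have hV : ∀ θ, V.1 θ k = (jetInfPushJet k V).1 (jetInfProj E EB EF π k θ) := by
    rw [← V.2.choose_spec]
    exact fun θ => rfl
  exact ⟨fun h => h ▸ hV, fun h => Subtype.ext ((jetInfProj_surjective k).injective_comp_right
    (funext fun θ => (h θ).symm.trans (hV θ)))⟩

theorem eq_jetPushJet_iff (hπ : IsFibreBundle E EB EF F π) (l k : ℕ) (h : l ≤ k)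
    (V : JetFields E EB EF π k) (W : JetFields E EB EF π l) : W = jetPushJet l k h V ↔
      internalTangentMap (dSmooth_jetProj E EB EF π h) ∘ V.1 = W.1 ∘ jetProj E EB EF π h := by
  have hV : internalTangentMap (dSmooth_jetProj E EB EF π h) ∘ V.1 =
      (jetPushJet l k h V).1 ∘ jetProj E EB EF π h := by
    rw [← V.2.choose_spec]
    exact funext (internalTangentMap_jetProj hπ V.2.choose.1 h)
  exact ⟨fun h' => h' ▸ hV, fun h' =>
    Subtype.ext ((jetProj_surjective h).injective_comp_right (h'.symm.trans hV))⟩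

theorem eq_jetPushTotal_iff (hπ : IsFibreBundle E EB EF F π) (V : JetFields E EB EF π 0)
    (W : AutonomousField E EB π) : W = jetPushTotal V ↔
      ∀ θ, toTangentBundle (internalTangentMap (hπ.dSmooth_jetValue 0) (V.1 θ)) =
        (⟨jetValue θ, W.1.total 0 (jetValue θ)⟩ : TangentBundle 𝓘(ℝ, EB) B) := by
  have hV : ∀ θ, toTangentBundle (internalTangentMap (hπ.dSmooth_jetValue 0) (V.1 θ)) =
      (⟨jetValue θ, (jetPushTotal V).1.total 0 (jetValue θ)⟩ : TangentBundle 𝓘(ℝ, EB) B) := by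
    rw [← V.2.choose_spec]
    exact toTangentBundle_jetProlongation hπ V.2.choose.1 0
  refine ⟨fun h => h ▸ hV, fun h => AutonomousField.ext_total_zero hπ.surjective ?_⟩
  funext b
  obtain ⟨θ, hθ⟩ := hπ.jetValue_surjective 0 b
  have h' := (h θ).symm.trans (hV θ)
  rw [hθ] at h'
  exact eq_of_heq (Bundle.TotalSpace.mk.inj h').2

theorem germPushJetInf_germProlongation (hπ : IsFibreBundle E EB EF F π)
    (X : AutonomousField E EB π) : germPushJetInf ⟨germProlongation X.1, X, rfl⟩ =
      (⟨jetInfProlongation X.1, X, rfl⟩ : JetInfFields E EB EF π) :=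
  ((eq_germPushJetInf_iff hπ _ _).mpr (jetInfTangentComparison_germToJetInf hπ X.1)).symm

theorem germPushJet_germProlongation (hπ : IsFibreBundle E EB EF F π) (k : ℕ)
    (X : AutonomousField E EB π) : germPushJet k ⟨germProlongation X.1, X, rfl⟩ =
      (⟨jetProlongation k X.1, X, rfl⟩ : JetFields E EB EF π k) :=
  ((eq_germPushJet_iff hπ k ⟨_, X, rfl⟩ ⟨_, X, rfl⟩).mpr
    (funext fun γ => internalTangentMap_germToJet hπ X.1 k γ)).symm

omit [FiniteDimensional ℝ E] [FiniteDimensional ℝ EB] [T2Space M] [T2Space B] in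
theorem jetInfPushJet_jetInfProlongation (k : ℕ) (X : AutonomousField E EB π) :
    jetInfPushJet k ⟨jetInfProlongation X.1, X, rfl⟩ =
      (⟨jetProlongation k X.1, X, rfl⟩ : JetFields E EB EF π k) :=
  ((eq_jetInfPushJet_iff k _ _).mpr fun _ => rfl).symm

theorem jetPushJet_jetProlongation (hπ : IsFibreBundle E EB EF F π) {l k : ℕ} (h : l ≤ k)
    (X : AutonomousField E EB π) : jetPushJet l k h ⟨jetProlongation k X.1, X, rfl⟩ =
      (⟨jetProlongation l X.1, X, rfl⟩ : JetFields E EB EF π l) :=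
  ((eq_jetPushJet_iff hπ l k h ⟨_, X, rfl⟩ ⟨_, X, rfl⟩).mpr
    (funext fun θ => internalTangentMap_jetProj hπ X.1 h θ)).symm

theorem jetPushTotal_jetProlongation (hπ : IsFibreBundle E EB EF F π)
    (X : AutonomousField E EB π) :
    jetPushTotal (⟨jetProlongation 0 X.1, X, rfl⟩ : JetFields E EB EF π 0) = X :=
  ((eq_jetPushTotal_iff hπ _ _).mpr (toTangentBundle_jetProlongation hπ X.1 0)).symm

end Tower

end GermBundle

/-! ### Assembly of the proposition. -/

theorem proposition3 {E EB EF M B F : Type*}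
    [NormedAddCommGroup E] [NormedSpace ℝ E] [FiniteDimensional ℝ E]
    [NormedAddCommGroup EB] [NormedSpace ℝ EB] [FiniteDimensional ℝ EB]
    [NormedAddCommGroup EF] [NormedSpace ℝ EF] [FiniteDimensional ℝ EF]
    [TopologicalSpace M] [ChartedSpace E M] [IsManifold 𝓘(ℝ, E) ∞ M] [T2Space M]
    [TopologicalSpace B] [ChartedSpace EB B] [IsManifold 𝓘(ℝ, EB) ∞ B] [T2Space B]
    [TopologicalSpace F] [ChartedSpace EF F] [IsManifold 𝓘(ℝ, EF) ∞ F] [T2Space F]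
    (π : B → M) (hπ : IsFibreBundle E EB EF F π) :
    -- the projections of the tower are smooth
    ∃ (hg : ∀ k : ℕ, DSmooth (germToJet E EB EF π k))
      (hinf : DSmooth (germToJetInf E EB EF π))
      (hB : DSmooth (jetValue : Jet E EB EF π 0 → AsDiffeological EB B)),
    -- the curves of germs and of jets defining the prolongations of a possibly time-dependent
    -- projectable field are given by the flows, are smooth, and define the prolongations
    -- independently of the chosen sections
    (∀ (X : ProjectableField E EB π) (p : PointedSection E EB π),
      (∀ᶠ t in 𝓝 (0 : ℝ), IsTransport X p t (transport X p t)) ∧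
      IsSmoothCurveAt (fun t => germ (transport X p t)) (germ p) ∧
      germProlongation X (germ p) =
        ⟨germ p, velocityAt (germ p) (fun t => germ (transport X p t))⟩ ∧
      ∀ k : ℕ, IsSmoothCurveAt (fun t => jet EF k (transport X p t)) (jet EF k p) ∧
        jetProlongation k X (jet EF k p) =
          ⟨jet EF k p, velocityAt (jet EF k p) (fun t => jet EF k (transport X p t))⟩) ∧
    (∀ (X : ProjectableField E EB π) (θ : JetInf E EB EF π),
      jetInfProlongation X θ ∈ jetInfTangent E EB EF π) ∧
    -- `dπ^{k,g} ∘ 𝔭ᵍ(X) = 𝔭ᵏ(X) ∘ π^{k,g}` for finite `k`, for `k = ∞`, and on `Γ_0(π) = B`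
    (∀ (X : ProjectableField E EB π) (k : ℕ),
      internalTangentMap (hg k) ∘ germProlongation X = jetProlongation k X ∘ germToJet E EB EF π k) ∧
    (∀ X : ProjectableField E EB π,
      jetInfTangentComparison E EB EF π ∘ internalTangentMap hinf ∘ germProlongation X =
        jetInfProlongation X ∘ germToJetInf E EB EF π) ∧
    (∀ (X : ProjectableField E EB π) (γ : Germ E EB π),
      toTangentBundle (internalTangentMap (hB.comp (hg 0)) (germProlongation X γ)) =
        (⟨jetValue (germToJet E EB EF π 0 γ), X.total 0 (jetValue (germToJet E EB EF π 0 γ))⟩ :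
          TangentBundle 𝓘(ℝ, EB) B)) ∧
    -- the tower of pushforward maps
    ∃ (pushInf : GermFields E EB π → JetInfFields E EB EF π)
      (push : ∀ k, GermFields E EB π → JetFields E EB EF π k)
      (jetPushInf : ∀ k, JetInfFields E EB EF π → JetFields E EB EF π k)
      (jetPush : ∀ (l k : ℕ), l ≤ k → JetFields E EB EF π k → JetFields E EB EF π l)
      (pushB : JetFields E EB EF π 0 → AutonomousField E EB π),
      -- each map sends a field to the unique field to which it projects
      (∀ V W, W = pushInf V ↔
        jetInfTangentComparison E EB EF π ∘ internalTangentMap hinf ∘ V.1 =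
          W.1 ∘ germToJetInf E EB EF π) ∧
      (∀ k V W, W = push k V ↔ internalTangentMap (hg k) ∘ V.1 = W.1 ∘ germToJet E EB EF π k) ∧
      (∀ k V W, W = jetPushInf k V ↔ ∀ θ, V.1 θ k = W.1 (jetInfProj E EB EF π k θ)) ∧
      (∀ l k (h : l ≤ k) V W, W = jetPush l k h V ↔
        internalTangentMap (dSmooth_jetProj E EB EF π h) ∘ V.1 = W.1 ∘ jetProj E EB EF π h) ∧
      (∀ V W, W = pushB V ↔ ∀ θ, toTangentBundle (internalTangentMap hB (V.1 θ)) =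
        (⟨jetValue θ, W.1.total 0 (jetValue θ)⟩ : TangentBundle 𝓘(ℝ, EB) B)) ∧
      -- the maps of the tower are compatible with each other
      (∀ k, jetPushInf k ∘ pushInf = push k) ∧
      (∀ l k (h : l ≤ k), jetPush l k h ∘ push k = push l) ∧
      (∀ l k (h : l ≤ k), jetPush l k h ∘ jetPushInf k = jetPushInf l) ∧
      (∀ j l k (h : j ≤ l) (h' : l ≤ k),
        jetPush j l h ∘ jetPush l k h' = jetPush j k (h.trans h')) ∧
      -- and with the prolongation operators
      (∀ X : AutonomousField E EB π,
        pushInf ⟨germProlongation X.1, X, rfl⟩ = ⟨jetInfProlongation X.1, X, rfl⟩ ∧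
        (∀ k, push k ⟨germProlongation X.1, X, rfl⟩ = ⟨jetProlongation k X.1, X, rfl⟩) ∧
        (∀ k, jetPushInf k ⟨jetInfProlongation X.1, X, rfl⟩ = ⟨jetProlongation k X.1, X, rfl⟩) ∧
        (∀ l k (h : l ≤ k), jetPush l k h ⟨jetProlongation k X.1, X, rfl⟩ =
          ⟨jetProlongation l X.1, X, rfl⟩) ∧
        pushB ⟨jetProlongation 0 X.1, X, rfl⟩ = X) := by 
  refine ⟨fun k => dSmooth_germToJet k, dSmooth_germToJetInf, hπ.dSmooth_jetValue 0,
    fun X p => ⟨eventually_isTransport_transport hπ.smooth X p,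
      isSmoothCurveAt_germ_transport hπ.smooth X p, germProlongation_germ hπ.smooth X p,
      fun k => ⟨isSmoothCurveAt_jet_transport hπ.smooth X k p, jetProlongation_jet hπ X k p⟩⟩,
    jetInfProlongation_mem hπ, fun X k => funext (internalTangentMap_germToJet hπ X k),
    jetInfTangentComparison_germToJetInf hπ, fun X γ => ?_,
    germPushJetInf, germPushJet, jetInfPushJet, jetPushJet, jetPushTotal,
    eq_germPushJetInf_iff hπ, eq_germPushJet_iff hπ, eq_jetInfPushJet_iff, eq_jetPushJet_iff hπ,
    eq_jetPushTotal_iff hπ, fun k => funext ?_, fun l k h => funext ?_, fun l k h => funext ?_,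
    fun j l k h h' => funext ?_,
    fun X => ⟨germPushJetInf_germProlongation hπ X, fun k => germPushJet_germProlongation hπ k X,
      fun k => jetInfPushJet_jetInfProlongation k X,
      fun l k h => jetPushJet_jetProlongation hπ h X, jetPushTotal_jetProlongation hπ X⟩⟩
  · rw [internalTangentMap_comp _ (dSmooth_germToJet 0), internalTangentMap_germToJet hπ]
    exact toTangentBundle_jetProlongation hπ X 0 _
  -- Every field in the tower is a prolongation of some X, and each pushforward sends a prolongation
  -- of X to a prolongation of the same X. Compatibility is then immediate.
  · rintro ⟨_, X, rfl⟩
    simp only [Function.comp_apply, germPushJetInf_germProlongation hπ,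
      germPushJet_germProlongation hπ, jetInfPushJet_jetInfProlongation]
  · rintro ⟨_, X, rfl⟩
    simp only [Function.comp_apply, germPushJet_germProlongation hπ,
      jetPushJet_jetProlongation hπ]
  · rintro ⟨_, X, rfl⟩
    simp only [Function.comp_apply, jetInfPushJet_jetInfProlongation,
      jetPushJet_jetProlongation hπ]
  · rintro ⟨_, X, rfl⟩
    simp only [Function.comp_apply, jetPushJet_jetProlongation hπ]
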